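/- Let $F$ be a closed connected oriented surface of genus $g\ge 2$ (so $H_1(F;\mathbb Z)\cong\mathbb Z^{2g}$), let $0<\delta_0<\lambda$ and $\delta>0$ be real numbers, and let $T_\lambda=\{(x,v)\in\mathbb R\times S^1: |x|\le\lambda\}$ be embedded in $F$ so that the image of $\{|x|<\lambda\}$ is open and the vanishing cycle $\{x=0\}$ is non-separating (its complement in $F$ is connected). Put $S=F\setminus\{|x|<\lambda-\delta_0\}$ and let $D=\{z\in\mathbb C:|z|\le\delta\}$. On $\mathbb C^2$ let $\pi(x_1,x_2)=x_1^2+x_2^2$, let $$E=\{\mathbf x\in\mathbb C^2 : |\mathbf x|^4-|\pi(\mathbf x)|^2\le 4\lambda^2,\ |\pi(\mathbf x)|\le\delta\},$$ write $w_\pm=x_1\pm i x_2$, and let $\Phi(\mathbf x)=(\pi(\mathbf x),(x,v))\in\mathbb C\times(\mathbb R\times S^1)$, where $x=\frac14(|w_+|^2-|w_-|^2)$ and $v=w_+/|w_+|$ if $x>0$, $v=\overline{w_-}/|w_-|$ if $x<0$. The elementary Lefschetz fibration $\pi_X:X\to D$ is obtained by gluing $E$ (with the map $\pi$) and $D\times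 S$ (with the projection to $D$), identifying via $\Phi$ the collar $\{\lambda-\delta_0\le|x|\le\lambda\}$ of the horizontal boundary of $E$ with $D\times\{(x,v)\in T_\lambda:\lambda-\delta_0\le |x|\le\lambda\}\subset D\times S$. Its generic fiber is a copy of $F$; write $\partial X=\pi_X^{-1}(\partial D)$. Then, for singular homology: 1. $H_2(X;\mathbb Z)\cong\mathbb Z$, generated by the class of the fiber: for every $z\in D\setminus\{0\}$ the fiber $F_z=\pi_X^{-1}(z)$ has $H_2(F_z;\mathbb Z)\cong\mathbb Z$, and the image in $H_2(X;\mathbb Z)$ of any generator of $H_2(F_z;\mathbb Z)$ generates $H_2(X;\mathbb Z)$; 2. $H_2(X,\partial X;\mathbb Z)\cong\mathbb Z$; 3. $H_1(X;\mathbb Z)\cong\mathbb Z^{2g-1}$. -/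

import Mathlib

open CategoryTheory CategoryTheory.Limits AlgebraicTopology Topology

noncomputable section

namespace ElemLefschetz

/-! ### Integral singular homology -/

/-- The singular chain complex of a space, with integer coefficients, as a functor. -/
abbrev chainsFunctor : TopCat.{0} ⥤ ChainComplex (ModuleCat.{0} ℤ) ℕ :=
  (singularChainComplexFunctor (ModuleCat.{0} ℤ)).obj (ModuleCat.of ℤ ℤ)

/-- Singular homology `H_n(X; ℤ)`. -/
abbrev H (n : ℕ) (X : Type) [TopologicalSpace X] : ModuleCat.{0} ℤ :=
  ((singularHomologyFunctor (ModuleCat.{0} ℤ) n).obj (ModuleCat.of ℤ ℤ)).obj (TopCat.of X)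

/-- The inclusion of a subspace. -/
abbrev incl {X : Type} [TopologicalSpace X] (A : Set X) : TopCat.of A ⟶ TopCat.of X :=
  TopCat.ofHom ⟨Subtype.val, continuous_subtype_val⟩

/-- The inclusion of a subspace into a larger one. -/
abbrev inclOfSubset {X : Type} [TopologicalSpace X] {A B : Set X} (h : A ⊆ B) :
    TopCat.of A ⟶ TopCat.of B :=
  TopCat.ofHom ⟨Set.inclusion h, continuous_inclusion h⟩

/-- The map `H_n(A; ℤ) → H_n(X; ℤ)` induced by the inclusion of a subspace. -/
def pushforward (n : ℕ) {X : Type} [TopologicalSpace X] (A : Set X) : H n A ⟶ H n X :=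
  ((singularHomologyFunctor (ModuleCat.{0} ℤ) n).obj (ModuleCat.of ℤ ℤ)).map (incl A)

/-- The relative singular chain complex `C(X) / C(A)`. -/
def relChains {X : Type} [TopologicalSpace X] (A : Set X) : ChainComplex (ModuleCat.{0} ℤ) ℕ :=
  cokernel (chainsFunctor.map (incl A))

/-- Relative singular homology `H_n(X, A; ℤ)`. -/
def relH (n : ℕ) {X : Type} [TopologicalSpace X] (A : Set X) : ModuleCat.{0} ℤ :=
  (relChains A).homology n

/-- The map `C(X) / C(A) → C(X) / C(B)` for `A ⊆ B`. -/
def relChainsMap {X : Type} [TopologicalSpace X] {A B : Set X} (h : A ⊆ B) :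
    relChains A ⟶ relChains B :=
  cokernel.map (chainsFunctor.map (incl A)) (chainsFunctor.map (incl B))
    (chainsFunctor.map (inclOfSubset h)) (𝟙 _) (by
      rw [Category.comp_id, ← Functor.map_comp]
      rfl)

/-- The map `H_n(X, A; ℤ) → H_n(X, B; ℤ)` for `A ⊆ B`. -/
def relHMap (n : ℕ) {X : Type} [TopologicalSpace X] {A B : Set X} (h : A ⊆ B) :
    relH n A ⟶ relH n B :=
  HomologicalComplex.homologyMap (relChainsMap h) n

/-- `c` generates the abelian group `M`. -/
def IsGenerator {M : Type} [AddCommGroup M] (c : M) : Prop :=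
  AddSubgroup.zmultiples c = ⊤

/-! ### Closed oriented surfaces -/

/-- Orientability of a topological `n`-manifold `M`: there is a choice of a generator `μ x` of
every local homology group `H_n(M, M ∖ {x}; ℤ)` which is locally consistent, i.e. every point has
a neighbourhood `U` and a class in `H_n(M, M ∖ U; ℤ)` that restricts to `μ y` for all `y ∈ U`. -/
def IsOrientable (n : ℕ) (M : Type) [TopologicalSpace M] : Prop :=
  ∃ μ : ∀ x : M, relH n ({x}ᶜ : Set M),
    (∀ x, IsGenerator (μ x)) ∧
    ∀ x : M, ∃ U ∈ 𝓝 x, ∃ c : relH n (Uᶜ : Set M), ∀ (y : M) (hy : y ∈ U),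
      relHMap n (Set.compl_subset_compl.mpr (Set.singleton_subset_iff.mpr hy)) c = μ y

/-- `F` is a closed connected oriented surface of genus `g`: a nonempty connected compact Hausdorff
orientable topological 2-manifold whose first homology is free abelian of rank `2 g`. -/
structure IsClosedSurface (F : Type) [TopologicalSpace F] (g : ℕ) : Prop where
  compact : CompactSpace F
  connected : ConnectedSpace F
  hausdorff : T2Space F
  locally_euclidean : Nonempty (ChartedSpace (EuclideanSpace ℝ (Fin 2)) F)
  orientable : IsOrientable 2 F
  genus : Nonempty (H 1 F ≃+ (Fin (2 * g) → ℤ))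

/-- An embedding of the cylinder `T_lam = {(x, v) ∈ ℝ × S¹ : |x| ≤ lam}` in a surface `F`, as a
neighbourhood of the vanishing cycle `{x = 0}`; only the values on `T_lam` matter. -/
structure CylinderEmbedding (F : Type) [TopologicalSpace F] (lam : ℝ) where
  toFun : ℝ × Circle → F
  continuousOn : ContinuousOn toFun {q | |q.1| ≤ lam}
  injOn : Set.InjOn toFun {q | |q.1| ≤ lam}
  isOpen_image : IsOpen (toFun '' {q | |q.1| < lam})

/-- The vanishing cycle, i.e. the image of the zero section of the cylinder. -/
def CylinderEmbedding.vanishingCycle {F : Type} [TopologicalSpace F] {lam : ℝ}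
    (ι : CylinderEmbedding F lam) : Set F :=
  ι.toFun '' {q | q.1 = 0}

/-- The complementary surface `S ⊆ F`, with `F = S ∪ T_lam`. It contains the closed collar
`{lam - d₀ ≤ |x| ≤ lam}` of its boundary. -/
def CylinderEmbedding.complement {F : Type} [TopologicalSpace F] {lam : ℝ}
    (ι : CylinderEmbedding F lam) (d₀ : ℝ) : Set F :=
  (ι.toFun '' {q | |q.1| < lam - d₀})ᶜ

/-! ### The local model -/

/-- The quadratic map `(x₁, x₂) ↦ x₁² + x₂²`. -/
def localPi (p : ℂ × ℂ) : ℂ := p.1 ^ 2 + p.2 ^ 2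

/-- The part `E` of the local model: `|p|⁴ - |π(p)|² ≤ 4 lam²` and `|π(p)| ≤ δ`. -/
def E (lam δ : ℝ) : Set (ℂ × ℂ) :=
  {p | (‖p.1‖ ^ 2 + ‖p.2‖ ^ 2) ^ 2 - ‖localPi p‖ ^ 2 ≤ 4 * lam ^ 2 ∧ ‖localPi p‖ ≤ δ}

/-- `w₊ = x₁ + i x₂`. -/
def wPlus (p : ℂ × ℂ) : ℂ := p.1 + Complex.I * p.2

/-- `w₋ = x₁ - i x₂`, so that `π = w₊ w₋`. -/
def wMinus (p : ℂ × ℂ) : ℂ := p.1 - Complex.I * p.2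

/-- The coordinate `x ∈ ℝ` of the cylinder component of the trivialisation
`Φ : ℂ² ∖ Σ → ℂ × (T ∖ T₀)`; one has `4 x² = |p|⁴ - |π(p)|²`, and `Σ = {x = 0}` is the union of
the vanishing cycles. -/
def cylX (p : ℂ × ℂ) : ℝ := (‖wPlus p‖ ^ 2 - ‖wMinus p‖ ^ 2) / 4

open Classical in
/-- The cylinder component of `Φ`, in the coordinates `(x, v) ∈ ℝ × S¹`, for `p ∉ Σ`:
`v = w₊ / |w₊|` where `x > 0`, and `v` is the conjugate of `w₋ / |w₋|` where `x < 0`. If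
`π(p) = r exp(2 π i t)` and `exp(- π i t) p = a + i b` with `a, b ∈ ℝ²`, this is the image of the
covector `u = - |a| b` at `v = a / |a|` under the normalised geodesic flow at time `t / 2`; see
`coe_cyl_snd` for the comparison. -/
def cyl (p : ℂ × ℂ) : ℝ × Circle :=
  (cylX p,
    if 0 < cylX p then Circle.exp (Complex.arg (wPlus p))
    else Circle.exp (-Complex.arg (wMinus p)))

/-- Comparison of `cyl` with the trivialisation `Φ` written through the geodesic flow: if
`π(p) = |π(p)| exp(2 π i t)` and `exp(- π i t) p = a + i b` with `a, b ∈ ℝ² = ℂ`, then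
`v = a / |a|`, `u = - |a| b` is the covector `u = i x v` with `x = cylX p`, and the circle
component of `cyl p` is obtained from `v` by moving a time `t / 2`, i.e. an angle `± π t`, in the
direction of `u`. -/
theorem coe_cyl_snd (p : ℂ × ℂ) (t : ℝ) (hx : cylX p ≠ 0)
    (ht : localPi p = ‖localPi p‖ * Complex.exp (2 * Real.pi * t * Complex.I))
    (h₁ h₂ a b : ℂ)
    (hh₁ : h₁ = Complex.exp (-(Real.pi * t * Complex.I)) * p.1)
    (hh₂ : h₂ = Complex.exp (-(Real.pi * t * Complex.I)) * p.2)
    (ha : a = h₁.re + h₂.re * Complex.I) (hb : b = h₁.im + h₂.im * Complex.I) :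
    -(‖a‖ : ℂ) * b = Complex.I * cylX p * (a / ‖a‖) ∧
    ((cyl p).2 : ℂ) =
      Complex.exp (SignType.sign (cylX p) * Real.pi * t * Complex.I) * (a / ‖a‖) := by
  set e : ℂ := Complex.exp (Real.pi * t * Complex.I) with he
  have hee : Complex.exp (-(Real.pi * t * Complex.I)) * e = 1 := by
    rw [he, ← Complex.exp_add]; simp
  have hne : ‖e‖ = 1 := by
    have := Complex.norm_exp_ofReal_mul_I (Real.pi * t)
    simpa [he] using this
  have he2 : Complex.exp (2 * Real.pi * t * Complex.I) = e * e := by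
    rw [he, ← Complex.exp_add]; ring_nf
  have hp1 : p.1 = e * h₁ := by rw [hh₁]; linear_combination (-p.1) * hee
  have hp2 : p.2 = e * h₂ := by rw [hh₂]; linear_combination (-p.2) * hee
  have hab : h₁ + Complex.I * h₂ = a + Complex.I * b := by
    apply Complex.ext <;> simp [ha, hb] <;> ring
  have hab' : h₁ - Complex.I * h₂ = star a + Complex.I * star b := by
    apply Complex.ext <;> simp [ha, hb] <;> ring
  have hwp : wPlus p = e * (a + Complex.I * b) := by
    rw [← hab, wPlus, hp1, hp2]; ring
  have hwm : wMinus p = e * (star a + Complex.I * star b) := by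
    rw [← hab', wMinus, hp1, hp2]; ring
  have hxx : cylX p = a.im * b.re - a.re * b.im := by
    rw [cylX, hwp, hwm, norm_mul, norm_mul, hne, one_mul, one_mul, ← Complex.normSq_eq_norm_sq,
      ← Complex.normSq_eq_norm_sq, Complex.normSq_apply, Complex.normSq_apply]
    simp
    ring
  have hr : h₁ ^ 2 + h₂ ^ 2 = ‖localPi p‖ := by
    have h0 : e * e ≠ 0 := by rw [← he2]; exact Complex.exp_ne_zero _
    apply mul_left_cancel₀ h0
    rw [he2] at ht
    rw [mul_comm _ (‖localPi p‖ : ℂ), ← ht, localPi, hp1, hp2]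
    ring
  have hperp : a.re * b.re + a.im * b.im = 0 := by
    have := congrArg Complex.im hr
    simp [pow_two] at this
    simp [ha, hb]
    linarith
  have ha0 : a ≠ 0 := by
    rintro rfl
    simp at hxx
    exact hx hxx
  have hna : (0 : ℝ) < ‖a‖ := norm_pos_iff.mpr ha0
  have hnac : (‖a‖ : ℂ) ≠ 0 := by exact_mod_cast hna.ne'
  have hn2 : ‖a‖ ^ 2 = a.re * a.re + a.im * a.im := by
    rw [← Complex.normSq_eq_norm_sq, Complex.normSq_apply]
  have hn2c : (‖a‖ : ℂ) ^ 2 = a * star a := by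
    rw [← Complex.ofReal_pow, ← Complex.normSq_eq_norm_sq, ← Complex.mul_conj]; rfl
  have hbx : (‖a‖ : ℂ) ^ 2 * b = -(Complex.I * cylX p * a) := by
    rw [← Complex.ofReal_pow, hn2, hxx]
    apply Complex.ext
    · simp
      linear_combination (a.re) * hperp
    · simp
      linear_combination (a.im) * hperp
  have hbx' : (‖a‖ : ℂ) ^ 2 * star b = Complex.I * cylX p * star a := by
    have := congrArg star hbx
    simpa using this
  refine ⟨?_, ?_⟩
  · field_simp
    linear_combination -hbx
  · have key : ∀ (w d : ℂ) (s : ℝ), 0 < s → ‖d‖ = 1 → w = s * d →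
        Complex.exp (Complex.arg w * Complex.I) = d := by
      intro w d s hs hd hw
      have h := Complex.norm_mul_exp_arg_mul_I w
      have hnw : ‖w‖ = s := by
        rw [hw, norm_mul, hd, Complex.norm_real, Real.norm_of_nonneg hs.le, mul_one]
      rw [hnw] at h
      have hs' : (s : ℂ) ≠ 0 := by exact_mod_cast hs.ne'
      apply mul_left_cancel₀ hs'
      rw [h, hw]
    rcases lt_or_gt_of_ne hx with hneg | hpos
    · have hk := key (wMinus p) (e * (star a / ‖a‖)) (‖a‖ - cylX p / ‖a‖)
        (by have := div_neg_of_neg_of_pos hneg hna; linarith)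
        (by rw [norm_mul, norm_div, norm_star, hne]; simp [hna.ne'])
        (by
          rw [hwm]
          push_cast
          field_simp
          linear_combination e * Complex.I * hbx' + e * cylX p * star a * Complex.I_sq)
      have hk2 := congrArg star hk
      simp only [cyl, if_neg (not_lt.mpr hneg.le), Circle.coe_exp]
      rw [sign_neg hneg]
      have hl : star (Complex.exp (Complex.arg (wMinus p) * Complex.I)) =
          Complex.exp (((-Complex.arg (wMinus p) : ℝ) : ℂ) * Complex.I) := by
        change (starRingEnd ℂ) _ = _
        rw [← Complex.exp_conj]; simp
      have hle : star e = Complex.exp (((SignType.neg : SignType) : ℂ) * Real.pi * t * Complex.I) := by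
        change (starRingEnd ℂ) _ = _
        rw [he, ← Complex.exp_conj]; simp
      rw [← hl, hk2]
      change _ = Complex.exp (((SignType.neg : SignType) : ℂ) * Real.pi * t * Complex.I) * _
      rw [← hle]
      simp
    · have hk := key (wPlus p) (e * (a / ‖a‖)) (‖a‖ + cylX p / ‖a‖) (by positivity)
        (by rw [norm_mul, norm_div, hne]; simp [hna.ne'])
        (by
          rw [hwp]
          push_cast
          field_simp
          linear_combination e * Complex.I * hbx - e * cylX p * a * Complex.I_sq)
      simp only [cyl, if_pos hpos, Circle.coe_exp]
      rw [sign_pos hpos, hk, he]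
      simp

/-! ### The total space -/

section Total

variable {F : Type} [TopologicalSpace F] {lam : ℝ}

/-- The trivial piece `D × S`, where `D` is the closed disk of radius `δ` about `0`. -/
abbrev TrivialPart (ι : CylinderEmbedding F lam) (δ d₀ : ℝ) : Type :=
  Metric.closedBall (0 : ℂ) δ × ι.complement d₀

/-- The gluing of the collar `{lam - d₀ ≤ |x|} ⊆ E` of the horizontal boundary with
`D × (collar of ∂S)` through the trivialisation `Φ = (π, cyl)`. -/
inductive Glue (ι : CylinderEmbedding F lam) (δ d₀ : ℝ) :
    E lam δ ⊕ TrivialPart ι δ d₀ → E lam δ ⊕ TrivialPart ι δ d₀ → Prop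
  | mk (e : E lam δ) (s : TrivialPart ι δ d₀) (hcollar : lam - d₀ ≤ |cylX e|)
      (hbase : (s.1 : ℂ) = localPi e) (hfibre : (s.2 : F) = ι.toFun (cyl e)) :
      Glue ι δ d₀ (Sum.inl e) (Sum.inr s)

/-- The total space `X = E ∪ (D × S)` of the elementary Lefschetz fibration, with the quotient
topology. -/
def TotalSpace (ι : CylinderEmbedding F lam) (δ d₀ : ℝ) : Type :=
  Quot (Glue ι δ d₀)

instance (ι : CylinderEmbedding F lam) (δ d₀ : ℝ) : TopologicalSpace (TotalSpace ι δ d₀) :=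
  inferInstanceAs (TopologicalSpace (Quot (Glue ι δ d₀)))

/-- The Lefschetz fibration `π_X : X → D ⊆ ℂ`. -/
def proj (ι : CylinderEmbedding F lam) (δ d₀ : ℝ) : TotalSpace ι δ d₀ → ℂ :=
  Quot.lift (Sum.elim (fun e => localPi e) (fun s => (s.1 : ℂ))) (by
    rintro _ _ ⟨e, s, -, hbase, -⟩
    exact hbase.symm)

/-- The fibre of `π_X` over `z`. -/
def fibre (ι : CylinderEmbedding F lam) (δ d₀ : ℝ) (z : ℂ) : Set (TotalSpace ι δ d₀) :=
  {p | proj ι δ d₀ p = z}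

/-- The boundary `Y = ∂X = π_X⁻¹(∂D)`. -/
def boundary (ι : CylinderEmbedding F lam) (δ d₀ : ℝ) : Set (TotalSpace ι δ d₀) :=
  {p | ‖proj ι δ d₀ p‖ = δ}

end Total

end ElemLefschetz

end

/-! Homologically, X is the surface F with a disk glued along the vanishing cycle V. In the
coordinates w₊, w₋ one has π = w₊w₋, and scaling by t ∈ [0, 1] multiplies both π and x by t². So the
neighbourhood {|x| < b} of the vanishing cycles (`nearV`) is star-shaped, hence contractible
(`nearV_contractible`). Off {x = 0}, Φ exhibits X as the product D × (F ∖ V) (`trivHomeo`).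
Therefore, in degrees n ≥ 1, H_n(X) ≅ H_n(X, nearV); excising {x = 0} and contracting D turns this
into H_n(F, U) for a thin open cylinder U, which deforms to V. Altogether H_n(X) ≅ H_n(F, V). The
comparison is induced by an embedding of F as a regular fibre (`Hmap_fibC_bijective`), equal to the
trivialisation outside a thin cylinder and twisted inside it, so the fibre class is kept track of.

On the surface, degree-two classes relative to the complement of a compact set are detected by their
restrictions to the local homology of points, and vanishing of the restriction spreads over
connected sets. Since F ∖ V is connected, H_2(F) → H_2(F, V) is bijective (`Hres_two_bijective`), so
a regular fibre carries H_2(X). The connecting map H_2(F, V) → H_1(V) is then zero and H_1(V)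
injects into H_1(F). The same holds modulo every prime p, because F has a mod p fundamental class.
If [V] were p times a class, it would vanish modulo p; so [V] is indivisible and H_1(X) ≅ H_1(F)/[V]
is free of rank 2g - 1 (`Hr_one_curve_equiv`).

For the boundary, the lifted radial flow deforms the complement of the central fibre to ∂X
(`Hres_boundary_bijective`). The critical point has a neighbourhood that is an open subset of ℂ², so
its local homology vanishes in degrees 2 and 3 and it can be removed (`Hr_compl_crit_subsingleton`).
The rest of the central fibre lies in the product part, and excision with a double suspension gives
H_2(X, ∂X) ≅ H_0(F ∖ V) ≅ ℤ (`Hr_two_boundary_equiv`).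

The general tools are built on the way: the sequence of a triple, homotopy invariance for pairs,
excision by barycentric subdivision (`Hmap_excision`), compact supports, and the fundamental class
of a closed oriented surface. Coefficients are kept general because both ℤ and ℤ/p are used. -/

noncomputable section

namespace ElemLefschetz

/-! ### Relative singular homology with coefficients -/

section Relative

variable (R : ModuleCat.{0} ℤ)

/-- Singular chains with coefficients in `R`. -/
abbrev Chains (X : Type) [TopologicalSpace X] : ChainComplex (ModuleCat.{0} ℤ) ℕ :=
  ((singularChainComplexFunctor (ModuleCat.{0} ℤ)).obj R).obj (TopCat.of X)

variable {X Y Z : Type} [TopologicalSpace X] [TopologicalSpace Y] [TopologicalSpace Z]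

/-- The map induced on singular chains by a continuous map. -/
abbrev Chains.map (f : C(X, Y)) : Chains R X ⟶ Chains R Y :=
  ((singularChainComplexFunctor (ModuleCat.{0} ℤ)).obj R).map (TopCat.ofHom f)

lemma Chains.map_comp (f : C(X, Y)) (g : C(Y, Z)) :
    Chains.map R (g.comp f) = Chains.map R f ≫ Chains.map R g := by
  rw [Chains.map, Chains.map, Chains.map, ← Functor.map_comp]; rfl

lemma Chains.map_id : Chains.map R (ContinuousMap.id X) = 𝟙 _ :=
  CategoryTheory.Functor.map_id _ _

/-- The inclusion of a subset as a continuous map. -/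
abbrev subIncl (A : Set X) : C(A, X) := ⟨Subtype.val, continuous_subtype_val⟩

/-- The restriction of a continuous map to subsets. -/
abbrev subMap (f : C(X, Y)) {A : Set X} {B : Set Y} (h : Set.MapsTo f A B) : C(A, B) :=
  ⟨h.restrict, f.continuous.restrict h⟩

lemma Chains.mono_map (f : C(X, Y)) (hf : Function.Injective f) : Mono (Chains.map R f) := by
  have : Mono (TopCat.ofHom f) := by rwa [TopCat.mono_iff_injective]
  exact inferInstanceAs (Mono (((singularChainComplexFunctor (ModuleCat.{0} ℤ)).obj R).map _))

lemma Chains.map_f_injective (f : C(X, Y)) (hf : Function.Injective f) (n : ℕ) :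
    Function.Injective ((Chains.map R f).f n) := by
  have := Chains.mono_map R f hf
  rw [← ModuleCat.mono_iff_injective]
  infer_instance

/-- Relative singular chains with coefficients in `R`. -/
def relC (A : Set X) : ChainComplex (ModuleCat.{0} ℤ) ℕ := cokernel (Chains.map R (subIncl A))

/-- The projection from chains to relative chains. -/
def relC.π (A : Set X) : Chains R X ⟶ relC R A := cokernel.π (Chains.map R (subIncl A))

instance (A : Set X) : Epi (relC.π R A) := inferInstanceAs (Epi (cokernel.π _))

lemma relC.π_surjective (A : Set X) (n : ℕ) : Function.Surjective ((relC.π R A).f n) := by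
  rw [← ModuleCat.epi_iff_surjective]
  infer_instance

lemma relC.π_eq_zero_iff (A : Set X) (n : ℕ) (c : (Chains R X).X n) :
    (relC.π R A).f n c = 0 ↔ ∃ a, (Chains.map R (subIncl A)).f n a = c := by
  have h := (ShortComplex.exact_cokernel (Chains.map R (subIncl A))).map
    (HomologicalComplex.eval _ _ n)
  rw [ShortComplex.moduleCat_exact_iff] at h
  refine ⟨fun hc => h c hc, ?_⟩
  rintro ⟨a, rfl⟩
  have := congr($(cokernel.condition (Chains.map R (subIncl A))).f n)
  exact congr($this a)

/-- The map on relative chains induced by a map of pairs. -/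
def relC.map (f : C(X, Y)) {A : Set X} {B : Set Y} (h : Set.MapsTo f A B) :
    relC R A ⟶ relC R B :=
  cokernel.map _ _ (Chains.map R (subMap f h)) (Chains.map R f) (by
    rw [← Chains.map_comp, ← Chains.map_comp]; rfl)

@[simp]
lemma relC.π_map (f : C(X, Y)) {A : Set X} {B : Set Y} (h : Set.MapsTo f A B) :
    relC.π R A ≫ relC.map R f h = Chains.map R f ≫ relC.π R B :=
  cokernel.π_desc _ _ _

@[simp]
lemma relC.π_map_assoc (f : C(X, Y)) {A : Set X} {B : Set Y} (h : Set.MapsTo f A B)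
    {K : ChainComplex (ModuleCat.{0} ℤ) ℕ} (k : relC R B ⟶ K) :
    relC.π R A ≫ relC.map R f h ≫ k = Chains.map R f ≫ relC.π R B ≫ k := by
  rw [← Category.assoc, relC.π_map, Category.assoc]

lemma relC.map_comp (f : C(X, Y)) (g : C(Y, Z)) {A : Set X} {B : Set Y} {D : Set Z}
    (h : Set.MapsTo f A B) (h' : Set.MapsTo g B D) :
    relC.map R (g.comp f) (h'.comp h) = relC.map R f h ≫ relC.map R g h' := by
  rw [← cancel_epi (relC.π R A)]
  simp [Chains.map_comp]

lemma relC.map_id (A : Set X) (h : Set.MapsTo (ContinuousMap.id X) A A) :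
    relC.map R (ContinuousMap.id X) h = 𝟙 _ := by
  rw [← cancel_epi (relC.π R A), relC.π_map, Chains.map_id, Category.id_comp, Category.comp_id]

lemma relC.map_comp_eq {W : Type} [TopologicalSpace W] {f : C(X, Y)} {g : C(Y, Z)} {f' : C(X, W)}
    {g' : C(W, Z)} {A : Set X} {B : Set Y} {D : Set Z} {B' : Set W} (e : g.comp f = g'.comp f')
    (h : Set.MapsTo f A B) (k : Set.MapsTo g B D) (h' : Set.MapsTo f' A B')
    (k' : Set.MapsTo g' B' D) :
    relC.map R f h ≫ relC.map R g k = relC.map R f' h' ≫ relC.map R g' k' := by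
  rw [← relC.map_comp, ← relC.map_comp]
  congr 1

lemma Chains.map_comp_eq {W : Type} [TopologicalSpace W] {f : C(X, Y)} {g : C(Y, Z)} {f' : C(X, W)}
    {g' : C(W, Z)} (e : g.comp f = g'.comp f') :
    Chains.map R f ≫ Chains.map R g = Chains.map R f' ≫ Chains.map R g' := by
  rw [← Chains.map_comp, ← Chains.map_comp, e]

/-- Relative singular homology `H_n(X, A; R)`. -/
def Hr (n : ℕ) (A : Set X) : ModuleCat.{0} ℤ := (relC R A).homology n

/-- The map induced on relative homology by a map of pairs. -/
def Hmap (n : ℕ) (f : C(X, Y)) {A : Set X} {B : Set Y} (h : Set.MapsTo f A B) :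
    Hr R n A →ₗ[ℤ] Hr R n B :=
  (HomologicalComplex.homologyMap (relC.map R f h) n).hom

variable {R} {n : ℕ}

lemma Hmap_comp (f : C(X, Y)) (g : C(Y, Z)) {A : Set X} {B : Set Y} {D : Set Z}
    (h : Set.MapsTo f A B) (h' : Set.MapsTo g B D) (x : Hr R n A) :
    Hmap R n g h' (Hmap R n f h x) = Hmap R n (g.comp f) (h'.comp h) x := by
  simp only [Hmap]
  rw [relC.map_comp, HomologicalComplex.homologyMap_comp]
  rfl

lemma Hmap_comp_eq {f : C(X, Y)} {g : C(Y, Z)} {k : C(X, Z)} (e : g.comp f = k) {A : Set X}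
    {B : Set Y} {D : Set Z} (h : Set.MapsTo f A B) (h' : Set.MapsTo g B D) (hk : Set.MapsTo k A D)
    (x : Hr R n A) : Hmap R n g h' (Hmap R n f h x) = Hmap R n k hk x := by
  subst e
  exact Hmap_comp f g h h' x

lemma Hmap_comm {W : Type} [TopologicalSpace W] {f : C(X, Y)} {g : C(Y, Z)} {f' : C(X, W)}
    {g' : C(W, Z)} (e : g.comp f = g'.comp f') {A : Set X} {B : Set Y} {D : Set Z} {B' : Set W}
    (h : Set.MapsTo f A B) (k : Set.MapsTo g B D) (h' : Set.MapsTo f' A B')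
    (k' : Set.MapsTo g' B' D) (x : Hr R n A) :
    Hmap R n g k (Hmap R n f h x) = Hmap R n g' k' (Hmap R n f' h' x) := by
  rw [Hmap_comp_eq e h k (k'.comp h'), Hmap_comp]

lemma Hmap_id (A : Set X) (h : Set.MapsTo (ContinuousMap.id X) A A) (x : Hr R n A) :
    Hmap R n (ContinuousMap.id X) h x = x := by
  simp only [Hmap]
  rw [relC.map_id, HomologicalComplex.homologyMap_id]
  rfl

/-- A homeomorphism of pairs induces a bijection on homology. -/
lemma Hmap_bijective_of_inverse (f : C(X, Y)) (g : C(Y, X)) {A : Set X} {B : Set Y}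
    (h : Set.MapsTo f A B) (h' : Set.MapsTo g B A)
    (hgf : ∀ x : Hr R n A, Hmap R n (g.comp f) (h'.comp h) x = x)
    (hfg : ∀ x : Hr R n B, Hmap R n (f.comp g) (h.comp h') x = x) :
    Function.Bijective (Hmap R n f h) := by
  refine Function.bijective_iff_has_inverse.mpr ⟨Hmap R n g h', fun x => ?_, fun x => ?_⟩
  · rw [Hmap_comp, hgf]
  · rw [Hmap_comp, hfg]

lemma Hmap_homeomorph_bijective (f : X ≃ₜ Y) {A : Set X} {B : Set Y}
    (h : ∀ x, x ∈ A ↔ f x ∈ B) :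
    Function.Bijective (Hmap R n (f : C(X, Y)) (fun x hx => (h x).1 hx)) := by
  have h' : Set.MapsTo (f.symm : C(Y, X)) B A := fun y hy => by
    have := (h (f.symm y)).2
    simp only [f.apply_symm_apply] at this
    exact this hy
  refine Hmap_bijective_of_inverse _ (f.symm : C(Y, X)) _ h' (fun x => ?_) (fun x => ?_)
  · have : (f.symm : C(Y, X)).comp (f : C(X, Y)) = ContinuousMap.id X := by ext; simp
    simp only [this]
    exact Hmap_id _ _ _
  · have : (f : C(X, Y)).comp (f.symm : C(Y, X)) = ContinuousMap.id Y := by ext; simp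
    simp only [this]
    exact Hmap_id _ _ _

/-! #### The long exact sequence of a triple -/

/-- The subset `A` of `X`, viewed as a subset of `B`. -/
abbrev inSub (B A : Set X) : Set B := Subtype.val ⁻¹' A

variable (R)

lemma subIncl_mapsTo (B A : Set X) : Set.MapsTo (subIncl B) (inSub B A) A := fun _ h => h

lemma id_mapsTo {A B : Set X} (h : A ⊆ B) : Set.MapsTo (ContinuousMap.id X) A B := h

/-- The short complex `C(B, A) → C(X, A) → C(X, B)`. -/
@[simps] def tripleSC {A B : Set X} (h : A ⊆ B) : ShortComplex (ChainComplex (ModuleCat.{0} ℤ) ℕ) where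
  X₁ := relC R (inSub B A)
  X₂ := relC R A
  X₃ := relC R B
  f := relC.map R (subIncl B) (subIncl_mapsTo B A)
  g := relC.map R (ContinuousMap.id X) (id_mapsTo h)
  zero := by
    rw [← cancel_epi (relC.π R _), relC.π_map_assoc, relC.π_map, Chains.map_id, comp_zero]
    exact cokernel.condition (Chains.map R (subIncl B))

lemma relC.π_map_apply (f : C(X, Y)) {A : Set X} {B : Set Y} (h : Set.MapsTo f A B) (n : ℕ)
    (c : (Chains R X).X n) :
    (relC.map R f h).f n ((relC.π R A).f n c) = (relC.π R B).f n ((Chains.map R f).f n c) :=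
  congr($(congr($(relC.π_map R f h).f n)) c)

lemma Chains.map_comp_apply (f : C(X, Y)) (g : C(Y, Z)) (n : ℕ) (c : (Chains R X).X n) :
    (Chains.map R (g.comp f)).f n c = (Chains.map R g).f n ((Chains.map R f).f n c) := by
  rw [Chains.map_comp]; rfl

/-- This is the third isomorphism theorem for C(A) ⊆ C(B) ⊆ C(X), checked in each degree on chain
representatives. -/
lemma tripleSC_shortExact {A B : Set X} (h : A ⊆ B) : (tripleSC R h).ShortExact := by
  refine HomologicalComplex.shortExact_of_degreewise_shortExact _ fun i => ?_
  have hinj : Function.Injective (((tripleSC R h).f).f i) := by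
    rw [← AddMonoidHom.coe_coe, injective_iff_map_eq_zero]
    intro x hx
    obtain ⟨b, rfl⟩ := relC.π_surjective R _ i x
    have hx' : (relC.map R (subIncl B) (subIncl_mapsTo B A)).f i
      ((relC.π R (inSub B A)).f i b) = 0 := hx
    rw [relC.π_map_apply, relC.π_eq_zero_iff] at hx'
    obtain ⟨a, ha⟩ := hx'
    refine (relC.π_eq_zero_iff R _ _ _).2 ?_
    -- Since A ⊆ B, the chain of A can be read inside B. There it equals `b`, because C(B) → C(X) is
    -- injective.
    let k : C(A, inSub B A) := ⟨fun a => ⟨⟨a.1, h a.2⟩, a.2⟩, by fun_prop⟩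
    refine ⟨(Chains.map R k).f i a, Chains.map_f_injective R (subIncl B) Subtype.val_injective i ?_⟩
    rw [← ha, ← Chains.map_comp_apply, ← Chains.map_comp_apply]
  have hsurj : Function.Surjective (((tripleSC R h).g).f i) := by
    intro x
    obtain ⟨c, rfl⟩ := relC.π_surjective R _ i x
    refine ⟨(relC.π R A).f i c, ?_⟩
    have := relC.π_map_apply R (ContinuousMap.id X) (id_mapsTo h) i c
    rw [Chains.map_id] at this
    exact this
  refine @ShortComplex.ShortExact.mk _ _ _ _ ?_ ((ModuleCat.mono_iff_injective _).2 hinj)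
    ((ModuleCat.epi_iff_surjective _).2 hsurj)
  rw [ShortComplex.moduleCat_exact_iff]
  intro x hx
  obtain ⟨c, rfl⟩ := relC.π_surjective R A i x
  have hx' : (relC.map R (ContinuousMap.id X) (id_mapsTo h)).f i ((relC.π R A).f i c) = 0 := hx
  rw [relC.π_map_apply, Chains.map_id] at hx'
  obtain ⟨b, hb⟩ := (relC.π_eq_zero_iff R B i c).1 hx'
  refine ⟨(relC.π R _).f i b, ?_⟩
  have := relC.π_map_apply R (subIncl B) (subIncl_mapsTo B A) i b
  rw [hb] at this
  exact this

/-- The connecting homomorphism `H_{n+1}(X, B) → H_n(B, A)` of a triple. -/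
def Hδ (n : ℕ) {A B : Set X} (h : A ⊆ B) : Hr R (n + 1) B →ₗ[ℤ] Hr R n (inSub B A) :=
  ((tripleSC_shortExact R h).δ (n + 1) n rfl).hom

variable {R}

/-- The map `H_n(X, A) → H_n(X, B)` for `A ⊆ B`. -/
abbrev Hres {A B : Set X} (h : A ⊆ B) : Hr R n A →ₗ[ℤ] Hr R n B :=
  Hmap R n (ContinuousMap.id X) (id_mapsTo h)

/-- The map `H_n(B, A) → H_n(X, A)` for `A ⊆ B`. -/
abbrev Hsub (B A : Set X) : Hr R n (inSub B A) →ₗ[ℤ] Hr R n A :=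
  Hmap R n (subIncl B) (subIncl_mapsTo B A)

lemma exact_sub_res {A B : Set X} (h : A ⊆ B) :
    Function.Exact (Hsub (R := R) (n := n) B A) (Hres h) :=
  (ShortComplex.ShortExact.moduleCat_exact_iff_function_exact _).1
    ((tripleSC_shortExact R h).homology_exact₂ n)

lemma exact_res_δ {A B : Set X} (h : A ⊆ B) :
    Function.Exact (Hres (R := R) (n := n + 1) h) (Hδ R n h) :=
  (ShortComplex.ShortExact.moduleCat_exact_iff_function_exact _).1
    ((tripleSC_shortExact R h).homology_exact₃ (n + 1) n rfl)

lemma exact_δ_sub {A B : Set X} (h : A ⊆ B) :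
    Function.Exact (Hδ R n h) (Hsub (R := R) (n := n) B A) :=
  (ShortComplex.ShortExact.moduleCat_exact_iff_function_exact _).1
    ((tripleSC_shortExact R h).homology_exact₁ (n + 1) n rfl)

variable (R) in
/-- The morphism of short complexes induced by a map of triples. -/
@[simps] def tripleSC.map (f : C(X, Y)) {A B : Set X} {A' B' : Set Y} (h : A ⊆ B) (h' : A' ⊆ B')
    (hA : Set.MapsTo f A A') (hB : Set.MapsTo f B B') : tripleSC R h ⟶ tripleSC R h' where
  τ₁ := relC.map R (subMap f hB) (fun _ ha => hA ha)
  τ₂ := relC.map R f hA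
  τ₃ := relC.map R f hB
  comm₁₂ := relC.map_comp_eq R (f := subMap f hB) (g := subIncl B') (f' := subIncl B) (g' := f)
    rfl (fun _ ha => hA ha) (subIncl_mapsTo B' A') (subIncl_mapsTo B A) hA
  comm₂₃ := relC.map_comp_eq R (f := f) (g := .id Y) (f' := .id X) (g' := f)
    rfl hA (id_mapsTo h') (id_mapsTo h) hB

lemma Hδ_naturality (f : C(X, Y)) {A B : Set X} {A' B' : Set Y} (h : A ⊆ B) (h' : A' ⊆ B')
    (hA : Set.MapsTo f A A') (hB : Set.MapsTo f B B') (x : Hr R (n + 1) B) :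
    Hδ R n h' (Hmap R (n + 1) f hB x) =
      Hmap R n (subMap f hB) (A := inSub B A) (B := inSub B' A') (fun _ ha => hA ha)
        (Hδ R n h x) :=
  congr($(HomologicalComplex.HomologySequence.δ_naturality (tripleSC.map R f h h' hA hB)
    (tripleSC_shortExact R h) (tripleSC_shortExact R h') (n + 1) n rfl) x).symm

/-! #### Homotopy invariance -/

variable (R) in
/-- A continuous map that is invertible up to homotopy induces a quasi-isomorphism. -/
lemma Chains.quasiIso_map (f : C(X, Y)) (g : C(Y, X)) (hgf : (g.comp f).Homotopic (.id X))
    (hfg : (f.comp g).Homotopic (.id Y)) : QuasiIso (Chains.map R f) := by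
  rw [quasiIso_iff]
  intro i
  rw [quasiIsoAt_iff_isIso_homologyMap]
  refine ⟨HomologicalComplex.homologyMap (Chains.map R g) i, ?_, ?_⟩
  · rw [← HomologicalComplex.homologyMap_comp, ← Chains.map_comp,
      ← HomologicalComplex.homologyMap_id, ← Chains.map_id]
    exact TopCat.Homotopy.congr_homologyMap_singularChainComplexFunctor
      (f := TopCat.ofHom (g.comp f)) (g := TopCat.ofHom (.id X)) hgf.some R i
  · rw [← HomologicalComplex.homologyMap_comp, ← Chains.map_comp,
      ← HomologicalComplex.homologyMap_id, ← Chains.map_id]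
    exact TopCat.Homotopy.congr_homologyMap_singularChainComplexFunctor
      (f := TopCat.ofHom (f.comp g)) (g := TopCat.ofHom (.id Y)) hfg.some R i

variable (R) in
/-- The short complex `C(A) → C(X) → C(X, A)`. -/
@[simps] def pairSC (A : Set X) : ShortComplex (ChainComplex (ModuleCat.{0} ℤ) ℕ) where
  X₁ := Chains R A
  X₂ := Chains R X
  X₃ := relC R A
  f := Chains.map R (subIncl A)
  g := relC.π R A
  zero := cokernel.condition _

variable (R) in
lemma pairSC_shortExact (A : Set X) : (pairSC R A).ShortExact where
  exact := ShortComplex.exact_cokernel _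
  mono_f := Chains.mono_map R _ Subtype.val_injective
  epi_g := inferInstanceAs (Epi (relC.π R A))

/-- A map of pairs which is a homology isomorphism on both parts is one of the pairs. -/
lemma Hmap_bijective_of_quasiIso (f : C(X, Y)) {A : Set X} {B : Set Y} (h : Set.MapsTo f A B)
    (h₁ : QuasiIso (Chains.map R (subMap f h))) (h₂ : QuasiIso (Chains.map R f)) :
    Function.Bijective (Hmap R n f h) := by
  let φ : pairSC R A ⟶ pairSC R B :=
    { τ₁ := Chains.map R (subMap f h)
      τ₂ := Chains.map R f
      τ₃ := relC.map R f h
      comm₁₂ := Chains.map_comp_eq R (f := subMap f h) (g := subIncl B) (f' := subIncl A) (g' := f)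
        rfl
      comm₂₃ := (relC.π_map R f h).symm }
  have := HomologicalComplex.HomologySequence.quasiIso_τ₃ φ (pairSC_shortExact R A)
    (pairSC_shortExact R B) h₁ h₂
  have h3 : IsIso (HomologicalComplex.homologyMap (relC.map R f h) n) := by
    rw [← quasiIsoAt_iff_isIso_homologyMap]
    exact inferInstanceAs (QuasiIsoAt φ.τ₃ n)
  exact ConcreteCategory.bijective_of_isIso _

/-- The projection of the cylinder is a homology isomorphism of pairs. -/
lemma Hmap_cylinder_bijective (A : Set X) :
    Function.Bijective (Hmap R n (A := {p : unitInterval × X | p.2 ∈ A}) (B := A)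
      (ContinuousMap.snd) (fun _ h => h)) := by
  refine Hmap_bijective_of_quasiIso _ _
    (Chains.quasiIso_map R _ ⟨fun a => ⟨(0, a.1), a.2⟩, by fun_prop⟩ ⟨?_⟩ ⟨?_⟩)
    (Chains.quasiIso_map R _ ⟨fun a => (0, a), by fun_prop⟩ ⟨?_⟩ ⟨?_⟩)
  · exact
    { toFun := fun p => ⟨(p.1 * p.2.1.1, p.2.1.2), p.2.2⟩
      continuous_toFun := by fun_prop
      map_zero_left := fun x => by ext1; simp
      map_one_left := fun x => by ext1; simp }
  · exact ContinuousMap.Homotopy.refl _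
  · exact
    { toFun := fun p => (p.1 * p.2.1, p.2.2)
      continuous_toFun := by fun_prop
      map_zero_left := fun x => by simp
      map_one_left := fun x => by simp }
  · exact ContinuousMap.Homotopy.refl _

/-- Homotopic maps of pairs induce the same map. -/
lemma Hmap_eq_of_homotopy {f g : C(X, Y)} (F : f.Homotopy g) {A : Set X} {B : Set Y}
    (hf : Set.MapsTo f A B) (hg : Set.MapsTo g A B) (hF : ∀ t, ∀ a ∈ A, F (t, a) ∈ B)
    (x : Hr R n A) : Hmap R n f hf x = Hmap R n g hg x := by
  let i : unitInterval → C(X, unitInterval × X) := fun t => ⟨fun x => (t, x), by fun_prop⟩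
  have hi : ∀ t, Set.MapsTo (i t) A {p : unitInterval × X | p.2 ∈ A} := fun t a ha => ha
  -- Both ends of the cylinder have the same composite with the projection, which is bijective on
  -- homology.
  have key : Hmap R n (i 0) (hi 0) x = Hmap R n (i 1) (hi 1) x := by
    apply (Hmap_cylinder_bijective A).1
    exact Hmap_comm (f := i 0) (g := .snd) (f' := i 1) (g' := .snd) rfl (hi 0) _ (hi 1) _ x
  have hF' : Set.MapsTo (F : C(unitInterval × X, Y)) {p : unitInterval × X | p.2 ∈ A} B :=
    fun p hp => hF p.1 p.2 hp
  have e0 : (F : C(unitInterval × X, Y)).comp (i 0) = f := by ext x; exact F.map_zero_left x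
  have e1 : (F : C(unitInterval × X, Y)).comp (i 1) = g := by ext x; exact F.map_one_left x
  rw [← Hmap_comp_eq e0 (hi 0) hF' hf, ← Hmap_comp_eq e1 (hi 1) hF' hg, key]

/-- If `B` deforms into `A ⊆ B`, keeping `A` in `A`, then `H(X, A) ≅ H(X, B)`. -/
lemma Hres_bijective_of_deformation {A B : Set X} (h : A ⊆ B) (r : C(unitInterval × B, B))
    (h0 : ∀ b, r (0, b) = b) (h1 : ∀ b, (r (1, b) : X) ∈ A)
    (hA : ∀ t (b : B), (b : X) ∈ A → (r (t, b) : X) ∈ A) :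
    Function.Bijective (Hres (R := R) (n := n) h) := by
  refine Hmap_bijective_of_quasiIso _ _
    (Chains.quasiIso_map R _ ⟨fun b => ⟨r (1, b), h1 b⟩, by fun_prop⟩ ⟨?_⟩ ⟨?_⟩)
    (by rw [Chains.map_id]; infer_instance)
  · exact ContinuousMap.Homotopy.symm
      { toFun := fun p => ⟨r (p.1, ⟨p.2.1, h p.2.2⟩), hA _ _ p.2.2⟩
        continuous_toFun := by fun_prop
        map_zero_left := fun x => by ext1; simp [h0]
        map_one_left := fun x => by ext1; simp; rfl }
  · exact ContinuousMap.Homotopy.symm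
      { toFun := r
        continuous_toFun := r.continuous
        map_zero_left := fun x => by simp [h0]
        map_one_left := fun x => by ext1; simp }

end Relative

/-! ### Barycentric subdivision -/

section Affine

/-- The standard topological simplex. -/
abbrev Δs (n : ℕ) : Type := stdSimplex ℝ (Fin (n + 1))

/-- The affine simplex with given vertices in a standard simplex. -/
def aff {k m : ℕ} (w : Fin (k + 1) → Δs m) : C(Δs k, Δs m) where
  toFun t := ⟨∑ j, t.1 j • (w j).1,
    (convex_stdSimplex ℝ _).sum_mem (fun j _ => t.2.1 j) t.2.2 (fun j _ => (w j).2)⟩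
  continuous_toFun := by
    refine Continuous.subtype_mk (continuous_finsetSum _ fun j _ => ?_) _
    exact ((continuous_apply j).comp continuous_subtype_val).smul continuous_const

lemma aff_coe {k m : ℕ} (w : Fin (k + 1) → Δs m) (t : Δs k) (i : Fin (m + 1)) :
    (aff w t).1 i = ∑ j, t.1 j * (w j).1 i := by
  simp [aff]

lemma aff_comp_aff {l k m : ℕ} (w : Fin (k + 1) → Δs m) (u : Fin (l + 1) → Δs k) :
    (aff w).comp (aff u) = aff (fun j => aff w (u j)) := by
  refine ContinuousMap.ext fun t => Subtype.ext (funext fun i => ?_)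
  simp only [ContinuousMap.comp_apply, aff_coe, Finset.sum_mul, Finset.mul_sum]
  rw [Finset.sum_comm]
  simp only [mul_assoc]

/-- The vertices of the standard simplex. -/
def vert (m : ℕ) (j : Fin (m + 1)) : Δs m := ⟨Pi.single j 1, single_mem_stdSimplex ℝ j⟩

lemma aff_vert (m : ℕ) : aff (vert m) = ContinuousMap.id _ := by
  refine ContinuousMap.ext fun t => Subtype.ext (funext fun i => ?_)
  rw [aff_coe]
  simp [vert, Pi.single_apply]

lemma aff_apply_vert {k m : ℕ} (w : Fin (k + 1) → Δs m) (j : Fin (k + 1)) :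
    aff w (vert k j) = w j := by
  refine Subtype.ext (funext fun i => ?_)
  rw [aff_coe]
  simp [vert, Pi.single_apply]

/-- The `i`-th face map of the standard simplex. -/
abbrev faceMap {m : ℕ} (i : Fin (m + 2)) : C(Δs m, Δs (m + 1)) :=
  ⟨stdSimplex.map i.succAbove, stdSimplex.continuous_map i.succAbove⟩

lemma faceMap_eq_aff {m : ℕ} (i : Fin (m + 2)) :
    faceMap i = aff (fun j => vert (m + 1) (i.succAbove j)) := by
  refine ContinuousMap.ext fun t => Subtype.ext (funext fun l => ?_)
  rw [aff_coe]
  have : (faceMap i t).1 l = ∑ j, if i.succAbove j = l then t.1 j else 0 := by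
    refine (congrFun (stdSimplex.map_coe i.succAbove t) l).trans ?_
    rw [FunOnFinite.linearMap_apply_apply, Finset.sum_filter]
    rfl
  rw [this]
  refine Finset.sum_congr rfl fun j _ => ?_
  simp only [vert, Pi.single_apply, mul_ite, mul_one, mul_zero, eq_comm]

lemma aff_comp_faceMap {k m : ℕ} (w : Fin (k + 2) → Δs m) (i : Fin (k + 2)) :
    (aff w).comp (faceMap i) = aff (w ∘ i.succAbove) := by
  rw [faceMap_eq_aff, aff_comp_aff]
  simp only [aff_apply_vert]
  rfl

/-- The barycentre of the standard simplex. -/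
def baryPt (k : ℕ) : Δs k :=
  ⟨fun _ => ((k : ℝ) + 1)⁻¹, fun _ => by positivity, by
    simp only [Finset.sum_const, Finset.card_univ, Fintype.card_fin, nsmul_eq_mul]
    push_cast
    exact mul_inv_cancel₀ (by positivity)⟩

/-- The barycentre of a tuple of points. -/
def bary {k m : ℕ} (w : Fin (k + 1) → Δs m) : Δs m := aff w (baryPt k)

lemma aff_bary {l k m : ℕ} (w : Fin (k + 1) → Δs m) (u : Fin (l + 1) → Δs k) :
    aff w (bary u) = bary (aff w ∘ u) :=
  DFunLike.congr_fun (aff_comp_aff w u) (baryPt l)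

/-- Closed balls of a normed space are convex. -/
lemma dist_aff_le {k m : ℕ} (w : Fin (k + 1) → Δs m) (y : Δs m) (r : ℝ)
    (h : ∀ i, dist (w i) y ≤ r) (t : Δs k) : dist (aff w t) y ≤ r := by
  have : (aff w t).1 ∈ Metric.closedBall y.1 r :=
    (convex_closedBall y.1 r).sum_mem (fun j _ => t.2.1 j) t.2.2 (fun j _ => h j)
  exact this

/-- The difference of a vertex and the barycentre is the average of the k + 1 differences of
vertices, one of which is zero. The resulting factor k/(k+1) < 1 makes the mesh shrink. -/
lemma dist_bary_le {k m : ℕ} (w : Fin (k + 1) → Δs m) (D : ℝ) (h : ∀ i j, dist (w i) (w j) ≤ D)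
    (i : Fin (k + 1)) : dist (w i) (bary w) ≤ k / (k + 1) * D := by
  have e : (w i).1 - (bary w).1 = ((k : ℝ) + 1)⁻¹ • ∑ j, ((w i).1 - (w j).1) := by
    have hk : (k : ℝ) + 1 ≠ 0 := by positivity
    rw [Finset.sum_sub_distrib, smul_sub, Finset.sum_const, Finset.card_univ, Fintype.card_fin,
      ← Nat.cast_smul_eq_nsmul ℝ, smul_smul, Finset.smul_sum]
    push_cast
    rw [inv_mul_cancel₀ hk, one_smul]
    rfl
  rw [Subtype.dist_eq, dist_eq_norm, e, norm_smul, Real.norm_of_nonneg (by positivity),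
    div_eq_inv_mul, mul_assoc]
  refine mul_le_mul_of_nonneg_left ?_ (by positivity)
  calc ‖∑ j, ((w i).1 - (w j).1)‖ ≤ ∑ j, ‖(w i).1 - (w j).1‖ := norm_sum_le _ _
    _ = ∑ j ∈ Finset.univ.erase i, ‖(w i).1 - (w j).1‖ := by
        rw [← Finset.sum_erase_add _ _ (Finset.mem_univ i)]; simp
    _ ≤ ∑ j ∈ Finset.univ.erase i, D := Finset.sum_le_sum fun j _ => by
        rw [← dist_eq_norm]; exact h i j
    _ = k * D := by simp

end Affine

/-! ### Algebra of cones and subdivision on chains of tuples -/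

section TupleChains

/-- Chains of tuples of points of a standard simplex. -/
abbrev TC (m k : ℕ) : Type := (Fin k → Δs m) →₀ ℤ

variable {m : ℕ}

/-- The boundary of a tuple. -/
def tb {k : ℕ} : TC m (k + 1) →ₗ[ℤ] TC m k :=
  Finsupp.linearCombination ℤ fun w => ∑ i : Fin (k + 1), (-1 : ℤ) ^ i.1 • Finsupp.single (w ∘ i.succAbove) 1

/-- The cone on a chain of tuples. -/
def cone (b : Δs m) {k : ℕ} : TC m k →ₗ[ℤ] TC m (k + 1) :=
  Finsupp.lmapDomain ℤ ℤ (fun w => (Fin.cons b w : Fin (k + 1) → Δs m))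

/-- The image of a chain of tuples under a map. -/
def push {m' : ℕ} (f : Δs m → Δs m') {k : ℕ} : TC m k →ₗ[ℤ] TC m' k :=
  Finsupp.lmapDomain ℤ ℤ (f ∘ ·)

lemma tb_single {k : ℕ} (w : Fin (k + 1) → Δs m) :
    tb (Finsupp.single w 1) = ∑ i : Fin (k + 1), (-1 : ℤ) ^ i.1 • Finsupp.single (w ∘ i.succAbove) 1 := by
  simp [tb]

lemma cone_single (b : Δs m) {k : ℕ} (w : Fin k → Δs m) (a : ℤ) :
    cone b (Finsupp.single w a) = Finsupp.single (Fin.cons b w) a := by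
  simp [cone]

lemma push_single {m' : ℕ} (f : Δs m → Δs m') {k : ℕ} (w : Fin k → Δs m) (a : ℤ) :
    push f (Finsupp.single w a) = Finsupp.single (f ∘ w) a := by
  simp [push]

lemma tc_ext {k : ℕ} {M : Type} [AddCommGroup M] {f g : TC m k →ₗ[ℤ] M}
    (h : ∀ w, f (Finsupp.single w 1) = g (Finsupp.single w 1)) : f = g :=
  Finsupp.lhom_ext' fun w => LinearMap.ext_ring (h w)

/-- Deleting the cone point returns the tuple; deleting any other vertex commutes with coning but
shifts its index by one, hence the minus sign. -/
lemma tb_cone_succ (b : Δs m) {k : ℕ} (c : TC m (k + 1)) :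
    tb (cone b c) = c - cone b (tb c) := by
  suffices h : tb ∘ₗ cone b = LinearMap.id - cone b ∘ₗ tb (m := m) (k := k) from
    DFunLike.congr_fun h c
  refine tc_ext fun w => ?_
  simp only [LinearMap.comp_apply, LinearMap.sub_apply, cone_single, tb_single,
    LinearMap.id_apply, Fin.sum_univ_succ (n := k + 1), map_sum, map_smul]
  have h0 : (Fin.cons b w : Fin (k + 2) → Δs m) ∘ Fin.succAbove 0 = w := by ext1 j; simp
  have hs : ∀ i : Fin (k + 1), (Fin.cons b w : Fin (k + 2) → Δs m) ∘ i.succ.succAbove =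
      Fin.cons b (w ∘ i.succAbove) := by
    intro i
    ext1 j
    refine Fin.cases ?_ (fun j => ?_) j <;> simp
  simp only [h0, hs, Fin.val_zero, pow_zero, one_smul, Fin.val_succ, pow_succ, mul_neg, mul_one,
    neg_smul, Finset.sum_neg_distrib, sub_eq_add_neg]

/-- Length 0 means the empty tuple, so this complex is augmented and the cone formula loses its
correction term at the bottom. -/
lemma tb_cone_zero (b : Δs m) (c : TC m 0) : tb (cone b c) = c := by
  suffices h : tb ∘ₗ cone b = LinearMap.id (M := TC m 0) from DFunLike.congr_fun h c
  refine tc_ext fun w => ?_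
  simp only [LinearMap.comp_apply, cone_single, tb_single, LinearMap.id_apply]
  simp only [Fin.sum_univ_succ, Finset.univ_eq_empty, Finset.sum_empty, add_zero, Fin.val_zero,
    pow_zero, one_smul]
  congr 1

lemma single_eq_cone {k : ℕ} (w : Fin (k + 1) → Δs m) :
    Finsupp.single w (1 : ℤ) = cone (w 0) (Finsupp.single (Fin.tail w) 1) := by
  rw [cone_single, Fin.cons_self_tail]

/-- Each tuple is the cone from its first vertex on its tail, so the cone formula gives the claim by
induction. -/
lemma tb_tb {k : ℕ} (c : TC m (k + 2)) : tb (tb c) = 0 := by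
  suffices h : tb ∘ₗ tb = (0 : TC m (k + 2) →ₗ[ℤ] TC m k) from DFunLike.congr_fun h c
  induction k with
  | zero =>
    refine tc_ext fun w => ?_
    rw [LinearMap.comp_apply, single_eq_cone, tb_cone_succ, map_sub, tb_cone_zero]
    simp
  | succ k ih =>
    refine tc_ext fun w => ?_
    rw [LinearMap.comp_apply, single_eq_cone, tb_cone_succ, map_sub, tb_cone_succ]
    -- The argument of `ih` is a dummy: its conclusion is an identity of linear maps, and any chain
    -- of the right length serves.
    have := DFunLike.congr_fun (ih (tb (cone (w 0) (Finsupp.single (Fin.tail w) 1))))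
      (Finsupp.single (Fin.tail w) 1)
    rw [LinearMap.comp_apply, LinearMap.zero_apply] at this
    simp [this]

/-- Barycentric subdivision of tuples. -/
def sd : (k : ℕ) → TC m k →ₗ[ℤ] TC m k
  | 0 => LinearMap.id
  | k + 1 => Finsupp.linearCombination ℤ
      fun w => cone (bary w) (sd k (tb (Finsupp.single w 1)))

/-- The chain homotopy between barycentric subdivision and the identity. -/
def sdh : (k : ℕ) → TC m k →ₗ[ℤ] TC m (k + 1)
  | 0 => 0
  | k + 1 => Finsupp.linearCombination ℤ
      fun w => cone (bary w) (Finsupp.single w 1 - sdh k (tb (Finsupp.single w 1)))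

lemma sd_single {k : ℕ} (w : Fin (k + 1) → Δs m) :
    sd (k + 1) (Finsupp.single w 1) = cone (bary w) (sd k (tb (Finsupp.single w 1))) := by
  simp [sd]

lemma sdh_single {k : ℕ} (w : Fin (k + 1) → Δs m) :
    sdh (k + 1) (Finsupp.single w 1) =
      cone (bary w) (Finsupp.single w 1 - sdh k (tb (Finsupp.single w 1))) := by
  simp [sdh]

/-- By the cone formula the boundary of a cone is its base minus the cone on the boundary of the
base; here the base is sd(∂w), and its boundary is sd(∂∂w) = 0 by induction. -/
lemma tb_sd {k : ℕ} (c : TC m (k + 1)) : tb (sd (k + 1) c) = sd k (tb c) := by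
  suffices h : tb ∘ₗ sd (k + 1) = sd k ∘ₗ (tb : TC m (k + 1) →ₗ[ℤ] TC m k) from
    DFunLike.congr_fun h c
  induction k with
  | zero =>
    refine tc_ext fun w => ?_
    rw [LinearMap.comp_apply, LinearMap.comp_apply, sd_single, tb_cone_zero]
  | succ k ih =>
    refine tc_ext fun w => ?_
    have := fun c => DFunLike.congr_fun (ih c) c
    simp only [LinearMap.comp_apply] at this
    rw [LinearMap.comp_apply, LinearMap.comp_apply, sd_single, tb_cone_succ, this, tb_tb]
    simp

/-- The homotopy cones off w - sdh(∂w) from the barycentre; the cone formula and the induction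
hypothesis for ∂w leave exactly w minus its subdivision. -/
lemma tb_sdh {k : ℕ} (c : TC m (k + 1)) :
    tb (sdh (k + 1) c) + sdh k (tb c) = c - sd (k + 1) c := by
  suffices h : tb ∘ₗ sdh (k + 1) + sdh k ∘ₗ tb =
      LinearMap.id - (sd (k + 1) : TC m (k + 1) →ₗ[ℤ] TC m (k + 1)) from DFunLike.congr_fun h c
  induction k with
  | zero =>
    refine tc_ext fun w => ?_
    simp only [LinearMap.add_apply, LinearMap.comp_apply, LinearMap.sub_apply, LinearMap.id_apply,
      sd_single, sdh_single, tb_cone_succ]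
    simp [sdh, sd]
  | succ k ih =>
    refine tc_ext fun w => ?_
    have := DFunLike.congr_fun (ih (tb (Finsupp.single w 1))) (tb (Finsupp.single w 1))
    simp only [LinearMap.add_apply, LinearMap.comp_apply, LinearMap.sub_apply, LinearMap.id_apply,
      tb_tb, map_zero, add_zero] at this
    simp only [LinearMap.add_apply, LinearMap.comp_apply, LinearMap.sub_apply, LinearMap.id_apply,
      sd_single, sdh_single, tb_cone_succ, map_sub, this]
    abel

section Push

variable {m' : ℕ} (f : Δs m → Δs m')

lemma push_tb {k : ℕ} (c : TC m (k + 1)) : push f (tb c) = tb (push f c) := by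
  suffices h : push f ∘ₗ tb = tb ∘ₗ push f (k := k + 1) from DFunLike.congr_fun h c
  refine tc_ext fun w => ?_
  simp only [LinearMap.comp_apply, push_single, tb_single, map_sum, map_smul]
  rfl

lemma push_cone (b : Δs m) {k : ℕ} (c : TC m k) : push f (cone b c) = cone (f b) (push f c) := by
  suffices h : push f ∘ₗ cone b = cone (f b) ∘ₗ push f (k := k) from DFunLike.congr_fun h c
  refine tc_ext fun w => ?_
  simp only [LinearMap.comp_apply, push_single, cone_single]
  congr 1
  ext1 j
  refine Fin.cases ?_ (fun j => ?_) j <;> simp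

/-- Affine maps send barycentres to barycentres, so the recursive definition of subdivision commutes
with them. -/
lemma push_sd {l : ℕ} (u : Fin (l + 1) → Δs m) {k : ℕ} (c : TC l k) :
    push (aff u) (sd k c) = sd k (push (aff u) c) := by
  suffices h : push (aff u) ∘ₗ sd k = sd k ∘ₗ push (aff u) from DFunLike.congr_fun h c
  induction k with
  | zero => rfl
  | succ k ih =>
    refine tc_ext fun w => ?_
    have := fun c => DFunLike.congr_fun (ih c) c
    simp only [LinearMap.comp_apply] at this
    simp only [LinearMap.comp_apply, sd_single, push_cone, push_single, this, push_tb, aff_bary]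

lemma push_sdh {l : ℕ} (u : Fin (l + 1) → Δs m) {k : ℕ} (c : TC l k) :
    push (aff u) (sdh k c) = sdh k (push (aff u) c) := by
  suffices h : push (aff u) ∘ₗ sdh k = sdh k ∘ₗ push (aff u) from DFunLike.congr_fun h c
  induction k with
  | zero => ext1; simp [sdh]
  | succ k ih =>
    refine tc_ext fun w => ?_
    have := fun c => DFunLike.congr_fun (ih c) c
    simp only [LinearMap.comp_apply] at this
    simp only [LinearMap.comp_apply, sdh_single, push_cone, push_single, this, push_tb, aff_bary,
      map_sub]

end Push

/-! #### Mesh of the subdivision -/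

lemma map_mem_of_supported {k : ℕ} {M : Type} [AddCommGroup M] [Module ℤ M] (f : TC m k →ₗ[ℤ] M)
    (N : Submodule ℤ M) (A : Set (Fin k → Δs m)) (h : ∀ w ∈ A, f (Finsupp.single w 1) ∈ N)
    (c : TC m k) (hc : c ∈ Finsupp.supported ℤ ℤ A) : f c ∈ N := by
  have h2 : Finsupp.supported ℤ ℤ A ≤ N.comap f := by
    rw [Finsupp.supported_eq_span_single, Submodule.span_le]
    rintro _ ⟨w, hw, rfl⟩
    exact h w hw
  exact h2 hc

/-- Two facts are proved together. The new vertices stay in every ball containing the old ones,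
which bounds their distance to the barycentre; and their mutual distances contract. The ratio
N/(N+1) is uniform in the length, because k/(k+1) increases with k. -/
lemma sd_mesh (N : ℕ) {k : ℕ} (hk : k ≤ N + 1) (w : Fin k → Δs m) (D : ℝ)
    (hD : ∀ i j, dist (w i) (w j) ≤ D) :
    sd k (Finsupp.single w 1) ∈ Finsupp.supported ℤ ℤ
      {u | (∀ y r, (∀ i, dist (w i) y ≤ r) → ∀ i, dist (u i) y ≤ r) ∧
        ∀ i j, dist (u i) (u j) ≤ N / (N + 1) * D} := by
  induction k with
  | zero =>
    exact Finsupp.single_mem_supported ℤ _ ⟨fun _ _ _ i => i.elim0, fun i => i.elim0⟩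
  | succ k ih =>
    have hD0 : 0 ≤ D := dist_nonneg.trans (hD 0 0)
    have hkN : (k : ℝ) / (k + 1) * D ≤ N / (N + 1) * D := by
      refine mul_le_mul_of_nonneg_right ?_ hD0
      have : (k : ℝ) ≤ N := by exact_mod_cast Nat.le_of_succ_le_succ hk
      rw [div_le_div_iff₀ (by positivity) (by positivity)]
      nlinarith
    have hb := dist_bary_le w D hD
    rw [sd_single, tb_single, map_sum, map_sum]
    refine Submodule.sum_mem _ fun l _ => ?_
    rw [map_smul, map_smul]
    refine Submodule.smul_mem _ _ ?_
    refine map_mem_of_supported (cone (bary w)) _ _ (fun u hu => ?_) _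
      (ih (by lia) (w ∘ l.succAbove) (fun i j => hD _ _))
    rw [cone_single]
    refine Finsupp.single_mem_supported ℤ _ ⟨fun y r hy => ?_, ?_⟩
    · refine Fin.cases ?_ fun i => ?_
      · exact dist_aff_le w y r hy _
      · simpa using hu.1 y r (fun i => hy _) i
    · have hb' : ∀ i, dist (u i) (bary w) ≤ N / (N + 1) * D := fun i =>
        hu.1 (bary w) _ (fun i => (hb _).trans hkN) i
      refine Fin.cases (Fin.cases ?_ fun j => ?_) fun i => Fin.cases ?_ fun j => ?_
      · simp only [Fin.cons_zero, dist_self]; positivity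
      · simpa [dist_comm] using hb' j
      · simpa using hb' i
      · simpa using hu.2 i j

lemma sd_iterate_mesh (N k : ℕ) (hk : k ≤ N + 1) (w : Fin k → Δs m) (D : ℝ)
    (hD : ∀ i j, dist (w i) (w j) ≤ D) (j : ℕ) :
    ((sd k)^[j]) (Finsupp.single w 1) ∈ Finsupp.supported ℤ ℤ
      {u | ∀ i i', dist (u i) (u i') ≤ ((N : ℝ) / (N + 1)) ^ j * D} := by
  induction j with
  | zero => exact Finsupp.single_mem_supported ℤ _ (by simpa using hD)
  | succ j ih =>
    rw [Function.iterate_succ_apply']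
    refine map_mem_of_supported (sd k) _ _ (fun u hu => ?_) _ ih
    refine Finsupp.supported_mono ?_ (sd_mesh N hk u _ hu)
    intro v hv
    simpa [pow_succ', mul_assoc] using hv.2

end TupleChains

/-! ### Singular chains as sums of simplices, and subdivision acting on them -/

section Simplices

variable (R : ModuleCat.{0} ℤ) {X Y : Type} [TopologicalSpace X] [TopologicalSpace Y]

/-- The inclusion of the summand of the singular chains given by a singular simplex. -/
def sx {n : ℕ} (σ : C(Δs n, X)) : R ⟶ (Chains R X).X n :=
  SSet.ιChainComplex (TopCat.toSSet.obj (TopCat.of X))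
    ((TopCat.toSSetObjEquiv (TopCat.of X) (.op (SimplexCategory.mk n))).symm σ)

variable {R}

lemma chains_hom_ext {n : ℕ} {M : ModuleCat.{0} ℤ} {f g : (Chains R X).X n ⟶ M}
    (h : ∀ σ : C(Δs n, X), sx R σ ≫ f = sx R σ ≫ g) : f = g := by
  refine SSet.chainComplex_hom_ext (X := TopCat.toSSet.obj (TopCat.of X)) fun x => ?_
  obtain ⟨σ, rfl⟩ :=
    (TopCat.toSSetObjEquiv (TopCat.of X) (.op (SimplexCategory.mk n))).symm.surjective x
  exact h σ

lemma sx_map (f : C(X, Y)) {n : ℕ} (σ : C(Δs n, X)) :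
    sx R σ ≫ (Chains.map R f).f n = sx R (f.comp σ) :=
  SSet.ι_chainComplexMap_f _ _ (TopCat.toSSet.map (TopCat.ofHom f)) R
    ((TopCat.toSSetObjEquiv (TopCat.of X) (.op (SimplexCategory.mk n))).symm σ)

lemma sx_d {n : ℕ} (σ : C(Δs (n + 1), X)) :
    sx R σ ≫ (Chains R X).d (n + 1) n =
      ∑ i : Fin (n + 2), (-1 : ℤ) ^ i.1 • sx R (σ.comp (faceMap i)) :=
  SSet.ιChainComplex_d (TopCat.toSSet.obj (TopCat.of X)) _ _

/-- Morphisms out of the singular chains, defined on simplices. -/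
def sxDesc {n : ℕ} {M : ModuleCat.{0} ℤ} (f : C(Δs n, X) → (R ⟶ M)) : (Chains R X).X n ⟶ M :=
  (SSet.isColimitChainComplexXCofan (TopCat.toSSet.obj (TopCat.of X)) R n).desc
    (Cofan.mk M fun x => f (TopCat.toSSetObjEquiv (TopCat.of X) (.op (SimplexCategory.mk n)) x))

lemma sx_desc {n : ℕ} {M : ModuleCat.{0} ℤ} (f : C(Δs n, X) → (R ⟶ M)) (σ : C(Δs n, X)) :
    sx R σ ≫ sxDesc f = f σ := by
  refine ((SSet.isColimitChainComplexXCofan (TopCat.toSSet.obj (TopCat.of X)) R n).fac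
    (Cofan.mk M fun x => f (TopCat.toSSetObjEquiv (TopCat.of X) (.op (SimplexCategory.mk n)) x))
    ⟨(TopCat.toSSetObjEquiv (TopCat.of X) (.op (SimplexCategory.mk n))).symm σ⟩).trans ?_
  simp

/-- The morphism of `ℤ`-modules given by an additive map. -/
def homOfAdd {M N : ModuleCat.{0} ℤ} (f : M →+ N) : M ⟶ N :=
  ModuleCat.ofHom
    { toFun := f
      map_add' := f.map_add
      map_smul' := fun a x => by
        simpa using map_intCast_smul f ℤ ℤ a x }

/-- The chain group is a coproduct of copies of R, so the projection to its quotient by the span of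
the summands is zero, being zero on each summand. -/
lemma chains_induction {n : ℕ} {P : (Chains R X).X n → Prop} (h0 : P 0)
    (hadd : ∀ c c', P c → P c' → P (c + c')) (hs : ∀ (σ : C(Δs n, X)) r, P (sx R σ r))
    (c : (Chains R X).X n) : P c := by
  let N : Submodule ℤ ((Chains R X).X n) := ⨆ σ : C(Δs n, X), LinearMap.range (sx R σ).hom
  let q : (Chains R X).X n ⟶ ModuleCat.of ℤ ((Chains R X).X n ⧸ N) :=
    homOfAdd N.mkQ.toAddMonoidHom
  have hq : q = 0 := by
    refine chains_hom_ext fun σ => ?_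
    refine ModuleCat.hom_ext (LinearMap.ext fun r => ?_)
    exact (Submodule.Quotient.mk_eq_zero N).2 (Submodule.mem_iSup_of_mem σ ⟨r, rfl⟩)
  have hc : c ∈ N := (Submodule.Quotient.mk_eq_zero N).1 congr($hq c)
  refine Submodule.iSup_induction _ (motive := P) hc ?_ h0 hadd
  rintro σ _ ⟨r, rfl⟩
  exact hs σ r

/-- The coefficients of a singular chain. -/
def coord (n : ℕ) : (Chains R X).X n →+ (C(Δs n, X) →₀ R) :=
  (sxDesc (M := ModuleCat.of ℤ (C(Δs n, X) →₀ R)) fun σ => homOfAdd (Finsupp.singleAddHom σ)).hom.toAddMonoidHom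

lemma coord_sx {n : ℕ} (σ : C(Δs n, X)) (r : R) : coord n (sx R σ r) = Finsupp.single σ r :=
  congr($(sx_desc (M := ModuleCat.of ℤ (C(Δs n, X) →₀ R))
    (fun σ => homOfAdd (Finsupp.singleAddHom σ)) σ) r)

/-- A singular chain is the sum of its simplices. -/
lemma sum_coord {n : ℕ} (c : (Chains R X).X n) : ((coord n c).sum fun σ r => sx R σ r) = c := by
  induction c using chains_induction with
  | h0 => simp
  | hadd c c' h h' =>
    rw [map_add, Finsupp.sum_add_index' (fun _ => map_zero _) (fun _ _ _ => map_add _ _ _), h, h']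
  | hs σ r =>
    rw [coord_sx]
    exact Finsupp.sum_single_index (map_zero _)

lemma coord_injective (n : ℕ) : Function.Injective (coord (R := R) (X := X) n) := by
  intro c c' h
  rw [← sum_coord c, h, sum_coord]

lemma coord_map (f : C(X, Y)) {n : ℕ} (c : (Chains R X).X n) :
    coord n ((Chains.map R f).f n c) = (coord n c).mapDomain (f.comp ·) := by
  induction c using chains_induction with
  | h0 => simp
  | hadd c c' h h' => rw [map_add, map_add, map_add, Finsupp.mapDomain_add, h, h']
  | hs σ r =>
    have : (Chains.map R f).f n (sx R σ r) = sx R (f.comp σ) r := congr($(sx_map f σ) r)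
    rw [this, coord_sx, coord_sx, Finsupp.mapDomain_single]

/-- A simplex whose image lies in the range lifts pointwise, and the lift is continuous because f is
an embedding. This lets chains be located by the images of their simplices, as excision and compact
supports require. -/
lemma mem_range_map_iff (f : C(X, Y)) (hf : IsEmbedding f) {n : ℕ} (c : (Chains R Y).X n) :
    (∃ a, (Chains.map R f).f n a = c) ↔
      ∀ σ, coord n c σ ≠ 0 → Set.range σ ⊆ Set.range f := by
  classical
  constructor
  · rintro ⟨a, rfl⟩ σ hσ
    rw [coord_map] at hσ
    have := Finsupp.mapDomain_support (Finsupp.mem_support_iff.2 hσ)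
    obtain ⟨τ, -, rfl⟩ := Finset.mem_image.1 this
    exact Set.range_comp_subset_range τ f
  · intro h
    change c ∈ LinearMap.range ((Chains.map R f).f n).hom
    rw [← sum_coord c]
    refine Submodule.sum_mem _ fun σ hσ => ?_
    have hr := h σ (Finsupp.mem_support_iff.1 hσ)
    have hlift : ∀ t, ∃ y, f y = σ t := fun t => hr ⟨t, rfl⟩
    choose τ hτ using hlift
    have hc : Continuous τ := by
      rw [hf.continuous_iff]
      have : f ∘ τ = σ := funext hτ
      rw [this]
      exact σ.continuous
    refine ⟨sx R (⟨τ, hc⟩ : C(Δs n, X)) (coord n c σ), ?_⟩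
    refine congr($(sx_map (R := R) f (⟨τ, hc⟩ : C(Δs n, X))) _).trans ?_
    exact congrArg (fun τ => sx R τ (coord n c σ)) (ContinuousMap.ext hτ)

lemma coord_map_comp (f : C(X, Y)) (hf : Function.Injective f) {n : ℕ} (c : (Chains R X).X n)
    (σ : C(Δs n, X)) : coord n ((Chains.map R f).f n c) (f.comp σ) = coord n c σ := by
  rw [coord_map, Finsupp.mapDomain_apply]
  intro σ τ h
  ext t
  exact hf (DFunLike.congr_fun h t)

/-! ### The action of chains of tuples -/

/-- Precomposition of singular simplices with chains of affine simplices. -/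
def op {m k : ℕ} (c : TC m (k + 1)) : (Chains R X).X m ⟶ (Chains R X).X k :=
  sxDesc fun σ => Finsupp.linearCombination ℤ (fun w => sx R (σ.comp (aff w))) c

lemma sx_op {m k : ℕ} (c : TC m (k + 1)) (σ : C(Δs m, X)) :
    sx R σ ≫ op c = Finsupp.linearCombination ℤ (fun w => sx R (σ.comp (aff w))) c :=
  sx_desc _ _

lemma op_add {m k : ℕ} (c c' : TC m (k + 1)) :
    op (R := R) (X := X) (c + c') = op c + op c' :=
  chains_hom_ext fun σ => by simp only [sx_op, map_add, Preadditive.comp_add]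

lemma op_sub {m k : ℕ} (c c' : TC m (k + 1)) :
    op (R := R) (X := X) (c - c') = op c - op c' :=
  chains_hom_ext fun σ => by simp only [sx_op, map_sub, Preadditive.comp_sub]

lemma op_naturality (f : C(X, Y)) {m k : ℕ} (c : TC m (k + 1)) :
    op c ≫ (Chains.map R f).f k = (Chains.map R f).f m ≫ op c := by
  refine chains_hom_ext fun σ => ?_
  rw [← Category.assoc, sx_op, ← Category.assoc, sx_map, sx_op]
  simp only [Finsupp.linearCombination_apply, Finsupp.sum, Preadditive.sum_comp,
    Preadditive.zsmul_comp, sx_map]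
  rfl

/-- Additivity of `op` reduces identities to single tuples. -/
lemma op_d {m k : ℕ} (c : TC m (k + 2)) :
    op (R := R) (X := X) c ≫ (Chains R X).d (k + 1) k = op (tb c) := by
  refine chains_hom_ext fun σ => ?_
  rw [← Category.assoc, sx_op, sx_op]
  induction c using Finsupp.induction_linear with
  | zero => simp
  | add c c' h h' => simp only [map_add, Preadditive.add_comp, h, h']
  | single w a =>
    have hw : Finsupp.single w a = a • Finsupp.single w (1 : ℤ) := by simp
    rw [hw, map_smul, map_smul, map_smul, Preadditive.zsmul_comp]
    congr 1
    rw [tb_single, map_sum, Finsupp.linearCombination_single, one_smul, sx_d]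
    refine Finset.sum_congr rfl fun i _ => ?_
    rw [map_smul, Finsupp.linearCombination_single, one_smul, ContinuousMap.comp_assoc,
      aff_comp_faceMap]

lemma linearCombination_push {m m' k : ℕ} (u : Fin (m + 1) → Δs m') (c : TC m (k + 1))
    (σ : C(Δs m', X)) :
    Finsupp.linearCombination ℤ (fun w => sx R (σ.comp (aff w))) (push (aff u) c) =
      Finsupp.linearCombination ℤ (fun w => sx R ((σ.comp (aff u)).comp (aff w))) c := by
  rw [push, Finsupp.lmapDomain_apply, Finsupp.linearCombination_mapDomain]
  congr 1
  congr 1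
  funext w
  rw [ContinuousMap.comp_assoc, aff_comp_aff]
  rfl

/-- Face maps are affine, so precomposing with a face and then with an affine simplex amounts to
pushing the tuple along the face. -/
lemma d_op {m k : ℕ} (c : TC m (k + 1)) :
    (Chains R X).d (m + 1) m ≫ op c =
      op (∑ i : Fin (m + 2), (-1 : ℤ) ^ i.1 • push (aff fun j => vert (m + 1) (i.succAbove j)) c) := by
  refine chains_hom_ext fun σ => ?_
  rw [← Category.assoc, sx_d, sx_op, map_sum, Preadditive.sum_comp]
  refine Finset.sum_congr rfl fun i _ => ?_
  rw [Preadditive.zsmul_comp, sx_op, map_smul, linearCombination_push, faceMap_eq_aff]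

/-- The tuple of all vertices. -/
abbrev vt (m : ℕ) : TC m (m + 1) := Finsupp.single (vert m) 1

lemma op_vt (m : ℕ) : op (R := R) (X := X) (vt m) = 𝟙 _ := by
  refine chains_hom_ext fun σ => ?_
  rw [sx_op, Finsupp.linearCombination_single, aff_vert]
  simp

lemma push_vt {m m' : ℕ} (u : Fin (m + 1) → Δs m') :
    push (aff u) (vt m) = Finsupp.single u 1 := by
  rw [push_single]
  congr 1
  funext j
  exact aff_apply_vert u j

lemma tb_vt (m : ℕ) : tb (vt (m + 1)) =
    ∑ i : Fin (m + 2), (-1 : ℤ) ^ i.1 • push (aff fun j => vert (m + 1) (i.succAbove j)) (vt m) := by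
  rw [tb_single]
  refine Finset.sum_congr rfl fun i _ => ?_
  rw [push_vt]
  rfl

variable (R X) in
/-- Barycentric subdivision of singular chains. -/
abbrev Sd (m : ℕ) : (Chains R X).X m ⟶ (Chains R X).X m := op (sd _ (vt m))

variable (R X) in
/-- The chain homotopy between barycentric subdivision and the identity. -/
abbrev Sdh (m : ℕ) : (Chains R X).X m ⟶ (Chains R X).X (m + 1) := op (sdh _ (vt m))

/-- Both sides are operators given by tuples; the identity for tuples is `tb_sd` at the tuple of
vertices, with naturality of subdivision along the faces. -/
lemma Sd_d (m : ℕ) : Sd R X (m + 1) ≫ (Chains R X).d (m + 1) m =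
    (Chains R X).d (m + 1) m ≫ Sd R X m := by
  rw [op_d, d_op, tb_sd, tb_vt]
  simp only [map_sum, map_smul, push_sd]

lemma Sdh_d_zero : Sdh R X 0 ≫ (Chains R X).d 1 0 = 𝟙 _ - Sd R X 0 := by
  have := tb_sdh (vt 0)
  simp only [sdh, LinearMap.zero_apply, add_zero] at this
  rw [op_d, ← op_vt, ← op_sub, ← this]
  rfl

lemma Sdh_d (m : ℕ) : Sdh R X (m + 1) ≫ (Chains R X).d (m + 2) (m + 1) +
    (Chains R X).d (m + 1) m ≫ Sdh R X m = 𝟙 _ - Sd R X (m + 1) := by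
  rw [op_d, d_op, ← op_vt, ← op_sub, ← op_add, ← tb_sdh, tb_vt]
  simp only [map_sum, map_smul, push_sdh]

/-- Iterated subdivision of a singular simplex thereby becomes iterated subdivision of one tuple,
whose mesh is controlled. -/
lemma op_Sd {m k : ℕ} (c : TC m (k + 1)) : op (R := R) (X := X) c ≫ Sd R X k = op (sd _ c) := by
  refine chains_hom_ext fun σ => ?_
  rw [← Category.assoc, sx_op, sx_op]
  induction c using Finsupp.induction_linear with
  | zero => simp
  | add c c' h h' => simp only [map_add, Preadditive.add_comp, h, h']
  | single w a =>
    have hw : Finsupp.single w a = a • Finsupp.single w (1 : ℤ) := by simp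
    rw [hw, map_smul, map_smul, map_smul, Preadditive.zsmul_comp]
    congr 1
    rw [Finsupp.linearCombination_single, one_smul, sx_op, ← linearCombination_push, push_sd,
      push_vt]

lemma Sd_iterate_sx {m : ℕ} (σ : C(Δs m, X)) (r : R) (j : ℕ) :
    (Sd R X m)^[j] (sx R σ r) =
      Finsupp.linearCombination ℤ (fun w => sx R (σ.comp (aff w))) ((sd _)^[j] (vt m)) r := by
  have key : (Sd R X m)^[j] (sx R σ r) = op ((sd _)^[j] (vt m)) (sx R σ r) := by
    induction j with
    | zero => rw [Function.iterate_zero_apply, Function.iterate_zero_apply, op_vt]; rfl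
    | succ j ih => rw [Function.iterate_succ_apply', Function.iterate_succ_apply', ih, ← op_Sd]; rfl
  rw [key]
  exact congr($(sx_op ((sd _)^[j] (vt m)) σ) r)

end Simplices

/-! ### Excision -/

section Excision

variable {R : ModuleCat.{0} ℤ} {X Y : Type} [TopologicalSpace X] [TopologicalSpace Y]

/-- The chains which are sums of chains in the range of `f` and chains in `A`. -/
def smallChains (R : ModuleCat.{0} ℤ) (f : C(Y, X)) (A : Set X) (n : ℕ) :
    Submodule ℤ ((Chains R X).X n) :=
  LinearMap.range ((Chains.map R f).f n).hom ⊔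
    LinearMap.range ((Chains.map R (subIncl A)).f n).hom

variable {f : C(Y, X)} {A : Set X}

lemma op_mem_smallChains {m k : ℕ} (c : TC m (k + 1)) {x : (Chains R X).X m}
    (hx : x ∈ smallChains R f A m) : op c x ∈ smallChains R f A k := by
  obtain ⟨_, ⟨y, rfl⟩, _, ⟨a, rfl⟩, rfl⟩ := Submodule.mem_sup.1 hx
  rw [map_add]
  refine Submodule.add_mem_sup ⟨op c y, ?_⟩ ⟨op c a, ?_⟩
  · exact congr($(op_naturality f c) y)
  · exact congr($(op_naturality (subIncl A) c) a)

lemma Sd_iterate_mem_smallChains {m : ℕ} {x : (Chains R X).X m} (j : ℕ)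
    (hx : x ∈ smallChains R f A m) : (Sd R X m)^[j] x ∈ smallChains R f A m := by
  induction j with
  | zero => exact hx
  | succ j ih =>
    rw [Function.iterate_succ_apply']
    exact op_mem_smallChains _ ih

/-- For one simplex, the preimages of the two open sets cover the compact standard simplex; a
Lebesgue number of this cover eventually exceeds the mesh of the iterated subdivision. -/
lemma exists_Sd_iterate_mem (hf : IsOpenEmbedding f) (hA : IsOpen A)
    (hc : Set.range f ∪ A = Set.univ) {m : ℕ} (x : (Chains R X).X m) :
    ∃ j, (Sd R X m)^[j] x ∈ smallChains R f A m := by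
  induction x using chains_induction with
  | h0 => exact ⟨0, Submodule.zero_mem _⟩
  | hadd c c' h h' =>
    obtain ⟨j, hj⟩ := h
    obtain ⟨j', hj'⟩ := h'
    refine ⟨j + j', ?_⟩
    have hadd : (Sd R X m)^[j + j'] (c + c') = (Sd R X m)^[j + j'] c + (Sd R X m)^[j + j'] c' :=
      iterate_map_add (Sd R X m).hom _ _ _
    rw [hadd]
    refine Submodule.add_mem _ ?_ ?_
    · rw [add_comm, Function.iterate_add_apply]
      exact Sd_iterate_mem_smallChains _ hj
    · rw [Function.iterate_add_apply]
      exact Sd_iterate_mem_smallChains _ hj'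
  | hs σ r =>
    have hcov : (Set.univ : Set (Δs m)) ⊆
        ⋃ b : Bool, cond b (σ ⁻¹' Set.range f) (σ ⁻¹' A) := by
      intro t _
      have : σ t ∈ Set.range f ∪ A := hc ▸ Set.mem_univ _
      rcases this with h | h
      · exact Set.mem_iUnion.2 ⟨true, h⟩
      · exact Set.mem_iUnion.2 ⟨false, h⟩
    obtain ⟨ε, hε, hL⟩ := lebesgue_number_lemma_of_metric isCompact_univ (fun b => by
      cases b
      · exact hA.preimage σ.continuous
      · exact hf.isOpen_range.preimage σ.continuous) hcov
    have hlim : Filter.Tendsto (fun j : ℕ => ((m : ℝ) / (m + 1)) ^ j * 1) Filter.atTop (𝓝 0) := by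
      rw [← zero_mul (1 : ℝ)]
      refine (tendsto_pow_atTop_nhds_zero_of_lt_one (by positivity) ?_).mul_const 1
      rw [div_lt_one (by positivity)]
      linarith
    obtain ⟨j, hj⟩ := (hlim.eventually_lt_const hε).exists
    refine ⟨j, ?_⟩
    rw [Sd_iterate_sx]
    -- The initial bound 1 is a bound for the diameter of the standard simplex in the sup metric.
    have hmesh := sd_iterate_mesh m (m + 1) le_rfl (vert m) 1 (fun a b => by
      refine (Metric.dist_le_diam_of_mem (bounded_stdSimplex _) (vert m a).2 (vert m b).2).trans ?_
      exact diam_stdSimplex_le) j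
    -- The tuple combination takes values in morphisms out of R, so smallness at the fixed
    -- coefficient `r` is phrased as a submodule of such morphisms.
    let N : Submodule ℤ (R ⟶ (Chains R X).X m) :=
      { carrier := {g | g r ∈ smallChains R f A m}
        add_mem' := fun h h' => (smallChains R f A m).add_mem h h'
        zero_mem' := (smallChains R f A m).zero_mem
        smul_mem' := fun a g h => by
          have e : (a • g) r = a • g r := by
            simp
          change (a • g) r ∈ smallChains R f A m
          rw [e]
          exact zsmul_mem (S := Submodule ℤ ((Chains R X).X m)) h a }
    refine map_mem_of_supported (Finsupp.linearCombination ℤ fun w => sx R (σ.comp (aff w)))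
      N _ (fun w hw => ?_) _ hmesh
    rw [Finsupp.linearCombination_single, one_smul]
    change sx R (σ.comp (aff w)) r ∈ smallChains R f A m
    obtain ⟨b, hb⟩ := hL (w 0) (Set.mem_univ _)
    have hran : Set.range (aff w) ⊆ Metric.ball (w 0) ε := by
      rintro _ ⟨t, rfl⟩
      exact (dist_aff_le w (w 0) _ (fun i => hw i 0) t).trans_lt hj
    have hsupp : ∀ τ, coord m (sx R (σ.comp (aff w)) r) τ ≠ 0 → τ = σ.comp (aff w) := by
      intro τ hτ
      rw [coord_sx] at hτ
      by_contra hne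
      exact hτ (Finsupp.single_eq_of_ne hne)
    cases b
    · refine Submodule.mem_sup_right ?_
      refine (mem_range_map_iff (subIncl A) IsEmbedding.subtypeVal _).2 fun τ hτ => ?_
      rw [hsupp τ hτ]
      rintro _ ⟨t, rfl⟩
      exact ⟨⟨_, hb (hran ⟨t, rfl⟩)⟩, rfl⟩
    · refine Submodule.mem_sup_left ?_
      refine (mem_range_map_iff f hf.isEmbedding _).2 fun τ hτ => ?_
      rw [hsupp τ hτ]
      rintro _ ⟨t, rfl⟩
      exact hb (hran ⟨t, rfl⟩)

end Excision

/-! ### The excision theorem -/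

section ExcisionTheorem

variable {R : ModuleCat.{0} ℤ} {X Y : Type} [TopologicalSpace X] [TopologicalSpace Y]
variable {f : C(Y, X)} {A : Set X} {B : Set Y}

variable (R) in
/-- The quotient of the relative chains of `(X, A)` by those of `(Y, B)`. -/
def exQ (h : Set.MapsTo f B A) : ChainComplex (ModuleCat.{0} ℤ) ℕ := cokernel (relC.map R f h)

variable (R) in
/-- The projection from chains to the excision quotient. -/
def exq (h : Set.MapsTo f B A) : Chains R X ⟶ exQ R h := relC.π R A ≫ cokernel.π (relC.map R f h)

lemma exq_surjective (h : Set.MapsTo f B A) (n : ℕ) : Function.Surjective ((exq R h).f n) := by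
  have h1 : Epi (cokernel.π (relC.map R f h)) := inferInstance
  have : Epi (exq R h) := epi_comp' inferInstance h1
  rw [← ModuleCat.epi_iff_surjective]
  infer_instance

/-- The quotient complex is C(X) modulo small chains, so its exactness becomes a statement about
making chains small. -/
lemma exq_eq_zero_iff (h : Set.MapsTo f B A) (n : ℕ) (c : (Chains R X).X n) :
    (exq R h).f n c = 0 ↔ c ∈ smallChains R f A n := by
  have hex := (ShortComplex.exact_cokernel (relC.map R f h)).map (HomologicalComplex.eval _ _ n)
  rw [ShortComplex.moduleCat_exact_iff] at hex
  constructor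
  · intro hc
    obtain ⟨b, hb⟩ := hex ((relC.π R A).f n c) hc
    obtain ⟨y, rfl⟩ := relC.π_surjective R B n b
    have hb' : (relC.π R A).f n ((Chains.map R f).f n y) = (relC.π R A).f n c :=
      (relC.π_map_apply R f h n y).symm.trans hb
    have hz : (relC.π R A).f n (c - (Chains.map R f).f n y) = 0 := by
      rw [map_sub, hb', sub_self]
    obtain ⟨a, ha⟩ := (relC.π_eq_zero_iff R A n _).1 hz
    exact Submodule.mem_sup.2 ⟨_, ⟨y, rfl⟩, _, ⟨a, rfl⟩, (congrArg (_ + ·) ha).trans (by abel)⟩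
  · intro hc
    obtain ⟨_, ⟨y, rfl⟩, _, ⟨a, rfl⟩, rfl⟩ := Submodule.mem_sup.1 hc
    have h1 : (exq R h).f n ((Chains.map R f).f n y) = 0 := by
      refine (congrArg ((cokernel.π (relC.map R f h)).f n) (relC.π_map_apply R f h n y)).symm.trans ?_
      exact congr($(congr($(cokernel.condition (relC.map R f h)).f n)) ((relC.π R B).f n y))
    have h2 : (exq R h).f n ((Chains.map R (subIncl A)).f n a) = 0 := by
      have := (relC.π_eq_zero_iff R A n _).2 ⟨a, rfl⟩
      refine (congrArg ((cokernel.π (relC.map R f h)).f n) this).trans (map_zero _)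
    refine (map_add _ _ _).trans ?_
    exact (congrArg₂ (· + ·) h1 h2).trans (add_zero 0)

/-- The homotopy formula writes z - Sd z - ∂(Sdh z) as Sdh(∂z), which is small when ∂z is. -/
lemma sub_Sd_mem (n : ℕ) (z : (Chains R X).X n)
    (hz : ∀ m, m + 1 = n → (Chains R X).d n m z ∈ smallChains R f A m) :
    ∃ w, z - Sd R X n z - (Chains R X).d (n + 1) n w ∈ smallChains R f A n := by
  refine ⟨Sdh R X n z, ?_⟩
  cases n with
  | zero =>
    have : (Chains R X).d 1 0 (Sdh R X 0 z) = z - Sd R X 0 z := congr($(Sdh_d_zero (R := R)) z)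
    rw [this, sub_self]
    exact Submodule.zero_mem _
  | succ n =>
    have : (Chains R X).d (n + 2) (n + 1) (Sdh R X (n + 1) z) +
      Sdh R X n ((Chains R X).d (n + 1) n z) = z - Sd R X (n + 1) z := congr($(Sdh_d (R := R) n) z)
    rw [← this, add_sub_cancel_left]
    exact op_mem_smallChains _ (hz n rfl)

lemma sub_Sd_iterate_mem (n : ℕ) (z : (Chains R X).X n)
    (hz : ∀ m, m + 1 = n → (Chains R X).d n m z ∈ smallChains R f A m) (j : ℕ) :
    ∃ w, z - (Sd R X n)^[j] z - (Chains R X).d (n + 1) n w ∈ smallChains R f A n := by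
  induction j with
  | zero => exact ⟨0, by simp⟩
  | succ j ih =>
    obtain ⟨w, hw⟩ := ih
    have hz' : ∀ m, m + 1 = n →
        (Chains R X).d n m ((Sd R X n)^[j] z) ∈ smallChains R f A m := by
      rintro m rfl
      have : (Chains R X).d (m + 1) m ((Sd R X (m + 1))^[j] z) =
          (Sd R X m)^[j] ((Chains R X).d (m + 1) m z) := by
        refine (Function.Semiconj.iterate_right (f := (Chains R X).d (m + 1) m) ?_ j) z
        exact fun x => congr($(Sd_d (R := R) (X := X) m) x)
      rw [this]
      exact Sd_iterate_mem_smallChains j (hz m rfl)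
    obtain ⟨w', hw'⟩ := sub_Sd_mem n _ hz'
    refine ⟨w + w', ?_⟩
    rw [Function.iterate_succ_apply', map_add]
    convert Submodule.add_mem _ hw hw' using 1
    abel

/-- A cycle of the quotient is represented by a chain z with small boundary. Some iterated
subdivision of z is small and differs from z by a boundary and a small chain, so z bounds in the
quotient. -/
lemma exQ_exactAt (hf : IsOpenEmbedding f) (hA : IsOpen A) (hc : Set.range f ∪ A = Set.univ)
    (h : Set.MapsTo f B A) (n : ℕ) : (exQ R h).ExactAt n := by
  rw [HomologicalComplex.exactAt_iff' _ (n + 1) n (n - 1) (by simp) (by cases n <;> simp),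
    ShortComplex.moduleCat_exact_iff]
  intro x hx
  obtain ⟨z, rfl⟩ := exq_surjective h n x
  have hz : ∀ m, m + 1 = n → (Chains R X).d n m z ∈ smallChains R f A m := by
    rintro m rfl
    rw [← exq_eq_zero_iff h]
    exact congr($((exq R h).comm (m + 1) m) z).symm.trans hx
  obtain ⟨j, hj⟩ := exists_Sd_iterate_mem hf hA hc z
  obtain ⟨w, hw⟩ := sub_Sd_iterate_mem n z hz j
  have hm : z - (Chains R X).d (n + 1) n w ∈ smallChains R f A n := by
    convert Submodule.add_mem _ hw hj using 1
    abel
  rw [← exq_eq_zero_iff h, map_sub, sub_eq_zero] at hm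
  refine ⟨(exq R h).f (n + 1) w, ?_⟩
  exact congr($((exq R h).comm (n + 1) n) w).trans hm.symm

/-- It matters that B is the whole preimage of A: a simplex of Y that f sends into A then already
lies in B. -/
lemma relC_map_f_injective (hf : IsEmbedding f) (hB : B = f ⁻¹' A) (h : Set.MapsTo f B A) (n : ℕ) :
    Function.Injective ((relC.map R f h).f n) := by
  rw [← AddMonoidHom.coe_coe, injective_iff_map_eq_zero]
  intro x hx
  obtain ⟨y, rfl⟩ := relC.π_surjective R _ n x
  have hx' : (relC.π R A).f n ((Chains.map R f).f n y) = 0 :=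
    (relC.π_map_apply R f h n y).symm.trans hx
  rw [relC.π_eq_zero_iff, mem_range_map_iff _ IsEmbedding.subtypeVal] at hx'
  refine (relC.π_eq_zero_iff R B n y).2 ?_
  rw [mem_range_map_iff _ IsEmbedding.subtypeVal]
  rintro σ hσ _ ⟨t, rfl⟩
  have := hx' (f.comp σ) (by rwa [coord_map_comp f hf.injective]) ⟨t, rfl⟩
  refine ⟨⟨σ t, ?_⟩, rfl⟩
  rw [hB]
  simpa using this

/-- Excision. -/
theorem Hmap_excision {n : ℕ} (hf : IsOpenEmbedding f) (hA : IsOpen A)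
    (hc : Set.range f ∪ A = Set.univ) (hB : B = f ⁻¹' A) (h : Set.MapsTo f B A) :
    Function.Bijective (Hmap R n f h) := by
  -- The cokernel of the map of relative chains is acyclic, so the long exact sequence forces a
  -- bijection.
  let S : ShortComplex (ChainComplex (ModuleCat.{0} ℤ) ℕ) :=
    ShortComplex.mk (relC.map R f h) (cokernel.π (relC.map R f h)) (cokernel.condition _)
  have hS : S.ShortExact :=
    { exact := ShortComplex.exact_cokernel _
      mono_f := by
        have : ∀ i, Mono ((relC.map R f h).f i) := fun i =>
          (ModuleCat.mono_iff_injective _).2 (relC_map_f_injective hf.isEmbedding hB h i)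
        exact HomologicalComplex.mono_of_mono_f _ this
      epi_g := inferInstanceAs (Epi (cokernel.π _)) }
  have hz : ∀ i (x : S.X₃.homology i), x = 0 := fun i x => by
    have := ((HomologicalComplex.exactAt_iff_isZero_homology _ _).1 (exQ_exactAt (R := R) hf hA hc h i))
    have := ModuleCat.subsingleton_of_isZero this
    exact Subsingleton.elim (α := (exQ R h).homology i) x 0
  constructor
  · rw [injective_iff_map_eq_zero]
    intro x hx
    obtain ⟨y, rfl⟩ := ((ShortComplex.ShortExact.moduleCat_exact_iff_function_exact _).1
      (hS.homology_exact₁ (n + 1) n rfl) x).1 hx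
    rw [hz _ y]
    exact map_zero _
  · intro x
    exact ((ShortComplex.ShortExact.moduleCat_exact_iff_function_exact _).1
      (hS.homology_exact₂ n) x).1 (hz _ _)

end ExcisionTheorem

/-! ### Compact supports -/

section CompactSupport

variable {R : ModuleCat.{0} ℤ} {X Y : Type} [TopologicalSpace X] [TopologicalSpace Y] {n : ℕ}

/-- Writing the differential as d n (n-1) covers degree zero as well, where d 0 0 is zero by the
shape of the complex. -/
lemma exists_cycle (K : ChainComplex (ModuleCat.{0} ℤ) ℕ) (x : K.X n) (hx : K.d n (n - 1) x = 0) :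
    ∃ c : K.cycles n, K.iCycles n c = x := by
  have := (ShortComplex.exact_of_f_is_kernel (ShortComplex.mk (K.iCycles n) (K.d n (n - 1))
    (K.iCycles_d _ _)) (K.cyclesIsKernel n (n - 1) (by cases n <;> simp)))
  rw [ShortComplex.moduleCat_exact_iff] at this
  exact this x hx

/-- Relative homology classes are compactly supported. -/
theorem exists_compact_support {A : Set X} (α : Hr R n A) :
    ∃ (K : Set X) (_ : IsCompact K) (hK : K ⊆ A) (β : Hr R n K), Hres hK β = α := by
  have hπ : ∀ K : ChainComplex (ModuleCat.{0} ℤ) ℕ, Function.Surjective (K.homologyπ n) := fun K =>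
    (ModuleCat.epi_iff_surjective _).1 inferInstance
  obtain ⟨c, rfl⟩ := hπ (relC R A) α
  obtain ⟨z, hz⟩ := relC.π_surjective R A n ((relC R A).iCycles n c)
  have hdz : (relC.π R A).f (n - 1) ((Chains R X).d n (n - 1) z) = 0 := by
    refine congr($((relC.π R A).comm n (n - 1)) z).symm.trans ?_
    refine (congrArg ((relC R A).d n (n - 1)) hz).trans ?_
    exact congr($((relC R A).iCycles_d n (n - 1)) c)
  rw [relC.π_eq_zero_iff, mem_range_map_iff _ IsEmbedding.subtypeVal] at hdz
  -- K is the union of the finitely many simplices in the boundary of z, so z is already a relative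
  -- cycle modulo K.
  let K : Set X := ⋃ σ ∈ (coord (n - 1) ((Chains R X).d n (n - 1) z)).support, Set.range σ
  have hK : K ⊆ A := Set.iUnion₂_subset fun σ hσ => by
    simpa using hdz σ (Finsupp.mem_support_iff.1 hσ)
  have hKz : (relC.π R K).f (n - 1) ((Chains R X).d n (n - 1) z) = 0 := by
    rw [relC.π_eq_zero_iff, mem_range_map_iff _ IsEmbedding.subtypeVal]
    intro σ hσ
    have : Set.range σ ⊆ K :=
      Set.subset_biUnion_of_mem (u := fun σ : C(Δs (n - 1), X) => Set.range σ)
        (Finsupp.mem_support_iff.2 hσ)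
    simpa using this
  obtain ⟨c', hc'⟩ := exists_cycle (relC R K) ((relC.π R K).f n z)
    (congr($((relC.π R K).comm n (n - 1)) z).trans hKz)
  refine ⟨K, ?_, hK, (relC R K).homologyπ n c', ?_⟩
  · exact (Finset.finite_toSet _).isCompact_biUnion fun σ _ => isCompact_range σ.continuous
  · refine congr($(HomologicalComplex.homologyπ_naturality
      (relC.map R (ContinuousMap.id X) (id_mapsTo hK)) n) c').trans ?_
    refine congrArg ((relC R A).homologyπ n) ?_
    have hinj : Function.Injective ((relC R A).iCycles n) :=
      (ModuleCat.mono_iff_injective _).1 inferInstance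
    apply hinj
    refine congr($(HomologicalComplex.cyclesMap_i
      (relC.map R (ContinuousMap.id X) (id_mapsTo hK)) n) c').trans ?_
    refine (congrArg ((relC.map R (ContinuousMap.id X) (id_mapsTo hK)).f n) hc').trans ?_
    refine (relC.π_map_apply R _ (id_mapsTo hK) n z).trans ?_
    rw [Chains.map_id]
    exact hz

end CompactSupport

/-! ### Absolute homology -/

section Absolute

variable (R : ModuleCat.{0} ℤ) {X Y : Type} [TopologicalSpace X] [TopologicalSpace Y] (n : ℕ)

/-- Singular homology with coefficients in `R`. -/
abbrev Ha (X : Type) [TopologicalSpace X] : ModuleCat.{0} ℤ := (Chains R X).homology n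

/-- The map induced on singular homology. -/
def Ha.map (f : C(X, Y)) : Ha R n X →ₗ[ℤ] Ha R n Y :=
  (HomologicalComplex.homologyMap (Chains.map R f) n).hom

/-- The map from absolute homology to homology relative to a subset. -/
def toRel (A : Set X) : Ha R n X →ₗ[ℤ] Hr R n A :=
  (HomologicalComplex.homologyMap (relC.π R A) n).hom

/-- The empty set carries no simplices. Absolute homology can therefore be handled as homology
relative to ∅. -/
lemma toRel_empty_bijective : Function.Bijective (toRel R n (∅ : Set X)) := by
  have : ∀ i, IsIso ((relC.π R (∅ : Set X)).f i) := fun i => by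
    have hmono : Mono ((relC.π R (∅ : Set X)).f i) := by
      rw [ModuleCat.mono_iff_injective, ← AddMonoidHom.coe_coe, injective_iff_map_eq_zero]
      intro c hc
      obtain ⟨a, rfl⟩ := (relC.π_eq_zero_iff R _ i c).1 hc
      have : a = 0 := by
        apply coord_injective
        ext σ
        exact (σ (vert i 0)).2.elim
      rw [this, map_zero]
    have : Epi ((relC.π R (∅ : Set X)).f i) := inferInstance
    exact isIso_of_mono_of_epi _
  have h1 : IsIso (relC.π R (∅ : Set X)) := HomologicalComplex.Hom.isIso_of_components _
  exact ConcreteCategory.bijective_of_isIso (HomologicalComplex.homologyMap (relC.π R ∅) n)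

variable {R n}

lemma toRel_map (f : C(X, Y)) {A : Set X} {B : Set Y} (h : Set.MapsTo f A B) (x : Ha R n X) :
    toRel R n B (Ha.map R n f x) = Hmap R n f h (toRel R n A x) := by
  have := congrArg (fun g => HomologicalComplex.homologyMap g n) (relC.π_map R f h)
  simp only [HomologicalComplex.homologyMap_comp] at this
  exact congr($this x).symm

/-! #### Reduction of coefficients modulo a prime -/

/-- The change of coefficients. -/
abbrev coefMap {R S : ModuleCat.{0} ℤ} (φ : R ⟶ S) (X : Type) [TopologicalSpace X] :
    Chains R X ⟶ Chains S X :=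
  ((singularChainComplexFunctor (ModuleCat.{0} ℤ)).map φ).app (TopCat.of X)

lemma sx_coefMap {R S : ModuleCat.{0} ℤ} (φ : R ⟶ S) {i : ℕ} (σ : C(Δs i, X)) :
    sx R σ ≫ (coefMap φ X).f i = φ ≫ sx S σ := by
  exact Sigma.ι_map (fun _ => φ) _

lemma coord_coefMap {R S : ModuleCat.{0} ℤ} (φ : R ⟶ S) {i : ℕ} (c : (Chains R X).X i) :
    coord i ((coefMap φ X).f i c) = (coord i c).mapRange φ (map_zero _) := by
  induction c using chains_induction with
  | h0 => simp
  | hadd c c' h h' =>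
    rw [map_add, map_add, map_add, Finsupp.mapRange_add (fun a b => map_add _ a b), h, h']
  | hs σ r =>
    have : (coefMap φ X).f i (sx R σ r) = sx S σ (φ r) := congr($(sx_coefMap φ σ) r)
    rw [this, coord_sx, coord_sx, Finsupp.mapRange_single]

variable (R) in
/-- Reduction of coefficients modulo `p`. -/
def redCoef (p : ℕ) : ModuleCat.of ℤ ℤ ⟶ ModuleCat.of ℤ (ZMod p) :=
  homOfAdd (Int.castAddHom (ZMod p))

/-- Reduction modulo `p` in homology. -/
def Ha.red (p : ℕ) (n : ℕ) (X : Type) [TopologicalSpace X] :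
    Ha (ModuleCat.of ℤ ℤ) n X →ₗ[ℤ] Ha (ModuleCat.of ℤ (ZMod p)) n X :=
  (HomologicalComplex.homologyMap (coefMap (redCoef p) X) n).hom

lemma Ha.red_map (p : ℕ) (f : C(X, Y)) (x : Ha (ModuleCat.of ℤ ℤ) n X) :
    Ha.red p n Y (Ha.map _ n f x) = Ha.map _ n f (Ha.red p n X x) := by
  have h : Chains.map (ModuleCat.of ℤ ℤ) f ≫ coefMap (redCoef p) Y =
      coefMap (redCoef p) X ≫ Chains.map _ f :=
    ((singularChainComplexFunctor (ModuleCat.{0} ℤ)).map (redCoef p)).naturality (TopCat.ofHom f)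
  have := congrArg (fun g => HomologicalComplex.homologyMap g n) h
  simp only [HomologicalComplex.homologyMap_comp] at this
  exact congr($this x)

lemma coefMap_zsmul (a : ℤ) : HomologicalComplex.homologyMap (coefMap (a • 𝟙 R) X) n =
    a • 𝟙 (Ha R n X) := by
  have : coefMap (a • 𝟙 R) X = a • 𝟙 (Chains R X) := by
    unfold coefMap
    rw [Functor.map_zsmul, CategoryTheory.Functor.map_id]
    rfl
  have h := (HomologicalComplex.homologyFunctor (ModuleCat.{0} ℤ) (ComplexShape.down ℕ) n).map_zsmul
    (f := 𝟙 (Chains R X)) (r := a)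
  rw [this]
  refine h.trans ?_
  rw [CategoryTheory.Functor.map_id]
  rfl

/-- Multiplication by p on the coefficients is zero, yet it induces multiplication by p on homology.
-/
lemma zmod_smul_eq_zero (p : ℕ) (x : Ha (ModuleCat.of ℤ (ZMod p)) n X) : (p : ℤ) • x = 0 := by
  have h0 : (p : ℤ) • 𝟙 (ModuleCat.of ℤ (ZMod p)) = 0 := by
    refine ModuleCat.hom_ext (LinearMap.ext fun r => ?_)
    change (p : ℤ) • (r : ZMod p) = 0
    simp
  have h := coefMap_zsmul (R := ModuleCat.of ℤ (ZMod p)) (X := X) (n := n) p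
  rw [h0] at h
  have hz : coefMap (0 : ModuleCat.of ℤ (ZMod p) ⟶ ModuleCat.of ℤ (ZMod p)) X = 0 := by
    unfold coefMap
    rw [Functor.map_zero]
    rfl
  rw [hz, HomologicalComplex.homologyMap_zero] at h
  have := congr($h x)
  simpa using this.symm

/-- Classes that vanish modulo `p` are divisible by `p`. -/
lemma exists_smul_of_red_eq_zero (p : ℕ) (hp : p ≠ 0) (x : Ha (ModuleCat.of ℤ ℤ) n X)
    (hx : Ha.red p n X x = 0) : ∃ y, x = (p : ℤ) • y := by
  have w : coefMap ((p : ℤ) • 𝟙 (ModuleCat.of ℤ ℤ)) X ≫ coefMap (redCoef p) X = 0 := by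
    unfold coefMap
    rw [← NatTrans.comp_app, ← Functor.map_comp]
    have : ((p : ℤ) • 𝟙 (ModuleCat.of ℤ ℤ)) ≫ redCoef p = 0 := by
      refine ModuleCat.hom_ext (LinearMap.ext fun r => ?_)
      change (((p : ℤ) • (r : ℤ) : ℤ) : ZMod p) = 0
      simp
    rw [this, Functor.map_zero]
    rfl
  -- This is the coefficient sequence 0 → ℤ → ℤ → ℤ/p → 0 on singular chains, exact because chains
  -- are finite sums of simplices with coefficients.
  let S : ShortComplex (ChainComplex (ModuleCat.{0} ℤ) ℕ) := ShortComplex.mk _ _ w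
  have hS : S.ShortExact := by
    refine HomologicalComplex.shortExact_of_degreewise_shortExact _ fun i => ?_
    have hmul : ∀ r : ℤ, ((p : ℤ) • 𝟙 (ModuleCat.of ℤ ℤ) : ModuleCat.of ℤ ℤ ⟶ _) r = (p : ℤ) * r :=
      fun r => rfl
    have hinj : Function.Injective ((coefMap ((p : ℤ) • 𝟙 (ModuleCat.of ℤ ℤ)) X).f i) := by
      intro c c' h
      apply coord_injective
      have h2 := congrArg (coord i) h
      rw [coord_coefMap, coord_coefMap] at h2
      ext σ
      have h3 := DFunLike.congr_fun h2 σ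
      simp only [Finsupp.mapRange_apply, hmul] at h3
      exact mul_left_cancel₀ (Int.natCast_ne_zero.2 hp) h3
    have hsurj : Function.Surjective ((coefMap (redCoef p) X).f i) := by
      intro c
      induction c using chains_induction with
      | h0 => exact ⟨0, map_zero _⟩
      | hadd c c' h h' =>
        obtain ⟨a, rfl⟩ := h
        obtain ⟨a', rfl⟩ := h'
        exact ⟨a + a', map_add _ _ _⟩
      | hs σ r =>
        obtain ⟨m, rfl⟩ := ZMod.intCast_surjective (n := p) r
        exact ⟨sx _ σ m, congr($(sx_coefMap (redCoef p) σ) m)⟩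
    refine @ShortComplex.ShortExact.mk _ _ _ _ ?_ ((ModuleCat.mono_iff_injective _).2 hinj)
      ((ModuleCat.epi_iff_surjective _).2 hsurj)
    rw [ShortComplex.moduleCat_exact_iff]
    intro (c : (Chains (ModuleCat.of ℤ ℤ) X).X i) hc
    have hc2 : coord i ((coefMap (redCoef p) X).f i c) = 0 :=
      (congrArg (coord i) hc).trans (map_zero _)
    rw [coord_coefMap] at hc2
    have hd : ∀ σ, (p : ℤ) ∣ coord i c σ := fun σ => by
      have := DFunLike.congr_fun hc2 σ
      rw [Finsupp.mapRange_apply] at this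
      exact (ZMod.intCast_zmod_eq_zero_iff_dvd _ _).1 this
    refine ⟨∑ σ ∈ (coord i c).support, sx (ModuleCat.of ℤ ℤ) σ ((coord i c σ : ℤ) / p : ℤ), ?_⟩
    change (coefMap ((p : ℤ) • 𝟙 (ModuleCat.of ℤ ℤ)) X).f i _ = c
    refine (map_sum _ _ _).trans (Eq.trans ?_ (sum_coord c))
    refine Finset.sum_congr rfl fun σ _ => ?_
    refine congr($(sx_coefMap ((p : ℤ) • 𝟙 (ModuleCat.of ℤ ℤ)) σ) _).trans ?_
    refine congrArg (sx _ σ) ?_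
    exact Int.mul_ediv_cancel' (hd σ)
  obtain ⟨y, hy⟩ := ((ShortComplex.ShortExact.moduleCat_exact_iff_function_exact _).1
    (hS.homology_exact₂ n) x).1 hx
  refine ⟨y, ?_⟩
  rw [← hy]
  exact congr($(coefMap_zsmul (R := ModuleCat.of ℤ ℤ) (X := X) (n := n) p) y)

end Absolute

/-! ### Homology in degree zero and of contractible spaces -/

section Points

variable (R : ModuleCat.{0} ℤ) {X Y : Type} [TopologicalSpace X] [TopologicalSpace Y] {n : ℕ}

/-- The class of a point. -/
def ptClass (x : X) : R ⟶ Ha R 0 X :=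
  (Chains R X).liftCycles (k := sx R (ContinuousMap.const (Δs 0) x)) 0 (by simp) (by simp) ≫
    (Chains R X).homologyπ 0

lemma ptClass_map (f : C(X, Y)) (x : X) :
    ptClass R x ≫ HomologicalComplex.homologyMap (Chains.map R f) 0 = ptClass R (f x) := by
  unfold ptClass
  rw [Category.assoc, HomologicalComplex.homologyπ_naturality,
    HomologicalComplex.liftCycles_comp_cyclesMap_assoc]
  congr 2
  exact sx_map _ _

/-- The augmentation. -/
def augm (X : Type) [TopologicalSpace X] : Ha R 0 X ⟶ R := (TopCat.of X).singularHomology₀ε R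

instance [PathConnectedSpace X] : IsIso (augm R X) :=
  inferInstanceAs (IsIso ((TopCat.of X).singularHomology₀ε R))

lemma ptClass_augm (x : X) : ptClass R x ≫ augm R X = 𝟙 R := by
  have := SSet.liftCycles_ιChainComplex_homologyπ_homology₀ε (TopCat.toSSet.obj (TopCat.of X)) R
    ((TopCat.toSSetObjEquiv (TopCat.of X) (.op (SimplexCategory.mk 0))).symm
      (ContinuousMap.const (Δs 0) x))
  exact (Category.assoc _ _ _).trans this

instance [PathConnectedSpace X] (x : X) : IsIso (ptClass R x) := by
  have h : ptClass R x = inv (augm R X) := by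
    rw [← cancel_mono (augm R X), ptClass_augm, IsIso.inv_hom_id]
  rw [h]
  infer_instance

variable {R}

lemma Ha_zero_map_bijective [PathConnectedSpace X] [PathConnectedSpace Y] (f : C(X, Y)) :
    Function.Bijective (Ha.map R 0 f) := by
  obtain ⟨x⟩ : Nonempty X := inferInstance
  have h := ptClass_map R f x
  have : HomologicalComplex.homologyMap (Chains.map R f) 0 =
      inv (ptClass R x) ≫ ptClass R (f x) := by
    rw [← h, IsIso.inv_hom_id_assoc]
  have h2 : IsIso (HomologicalComplex.homologyMap (Chains.map R f) 0) := by
    rw [this]; infer_instance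
  exact ConcreteCategory.bijective_of_isIso (HomologicalComplex.homologyMap (Chains.map R f) 0)

lemma Hr_zero_map_bijective [PathConnectedSpace X] [PathConnectedSpace Y] (f : C(X, Y))
    {A : Set X} {B : Set Y} (hA : A = ∅) (hB : B = ∅) (h : Set.MapsTo f A B) :
    Function.Bijective (Hmap R 0 f h) := by
  subst hA hB
  have h1 := toRel_empty_bijective R 0 (X := X)
  have h2 := toRel_empty_bijective R 0 (X := Y)
  have h3 : Hmap R 0 f h ∘ toRel R 0 ∅ = toRel R 0 ∅ ∘ Ha.map R 0 f :=
    funext fun x => (toRel_map f h x).symm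
  refine (Function.Bijective.of_comp_iff _ h1).1 ?_
  rw [h3]
  exact h2.comp (Ha_zero_map_bijective f)

variable (R) in
lemma Hr_zero_equiv [PathConnectedSpace X] {A : Set X} (hA : A = ∅) :
    Nonempty (Hr R 0 A ≃ₗ[ℤ] R) := by
  subst hA
  exact ⟨(LinearEquiv.ofBijective _ (toRel_empty_bijective R 0 (X := X))).symm ≪≫ₗ
    (asIso (augm R X)).toLinearEquiv⟩

/-- In degree zero every chain is a cycle, so any representative lifts. -/
lemma Hres_zero_surjective {A B : Set X} (h : A ⊆ B) :
    Function.Surjective (Hres (R := R) (n := 0) h) := by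
  have hπ : ∀ K : ChainComplex (ModuleCat.{0} ℤ) ℕ, Function.Surjective (K.homologyπ 0) := fun K =>
    (ModuleCat.epi_iff_surjective _).1 inferInstance
  intro β
  obtain ⟨c, rfl⟩ := hπ (relC R B) β
  obtain ⟨z, hz⟩ := relC.π_surjective R B 0 ((relC R B).iCycles 0 c)
  obtain ⟨c', hc'⟩ := exists_cycle (relC R A) ((relC.π R A).f 0 z)
    (congr($((relC R A).shape 0 (0 - 1) (by simp)) _))
  refine ⟨(relC R A).homologyπ 0 c', ?_⟩
  refine congr($(HomologicalComplex.homologyπ_naturality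
      (relC.map R (ContinuousMap.id X) (id_mapsTo h)) 0) c').trans ?_
  refine congrArg ((relC R B).homologyπ 0) ?_
  have hinj : Function.Injective ((relC R B).iCycles 0) :=
    (ModuleCat.mono_iff_injective _).1 inferInstance
  apply hinj
  refine congr($(HomologicalComplex.cyclesMap_i
    (relC.map R (ContinuousMap.id X) (id_mapsTo h)) 0) c').trans ?_
  refine (congrArg ((relC.map R (ContinuousMap.id X) (id_mapsTo h)).f 0) hc').trans ?_
  refine (relC.π_map_apply R _ (id_mapsTo h) 0 z).trans ?_
  rw [Chains.map_id]
  exact hz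

/-- In the sequence of the triple with A = B = X, the restriction map is the identity and the map
before it is an isomorphism, while their composite is zero. -/
lemma Hr_univ_subsingleton : Subsingleton (Hr R n (Set.univ : Set X)) := by
  refine subsingleton_of_forall_eq 0 fun x => ?_
  obtain ⟨y, rfl⟩ := (Hmap_homeomorph_bijective (R := R) (n := n) (Homeomorph.Set.univ X)
    (A := inSub Set.univ Set.univ) (B := Set.univ) (fun x => by simp)).2 x
  have h := (exact_sub_res (R := R) (n := n) (Set.Subset.refl (Set.univ : Set X)) _).2 ⟨y, rfl⟩
  exact (Hmap_id _ _ _).symm.trans h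

/-- If `X` deforms into `A`, then `H(X, A) = 0`. -/
lemma Hr_subsingleton_of_deformation {A : Set X} (r : C(unitInterval × X, X))
    (h0 : ∀ b, r (0, b) = b) (h1 : ∀ b, r (1, b) ∈ A) (hA : ∀ t, ∀ b ∈ A, r (t, b) ∈ A) :
    Subsingleton (Hr R n A) := by
  have := Hr_univ_subsingleton (R := R) (X := X) (n := n)
  exact (Hres_bijective_of_deformation (R := R) (n := n) (Set.subset_univ A)
    ⟨fun p => ⟨r (p.1, p.2.1), trivial⟩, by fun_prop⟩ (fun b => by ext; exact h0 b)
    (fun b => h1 b) (fun t b hb => hA t b hb)).1.subsingleton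

lemma Hr_pt_subsingleton [Subsingleton X] {A : Set X} (hA : A = ∅) :
    Subsingleton (Hr R (n + 1) A) := by
  subst hA
  have h := isZero_singularHomologyFunctor_of_totallyDisconnectedSpace (C := ModuleCat.{0} ℤ)
    (n + 1) R (TopCat.of X) (by simp)
  have : Subsingleton (Ha R (n + 1) X) := ModuleCat.subsingleton_of_isZero h
  exact (toRel_empty_bijective R (n + 1) (X := X)).2.subsingleton

/-- Homotopy equivalent spaces have isomorphic homology. -/
lemma Hmap_bijective_of_homotopyEquiv (f : C(X, Y)) (g : C(Y, X)) {A : Set X} {B : Set Y}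
    (h : Set.MapsTo f A B) (h' : Set.MapsTo g B A)
    (F : (g.comp f).Homotopy (.id X)) (hF : ∀ t, ∀ a ∈ A, F (t, a) ∈ A)
    (G : (f.comp g).Homotopy (.id Y)) (hG : ∀ t, ∀ b ∈ B, G (t, b) ∈ B) :
    Function.Bijective (Hmap R n f h) :=
  Hmap_bijective_of_inverse f g h h'
    (fun x => (Hmap_eq_of_homotopy F _ (fun _ h => h) hF x).trans (Hmap_id _ _ _))
    (fun x => (Hmap_eq_of_homotopy G _ (fun _ h => h) hG x).trans (Hmap_id _ _ _))

lemma Hr_contractible_subsingleton [ContractibleSpace X] {A : Set X} (hA : A = ∅) :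
    Subsingleton (Hr R (n + 1) A) := by
  subst hA
  obtain ⟨e⟩ := ContractibleSpace.hequiv_unit' (X := X)
  have := Hr_pt_subsingleton (R := R) (n := n) (X := Unit) (A := ∅) rfl
  exact (Hmap_bijective_of_homotopyEquiv (R := R) (n := n + 1) e.toFun e.invFun (A := ∅) (B := ∅)
    (fun _ h => h) (fun _ h => h) e.left_inv.some (fun _ _ h => h.elim)
    e.right_inv.some (fun _ _ h => h.elim)).1.subsingleton

/-- If `A` is contractible and nonempty, then `H(X) ≅ H(X, A)` in positive degrees. -/
lemma Hres_bijective_of_contractible {A : Set X} [ContractibleSpace A] [PathConnectedSpace X] :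
    Function.Bijective (Hres (R := R) (n := n + 1) (Set.empty_subset A)) := by
  have h1 := Hr_contractible_subsingleton (R := R) (n := n) (X := A) (A := inSub A ∅) rfl
  constructor
  · rw [injective_iff_map_eq_zero]
    intro x hx
    obtain ⟨y, rfl⟩ := (exact_sub_res (Set.empty_subset A) x).1 hx
    rw [Subsingleton.elim y 0, map_zero]
  · intro x
    refine (exact_res_δ (Set.empty_subset A) x).1 ?_
    -- It remains to see that the connecting map vanishes: for n = 0 because H_0(A) → H_0(X) is
    -- injective, both being path connected, and for n > 0 because H_n(A) = 0.
    cases n with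
    | zero =>
      refine (Hr_zero_map_bijective (R := R) (subIncl A) (A := inSub A ∅) (B := ∅) rfl rfl
        (subIncl_mapsTo A ∅)).1 ?_
      rw [map_zero]
      exact (exact_δ_sub (Set.empty_subset A) _).2 ⟨x, rfl⟩
    | succ n =>
      have h1 := Hr_contractible_subsingleton (R := R) (n := n) (X := A) (A := inSub A ∅) rfl
      exact Subsingleton.elim _ _

end Points

/-! ### Suspension -/

section Suspension

variable {R : ModuleCat.{0} ℤ} {Y : Type} [TopologicalSpace Y] {n : ℕ}

/-- The subset of `ℝ × Y` whose pair is the suspension of the pair `(Y, B)`. -/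
def susp (B : Set Y) : Set (ℝ × Y) := {p | p.1 ≠ 0 ∨ p.2 ∈ B}

/-- The upper part of `susp B`. -/
def suspUp (B : Set Y) : Set (ℝ × Y) := {p | 0 < p.1 ∨ p.2 ∈ B}

/-- The lower part of `susp B`. -/
def suspDown (B : Set Y) : Set (ℝ × Y) := {p | p.1 < 0 ∨ p.2 ∈ B}

omit [TopologicalSpace Y] in
lemma suspUp_subset (B : Set Y) : suspUp B ⊆ susp B := fun _ h => h.imp_left fun h => h.ne'

lemma isOpen_susp {B : Set Y} (hB : IsOpen B) : IsOpen (susp B) :=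
  (isOpen_ne_fun continuous_fst continuous_const).union (hB.preimage continuous_snd)

lemma isOpen_suspUp {B : Set Y} (hB : IsOpen B) : IsOpen (suspUp B) :=
  (isOpen_lt continuous_const continuous_fst).union (hB.preimage continuous_snd)

lemma isOpen_suspDown {B : Set Y} (hB : IsOpen B) : IsOpen (suspDown B) :=
  (isOpen_lt continuous_fst continuous_const).union (hB.preimage continuous_snd)

/-- Raising the real coordinate x by t(|x| + 1) preserves `suspUp B` and makes every height positive
at time 1. -/
lemma Hr_suspUp_subsingleton (B : Set Y) : Subsingleton (Hr R n (suspUp B)) := by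
  refine Hr_subsingleton_of_deformation ⟨fun p => (p.2.1 + p.1 * (|p.2.1| + 1), p.2.2), by fun_prop⟩
    (fun b => by simp) (fun b => Or.inl ?_) (fun t b hb => hb.imp (fun h => ?_) fun h => h)
  · have := neg_abs_le b.1
    simp only [ContinuousMap.coe_mk, Set.Icc.coe_one]
    linarith
  · have : 0 ≤ (t : ℝ) * (|b.1| + 1) := mul_nonneg t.2.1 (by positivity)
    simp only [ContinuousMap.coe_mk]
    linarith

lemma Hr_zero_susp_subsingleton (B : Set Y) : Subsingleton (Hr R 0 (susp B)) := by
  have := Hr_suspUp_subsingleton (R := R) (n := 0) B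
  exact (Hres_zero_surjective (R := R) (suspUp_subset B)).subsingleton

/-- Heights are moved linearly to -1; negative heights stay negative on the way and the Y-coordinate
is untouched. -/
lemma Hmap_suspDown_bijective (B : Set Y) : Function.Bijective
    (Hmap R n (A := (fun p : suspDown B => p.1.2) ⁻¹' B) (B := B)
      ⟨fun p : suspDown B => p.1.2, by fun_prop⟩ (fun _ h => h)) := by
  let g : C(Y, suspDown B) := ⟨fun y => ⟨(-1, y), Or.inl (by norm_num)⟩, by fun_prop⟩
  refine Hmap_bijective_of_homotopyEquiv _ g _ (fun y hy => hy)
    { toFun := fun q => ⟨(q.1 * q.2.1.1 - (1 - q.1), q.2.1.2), q.2.2.elim (fun h => ?_) Or.inr⟩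
      continuous_toFun := by fun_prop
      map_zero_left := fun x => by ext1; simp [g]
      map_one_left := fun x => by ext1; simp } (fun t a ha => ha)
    (ContinuousMap.Homotopy.refl _) (fun t a ha => ha)
  left
  have h0 := q.1.2.1
  have h1 := q.1.2.2
  change (q.1 : ℝ) * q.2.1.1 - (1 - q.1) < 0
  rcases h0.eq_or_lt with h0 | h0
  · rw [← h0]; norm_num
  · nlinarith [mul_neg_of_pos_of_neg h0 h]

/-- The suspension isomorphism. -/
theorem Hr_susp_equiv {B : Set Y} (hB : IsOpen B) :
    Nonempty (Hr R (n + 1) (susp B) ≃ₗ[ℤ] Hr R n B) := by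
  have h0 := Hr_suspUp_subsingleton (R := R) (n := n) B
  have h1 := Hr_suspUp_subsingleton (R := R) (n := n + 1) B
  -- In the triple suspUp ⊆ susp ⊆ ℝ × Y the pair with `suspUp` has no homology, so the connecting
  -- map is bijective.
  have hδ : Function.Bijective (Hδ R n (suspUp_subset B)) := by
    constructor
    · rw [injective_iff_map_eq_zero]
      intro x hx
      obtain ⟨y, rfl⟩ := (exact_res_δ (suspUp_subset B) x).1 hx
      rw [Subsingleton.elim y 0, map_zero]
    · exact fun x => (exact_δ_sub (suspUp_subset B) x).1 (Subsingleton.elim _ _)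
  let f : C(suspDown B, susp B) :=
    ⟨fun p => ⟨p.1, p.2.imp_left fun h => h.ne⟩, by fun_prop⟩
  have hf : IsOpenEmbedding f := by
    refine IsOpenEmbedding.of_comp f ((isOpen_susp hB).isOpenEmbedding_subtypeVal) ?_
    exact (isOpen_suspDown hB).isOpenEmbedding_subtypeVal
  -- The upper half is excised; what remains of `suspUp` in the lower part is the preimage of B.
  have hex := Hmap_excision (R := R) (n := n) (f := f) (A := inSub (susp B) (suspUp B))
    (B := (fun p : suspDown B => p.1.2) ⁻¹' B) hf
    ((isOpen_suspUp hB).preimage continuous_subtype_val) (by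
      rw [Set.eq_univ_iff_forall]
      rintro ⟨⟨t, y⟩, h⟩
      rcases lt_trichotomy t 0 with ht | ht | ht
      · exact Or.inl ⟨⟨(t, y), Or.inl ht⟩, rfl⟩
      · exact Or.inr (Or.inr (h.resolve_left fun h => h ht))
      · exact Or.inr (Or.inl ht)) (by
      ext ⟨⟨t, y⟩, h⟩
      change y ∈ B ↔ (0 < t ∨ y ∈ B)
      refine ⟨Or.inr, fun h' => h'.elim (fun h1 => h.elim (fun h2 => ?_) id) id⟩
      exact absurd h1 (not_lt.2 (le_of_lt h2)))
    (fun p hp => Or.inr hp)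
  exact ⟨(LinearEquiv.ofBijective _ hδ).trans ((LinearEquiv.ofBijective _ hex).symm.trans
    (LinearEquiv.ofBijective _ (Hmap_suspDown_bijective B)))⟩

/-- The complement of the zero section, together with the preimage of `B`, in `ℂ × Y`. -/
def csusp (B : Set Y) : Set (ℂ × Y) := {p | p.1 ≠ 0 ∨ p.2 ∈ B}

/-- `ℂ × Y` as an iterated product with real lines. -/
def complexProdHomeo (Y : Type) [TopologicalSpace Y] : ℂ × Y ≃ₜ ℝ × ℝ × Y :=
  (Complex.equivRealProdCLM.toHomeomorph.prodCongr (Homeomorph.refl Y)).trans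
    (Homeomorph.prodAssoc _ _ _)

lemma Hr_csusp_equiv_susp (B : Set Y) :
    Nonempty (Hr R n (csusp B) ≃ₗ[ℤ] Hr R n (susp (susp B))) := by
  refine ⟨LinearEquiv.ofBijective _ (Hmap_homeomorph_bijective (complexProdHomeo Y) ?_)⟩
  rintro ⟨z, y⟩
  change (z ≠ 0 ∨ y ∈ B) ↔ (z.re ≠ 0 ∨ (z.im ≠ 0 ∨ y ∈ B))
  rw [← or_assoc, Ne, Complex.ext_iff, not_and_or]
  rfl

/-- The double suspension isomorphism. -/
theorem Hr_csusp_equiv {B : Set Y} (hB : IsOpen B) :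
    Nonempty (Hr R (n + 2) (csusp B) ≃ₗ[ℤ] Hr R n B) :=
  ⟨(Hr_csusp_equiv_susp B).some.trans
    ((Hr_susp_equiv (isOpen_susp hB)).some.trans (Hr_susp_equiv hB).some)⟩

lemma Hr_csusp_subsingleton_zero (B : Set Y) : Subsingleton (Hr R 0 (csusp B)) := by
  have := Hr_zero_susp_subsingleton (R := R) (susp B)
  exact (Hr_csusp_equiv_susp B).some.injective.subsingleton

lemma Hr_csusp_subsingleton_one {B : Set Y} (hB : IsOpen B) : Subsingleton (Hr R 1 (csusp B)) := by
  have := Hr_zero_susp_subsingleton (R := R) B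
  exact ((Hr_csusp_equiv_susp B).some.trans
    (Hr_susp_equiv (isOpen_susp hB)).some).injective.subsingleton

lemma csusp_bijective_of_punctured_plane :
    Function.Bijective (Hmap R n (A := ({0}ᶜ : Set ℂ)) (B := csusp (∅ : Set Unit))
      ⟨fun z => (z, ()), by fun_prop⟩ (fun _ h => Or.inl h)) :=
  Hmap_homeomorph_bijective (Homeomorph.prodUnique ℂ Unit).symm fun z => by
    change z ≠ 0 ↔ (z ≠ 0 ∨ False)
    simp

variable (R) in
/-- The local homology of the plane in degree two. -/
theorem Hr_punctured_plane_two : Nonempty (Hr R 2 ({0}ᶜ : Set ℂ) ≃ₗ[ℤ] R) :=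
  ⟨(LinearEquiv.ofBijective _ csusp_bijective_of_punctured_plane).trans
    ((Hr_csusp_equiv isOpen_empty).some.trans (Hr_zero_equiv R rfl).some)⟩

lemma Hr_punctured_plane_subsingleton : Subsingleton (Hr R (n + 3) ({0}ᶜ : Set ℂ)) := by
  have := Hr_pt_subsingleton (R := R) (n := n) (X := Unit) (A := ∅) rfl
  exact ((LinearEquiv.ofBijective _ csusp_bijective_of_punctured_plane).trans
    (Hr_csusp_equiv (R := R) (n := n + 1) isOpen_empty).some).injective.subsingleton

/-- The local homology of `ℂ²` vanishes in degrees two and three. -/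
lemma Hr_punctured_plane_sq_subsingleton (h : n = 2 ∨ n = 3) :
    Subsingleton (Hr R n (csusp ({0}ᶜ : Set ℂ))) := by
  have h0 := Hr_csusp_subsingleton_zero (R := R) (∅ : Set Unit)
  have h1 := Hr_csusp_subsingleton_one (R := R) (isOpen_empty (X := Unit))
  rcases h with rfl | rfl
  · exact ((Hr_csusp_equiv (R := R) (n := 0) isOpen_compl_singleton).some.trans
      (LinearEquiv.ofBijective _ csusp_bijective_of_punctured_plane)).injective.subsingleton
  · exact ((Hr_csusp_equiv (R := R) (n := 1) isOpen_compl_singleton).some.trans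
      (LinearEquiv.ofBijective _ csusp_bijective_of_punctured_plane)).injective.subsingleton

variable (R) in
/-- The first homology of the circle, in the form of the punctured plane. -/
theorem Hr_one_punctured_plane {A : Set ({0}ᶜ : Set ℂ)} (hA : A = ∅) :
    Nonempty (Hr R 1 A ≃ₗ[ℤ] R) := by
  have h : (∅ : Set ℂ) ⊆ ({0}ᶜ : Set ℂ) := Set.empty_subset _
  have h1 := Hr_contractible_subsingleton (R := R) (n := 1) (X := ℂ) (A := ∅) rfl
  have h0 := Hr_contractible_subsingleton (R := R) (n := 0) (X := ℂ) (A := ∅) rfl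
  have hδ : Function.Bijective (Hδ R 1 h) := by
    constructor
    · rw [injective_iff_map_eq_zero]
      intro x hx
      obtain ⟨y, rfl⟩ := (exact_res_δ h x).1 hx
      rw [Subsingleton.elim y 0, map_zero]
    · exact fun x => (exact_δ_sub h x).1 (Subsingleton.elim _ _)
  have e : A = inSub ({0}ᶜ : Set ℂ) ∅ := hA
  subst e
  exact ⟨(LinearEquiv.ofBijective _ hδ).symm.trans (Hr_punctured_plane_two R).some⟩

end Suspension

/-! ### Mayer–Vietoris arguments -/

section MayerVietoris

variable {R : ModuleCat.{0} ℤ} {M N : Type} [TopologicalSpace M] [TopologicalSpace N] {n : ℕ}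

lemma Hres_Hres {A B C : Set M} (h : A ⊆ B) (h' : B ⊆ C) (x : Hr R n A) :
    Hres h' (Hres h x) = Hres (h.trans h') x :=
  Hmap_comp_eq (f := .id M) (g := .id M) (k := .id M) rfl _ _ _ x

lemma Hmap_Hres (f : C(M, N)) {A B : Set M} {A' B' : Set N} (h : A ⊆ B) (h' : A' ⊆ B')
    (hA : Set.MapsTo f A A') (hB : Set.MapsTo f B B') (x : Hr R n A) :
    Hmap R n f hB (Hres h x) = Hres h' (Hmap R n f hA x) :=
  Hmap_comm (f := .id M) (g := f) (f' := f) (g' := .id N) rfl _ _ _ _ x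

variable {A B : Set M}

lemma inter_mapsTo (A B : Set M) : Set.MapsTo (subMap (.id M)
    (id_mapsTo (Set.subset_union_left : A ⊆ A ∪ B))) (inSub A (A ∩ B)) (inSub (A ∪ B) B) :=
  fun _ h => h.2

/-- Excision for A inside A ∪ B; it plays the role of the Mayer–Vietoris sequence in the two lemmas
below. -/
lemma Hmap_inter_bijective (hA : IsOpen A) (hB : IsOpen B) :
    Function.Bijective (Hmap R n _ (inter_mapsTo A B)) := by
  refine Hmap_excision ?_ (hB.preimage continuous_subtype_val) ?_ ?_ _
  · refine IsOpenEmbedding.of_comp _ ((hA.union hB).isOpenEmbedding_subtypeVal) ?_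
    exact hA.isOpenEmbedding_subtypeVal
  · rw [Set.eq_univ_iff_forall]
    rintro ⟨x, hx | hx⟩
    · exact Or.inl ⟨⟨x, hx⟩, rfl⟩
    · exact Or.inr hx
  · ext x
    exact ⟨fun h => h.2, fun h => ⟨x.2, h⟩⟩

lemma Hsub_inter (β : Hr R n (inSub A (A ∩ B))) :
    Hres Set.inter_subset_right (Hsub A (A ∩ B) β) =
      Hsub (A ∪ B) B (Hmap R n _ (inter_mapsTo A B) β) :=
  Hmap_comm (f := subIncl A) (g := .id M)
    (f' := subMap (.id M) (id_mapsTo (Set.subset_union_left : A ⊆ A ∪ B)))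
    (g' := subIncl (A ∪ B)) rfl _ _ _ _ β

/-- A class is determined by its restrictions if there is no homology one degree above. -/
lemma eq_zero_of_Hres_eq_zero (hA : IsOpen A) (hB : IsOpen B)
    (h : Subsingleton (Hr R (n + 1) (A ∪ B))) (α : Hr R n (A ∩ B))
    (h₁ : Hres Set.inter_subset_left α = 0) (h₂ : Hres Set.inter_subset_right α = 0) : α = 0 := by
  obtain ⟨β, rfl⟩ := (exact_sub_res Set.inter_subset_left α).1 h₁
  rw [Hsub_inter] at h₂
  obtain ⟨ε, hε⟩ := (exact_δ_sub Set.subset_union_right _).1 h₂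
  rw [Subsingleton.elim ε 0, map_zero] at hε
  have : β = 0 := (Hmap_inter_bijective hA hB).1 (hε.symm.trans (map_zero _).symm)
  rw [this, map_zero]

/-- Classes which agree on the union can be glued. -/
lemma exists_glue (hA : IsOpen A) (hB : IsOpen B) (α : Hr R (n + 1) A) (β : Hr R (n + 1) B)
    (h : Hres Set.subset_union_left α = Hres (Set.subset_union_right (s := A)) β) :
    ∃ γ : Hr R (n + 1) (A ∩ B), Hres Set.inter_subset_left γ = α ∧
      Hres Set.inter_subset_right γ = β := by
  have h1 : Hδ R n (Set.inter_subset_left (s := A) (t := B)) α = 0 := by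
    apply (Hmap_inter_bijective hA hB).1
    have := Hδ_naturality (R := R) (n := n) (.id M) (Set.inter_subset_left (s := A) (t := B))
      (Set.subset_union_right (s := A) (t := B)) (id_mapsTo Set.inter_subset_right)
      (id_mapsTo Set.subset_union_left) α
    refine this.symm.trans ?_
    rw [map_zero]
    exact (exact_res_δ Set.subset_union_right _).2 ⟨β, h.symm⟩
  obtain ⟨γ, rfl⟩ := (exact_res_δ Set.inter_subset_left α).1 h1
  have h2 : Hres (Set.subset_union_right (s := A)) (β - Hres Set.inter_subset_right γ) = 0 := by
    rw [map_sub, ← h, Hres_Hres, Hres_Hres, sub_self]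
  obtain ⟨η, hη⟩ := (exact_sub_res Set.subset_union_right _).1 h2
  obtain ⟨η, rfl⟩ := (Hmap_inter_bijective hA hB).2 η
  -- The class γ is correct on A. Its error on B comes from H(A ∪ B, B) ≅ H(A, A ∩ B), and adding
  -- the image of η repairs it without changing the restriction to A.
  refine ⟨γ + Hsub A (A ∩ B) η, ?_, ?_⟩
  · rw [map_add, (exact_sub_res Set.inter_subset_left _).2 ⟨η, rfl⟩, add_zero]
  · rw [map_add, Hsub_inter, hη, add_sub_cancel]

end MayerVietoris

/-! ### Homology of the plane relative to complements of compact sets -/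

section LocalHomology

variable {R : ModuleCat.{0} ℤ} {M N : Type} [TopologicalSpace M] [TopologicalSpace N] {n : ℕ}

/-- Restriction of a relative class to a point. -/
def resPt {A : Set M} {x : M} (hx : x ∉ A) : Hr R n A →ₗ[ℤ] Hr R n ({x}ᶜ : Set M) :=
  Hres (Set.subset_compl_singleton_iff.2 hx)

lemma resPt_Hres {A B : Set M} (h : A ⊆ B) {x : M} (hx : x ∉ B) (α : Hr R n A) :
    resPt hx (Hres h α) = resPt (fun h' => hx (h h')) α :=
  Hres_Hres h (Set.subset_compl_singleton_iff.2 hx) α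

variable (R) in
/-- `A` is the complement of a set `K` such that the homology relative to `A` vanishes above degree
two, and in degree two is detected by restriction to the points of `K`. -/
def IsDetected (A : Set M) : Prop :=
  (∀ n, Subsingleton (Hr R (n + 3) A)) ∧
    ∀ α : Hr R 2 A, (∀ x (hx : x ∉ A), resPt hx α = 0) → α = 0

/-- With A and B the complements of K and L, this passes from K, L and K ∩ L to K ∪ L. Vanishing in
one degree higher for K ∩ L is what makes a class on K ∪ L determined by its two restrictions. -/
lemma IsDetected.inter {A B : Set M} (hA : IsOpen A) (hB : IsOpen B) (h₁ : IsDetected R A)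
    (h₂ : IsDetected R B) (h : IsDetected R (A ∪ B)) : IsDetected R (A ∩ B) := by
  constructor
  · intro n
    have := h₁.1 n
    have := h₂.1 n
    exact subsingleton_of_forall_eq 0 fun α => eq_zero_of_Hres_eq_zero hA hB (h.1 (n + 1)) α
      (Subsingleton.elim _ _) (Subsingleton.elim _ _)
  · intro α hα
    refine eq_zero_of_Hres_eq_zero hA hB (h.1 0) α (h₁.2 _ fun x hx => ?_)
      (h₂.2 _ fun x hx => ?_)
    · rw [resPt_Hres]; exact hα x _
    · rw [resPt_Hres]; exact hα x _

lemma isDetected_univ : IsDetected R (Set.univ : Set M) :=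
  ⟨fun _ => Hr_univ_subsingleton, fun _ _ =>
    (Hr_univ_subsingleton (R := R) (X := M) (n := 2)).elim _ _⟩

lemma isDetected_of_bijective {A : Set M} {x : M} (hx : x ∉ A)
    (h : ∀ n, Function.Injective (resPt (R := R) (n := n) hx))
    (h' : ∀ n, Subsingleton (Hr R (n + 3) ({x}ᶜ : Set M))) : IsDetected R A :=
  ⟨fun n => (have := h' n; (h (n + 3)).subsingleton), fun _ hα => h 2 ((hα x hx).trans (map_zero _).symm)⟩

variable {V : Type} [NormedAddCommGroup V] [NormedSpace ℝ V]

/-- The complement of a point deforms into the complement of a bounded convex set. -/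
lemma resPt_bijective_of_convex {K : Set V} (hK : Bornology.IsBounded K) (hc : Convex ℝ K) {x : V}
    (hx' : x ∉ Kᶜ) : Function.Bijective (resPt (R := R) (n := n) hx') := by
  have hx := Set.notMem_compl_iff.1 hx'
  obtain ⟨ρ, hρ⟩ := (Metric.isBounded_iff_subset_closedBall x).1 hK
  have hρ0 : 0 ≤ ρ := by simpa using (Metric.mem_closedBall.1 (hρ hx))
  have hpos : ∀ b : ({x}ᶜ : Set V), 0 < ‖(b : V) - x‖ := fun b => norm_pos_iff.2 (sub_ne_zero.2 b.2)
  have hs : ∀ (t : unitInterval) (b : ({x}ᶜ : Set V)), 1 ≤ 1 + (t : ℝ) * ((ρ + 1) / ‖(b : V) - x‖) :=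
    fun t b => by
      have : 0 ≤ (t : ℝ) * ((ρ + 1) / ‖(b : V) - x‖) := mul_nonneg t.2.1 (by positivity)
      linarith
  -- Radial expansion from x: at time t the distance to x has grown by t(ρ + 1), so at time 1 the
  -- point has left the ball of radius ρ containing K. By convexity a point outside K cannot enter K
  -- while receding from x ∈ K.
  refine Hres_bijective_of_deformation (Set.subset_compl_singleton_iff.2 hx')
    ⟨fun p => ⟨x + (1 + (p.1 : ℝ) * ((ρ + 1) / ‖(p.2 : V) - x‖)) • ((p.2 : V) - x), ?_⟩, ?_⟩ ?_ ?_ ?_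
  · have h1 := hs p.1 p.2
    simp only [Set.mem_compl_iff, Set.mem_singleton_iff, add_eq_left, smul_eq_zero, sub_eq_zero,
      not_or]
    exact ⟨by linarith, p.2.2⟩
  · refine Continuous.subtype_mk ?_ _
    refine continuous_const.add (Continuous.smul ?_ (by fun_prop))
    refine continuous_const.add (Continuous.mul (by fun_prop) ?_)
    exact continuous_const.div (by fun_prop) fun p => (hpos p.2).ne'
  · intro b; ext; simp
  · intro b hb
    have h1 := hρ hb
    have h2 := hpos b
    rw [mem_closedBall_iff_norm, ContinuousMap.coe_mk, add_sub_cancel_left, norm_smul,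
      Real.norm_of_nonneg (by linarith [hs 1 b]), Set.Icc.coe_one, one_mul, add_mul, one_mul,
      div_mul_cancel₀ _ h2.ne'] at h1
    linarith
  · intro t b hb h
    apply hb
    have h1 := hs t b
    set s := 1 + (t : ℝ) * ((ρ + 1) / ‖(b : V) - x‖) with hsdef
    have h2 := hc.add_smul_mem hx (y := s • ((b : V) - x)) h (t := s⁻¹)
      ⟨by positivity, inv_le_one_of_one_le₀ h1⟩
    rwa [smul_smul, inv_mul_cancel₀ (by positivity), one_smul, add_sub_cancel] at h2

lemma Hr_compl_singleton_subsingleton (x : ℂ) : Subsingleton (Hr R (n + 3) ({x}ᶜ : Set ℂ)) := by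
  have := Hr_punctured_plane_subsingleton (R := R) (n := n)
  refine (Hmap_homeomorph_bijective (R := R) (n := n + 3) (Homeomorph.addRight (-x))
    (A := ({x}ᶜ : Set ℂ)) (B := {0}ᶜ) (fun y => ?_)).1.subsingleton
  simp [add_neg_eq_zero]

variable (R) in
lemma Hr_compl_singleton_two (x : ℂ) : Nonempty (Hr R 2 ({x}ᶜ : Set ℂ) ≃ₗ[ℤ] R) := by
  refine ⟨(LinearEquiv.ofBijective _ (Hmap_homeomorph_bijective (R := R) (n := 2)
    (Homeomorph.addRight (-x)) (A := ({x}ᶜ : Set ℂ)) (B := {0}ᶜ) (fun y => ?_))).trans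
    (Hr_punctured_plane_two R).some⟩
  simp [add_neg_eq_zero]

lemma isDetected_of_convex {K : Set ℂ} (hK : Bornology.IsBounded K) (hc : Convex ℝ K) :
    IsDetected R (Kᶜ) := by
  rcases K.eq_empty_or_nonempty with rfl | ⟨x, hx⟩
  · rw [Set.compl_empty]; exact isDetected_univ
  · have hx' : x ∉ Kᶜ := fun h => h hx
    exact isDetected_of_bijective hx' (fun n => (resPt_bijective_of_convex hK hc hx').1)
      fun n => Hr_compl_singleton_subsingleton x

/-- The induction is on the length of the list, not its structure: the sets K ∩ L for L in the tail
form another list of the same length as the tail, to which the hypothesis also applies. -/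
lemma isDetected_of_list (m : ℕ) : ∀ (l : List (Set ℂ)), l.length = m →
    (∀ K ∈ l, IsCompact K ∧ Convex ℝ K) → IsDetected R ((⋃ K ∈ l, K)ᶜ) := by
  induction m with
  | zero =>
    intro l hl _
    rw [List.length_eq_zero_iff.1 hl]
    simpa using isDetected_univ
  | succ m ih =>
    intro l hl h
    obtain _ | ⟨K, l⟩ := l
    · simp at hl
    have hl' : l.length = m := by simpa using hl
    have hKc := h K (by simp)
    have hLc : ∀ L ∈ l, IsCompact L ∧ Convex ℝ L := fun L hL => h L (by simp [hL])
    have hcl : IsClosed (⋃ L ∈ l, L) := by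
      have : (⋃ L ∈ l, L) = ⋃ L ∈ {L | L ∈ l}, L := rfl
      rw [this]
      exact (List.finite_toSet l).isClosed_biUnion fun L hL => (hLc L hL).1.isClosed
    have e : (⋃ L ∈ K :: l, L)ᶜ = Kᶜ ∩ (⋃ L ∈ l, L)ᶜ := by
      rw [← Set.compl_union]
      congr 1
      ext x
      simp
    have e' : Kᶜ ∪ (⋃ L ∈ l, L)ᶜ = (⋃ L ∈ l.map (K ∩ ·), L)ᶜ := by
      rw [← Set.compl_inter]
      congr 1
      ext x
      simp
    rw [e]
    refine IsDetected.inter hKc.1.isClosed.isOpen_compl hcl.isOpen_compl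
      (isDetected_of_convex hKc.1.isBounded hKc.2) (ih l hl' hLc) ?_
    rw [e']
    refine ih _ (by simpa using hl') fun L hL => ?_
    obtain ⟨L', hL', rfl⟩ := List.mem_map.1 hL
    exact ⟨hKc.1.inter_right (hLc L' hL').1.isClosed, hKc.2.inter (hLc L' hL').2⟩

/-- Detection for compact subsets of the plane. -/
theorem isDetected_of_isCompact_plane {K : Set ℂ} (hK : IsCompact K) : IsDetected R (Kᶜ) := by
  -- By compactness of supports a class extends to a neighbourhood of K, hence to a finite union of
  -- closed balls centred at points of K.
  have key : ∀ n (α : Hr R n (Kᶜ)), ∃ (l : List (Set ℂ)) (h : (⋃ L ∈ l, L)ᶜ ⊆ Kᶜ),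
      (∀ L ∈ l, IsCompact L ∧ Convex ℝ L ∧ ∃ x ∈ K, x ∈ L) ∧ ∃ β, Hres h β = α := by
    intro n α
    obtain ⟨C, hC, hCK, β, hβ⟩ := exists_compact_support α
    have hCc : IsOpen (Cᶜ) := hC.isClosed.isOpen_compl
    have hr : ∀ x ∈ K, ∃ r > 0, Metric.closedBall x r ⊆ Cᶜ := fun x hx =>
      Metric.nhds_basis_closedBall.mem_iff.1 (hCc.mem_nhds fun h => hCK h hx)
    choose! r hr0 hr using hr
    obtain ⟨t, ht, hKt⟩ := hK.elim_nhds_subcover (fun x => Metric.closedBall x (r x))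
      fun x hx => Metric.closedBall_mem_nhds x (hr0 x hx)
    have e : (⋃ L ∈ t.toList.map fun x => Metric.closedBall x (r x), L) =
        ⋃ x ∈ t, Metric.closedBall x (r x) := by
      ext y
      simp
    refine ⟨t.toList.map fun x => Metric.closedBall x (r x), ?_, ?_, ?_⟩
    · rw [Set.compl_subset_compl, e]
      exact hKt
    · intro L hL
      simp only [List.mem_map, Finset.mem_toList] at hL
      obtain ⟨x, hx, rfl⟩ := hL
      exact ⟨isCompact_closedBall _ _, convex_closedBall _ _, x, ht x hx,
        Metric.mem_closedBall_self (hr0 x (ht x hx)).le⟩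
    · have hC' : C ⊆ (⋃ L ∈ t.toList.map fun x => Metric.closedBall x (r x), L)ᶜ := by
        rw [e, Set.subset_compl_comm]
        exact Set.iUnion₂_subset fun x hx => hr x (ht x hx)
      exact ⟨Hres hC' β, (Hres_Hres _ _ _).trans hβ⟩
  constructor
  · intro n
    refine subsingleton_of_forall_eq 0 fun α => ?_
    obtain ⟨l, h, hl, β, rfl⟩ := key _ α
    have := (isDetected_of_list (R := R) _ l rfl fun L hL => ⟨(hl L hL).1, (hl L hL).2.1⟩).1 n
    rw [Subsingleton.elim β 0, map_zero]
  · intro α hα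
    obtain ⟨l, h, hl, β, rfl⟩ := key _ α
    suffices β = 0 by rw [this, map_zero]
    refine (isDetected_of_list _ l rfl fun L hL => ⟨(hl L hL).1, (hl L hL).2.1⟩).2 β fun y hy => ?_
    simp only [Set.mem_compl_iff, Set.mem_iUnion, not_not] at hy
    obtain ⟨L, hL, hyL⟩ := hy
    obtain ⟨hLc, hLv, x, hxK, hxL⟩ := hl L hL
    have hsub : (⋃ L ∈ l, L)ᶜ ⊆ Lᶜ :=
      Set.compl_subset_compl.2 (Set.subset_biUnion_of_mem (s := {L | L ∈ l}) (u := fun L => L) hL)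
    -- On a convex piece the restriction to a single point is injective, and each piece contains a
    -- point of K, where the class vanishes.
    have hz : Hres hsub β = 0 := by
      apply (resPt_bijective_of_convex (R := R) hLc.isBounded hLv (fun h => h hxL : x ∉ Lᶜ)).1
      rw [resPt_Hres, map_zero]
      have := hα x (fun h => h hxK)
      rwa [resPt_Hres] at this
    have := resPt_Hres hsub (fun h => h hyL : y ∉ Lᶜ) β
    rw [← this, hz, map_zero]

end LocalHomology

/-! ### Homology of surfaces -/

section Surface

variable {R : ModuleCat.{0} ℤ} {M : Type} [TopologicalSpace M] {n : ℕ}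

/-- Every point has a neighbourhood parametrised by the plane. -/
def HasPlaneCharts (M : Type) [TopologicalSpace M] : Prop :=
  ∀ x : M, ∃ f : C(ℂ, M), IsOpenEmbedding f ∧ f 0 = x

lemma Hmap_chart_bijective {f : C(ℂ, M)} (hf : IsOpenEmbedding f) {A : Set M} (hA : IsOpen A)
    (hc : Aᶜ ⊆ Set.range f) :
    Function.Bijective (Hmap R n (A := f ⁻¹' A) (B := A) f (fun _ h => h)) :=
  Hmap_excision hf hA (by rwa [Set.union_comm, ← Set.compl_subset_iff_union]) rfl _

lemma preimage_compl_singleton {f : C(ℂ, M)} (hf : IsOpenEmbedding f) (y : ℂ) :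
    f ⁻¹' {f y}ᶜ = {y}ᶜ := by
  ext z
  simp [hf.injective.eq_iff]

lemma chart_mapsTo {f : C(ℂ, M)} (hf : IsOpenEmbedding f) (y : ℂ) :
    Set.MapsTo f {y}ᶜ {f y}ᶜ := fun z hz => by
  simpa [hf.injective.eq_iff] using hz

lemma Hmap_chart_pt_bijective [T2Space M] {f : C(ℂ, M)} (hf : IsOpenEmbedding f) (y : ℂ) :
    Function.Bijective (Hmap R n f (chart_mapsTo hf y)) :=
  Hmap_excision hf isOpen_compl_singleton (by
    rw [Set.union_comm, ← Set.compl_subset_iff_union]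
    simp) (preimage_compl_singleton hf y).symm _

lemma resPt_chart {f : C(ℂ, M)} (hf : IsOpenEmbedding f) {A : Set M} {y : ℂ} (hy : f y ∉ A)
    (α : Hr R n (f ⁻¹' A)) :
    resPt hy (Hmap R n (A := f ⁻¹' A) (B := A) f (fun _ h => h) α) =
      Hmap R n f (chart_mapsTo hf y) (resPt (show y ∉ f ⁻¹' A from hy) α) :=
  (Hmap_Hres (R := R) (n := n) f (A := f ⁻¹' A) (A' := A)
    (Set.subset_compl_singleton_iff.2 (show y ∉ f ⁻¹' A from hy))
    (Set.subset_compl_singleton_iff.2 hy) (fun _ h => h) (chart_mapsTo hf y) α).symm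

variable [T2Space M]

lemma isDetected_of_chart {f : C(ℂ, M)} (hf : IsOpenEmbedding f) {K : Set M} (hK : IsCompact K)
    (hc : K ⊆ Set.range f) : IsDetected R (Kᶜ) := by
  have hb := fun n => Hmap_chart_bijective (R := R) (n := n) hf hK.isClosed.isOpen_compl
    (by rwa [compl_compl])
  have hd : IsDetected R (f ⁻¹' Kᶜ) := by
    rw [Set.preimage_compl]
    exact isDetected_of_isCompact_plane (hf.isInducing.isCompact_preimage' hK hc)
  constructor
  · intro n
    have := hd.1 n
    exact (hb (n + 3)).2.subsingleton
  · intro α hα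
    obtain ⟨β, rfl⟩ := (hb 2).2 α
    rw [hd.2 β fun y hy => ?_, map_zero]
    have := hα (f y) hy
    rw [resPt_chart hf] at this
    exact (Hmap_chart_pt_bijective hf y).1 (this.trans (map_zero _).symm)

/-- Detection for compact subsets of a surface. -/
theorem isDetected_of_isCompact (hM : HasPlaneCharts M) {K : Set M} (hK : IsCompact K) :
    IsDetected R (Kᶜ) := by
  classical
  choose f hf hf0 using hM
  have key : ∀ (t : Finset M) (L : M → Set M), (∀ i, IsCompact (L i)) →
      (∀ i, L i ⊆ Set.range (f i)) → IsDetected R ((⋃ i ∈ t, L i)ᶜ) := by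
    intro t
    induction t using Finset.induction_on with
    | empty => intro L _ _; simpa using isDetected_univ
    | insert a t _ ih =>
      intro L hL hLf
      have hc : IsClosed (⋃ i ∈ t, L i) :=
        (Finset.finite_toSet t).isClosed_biUnion fun i _ => (hL i).isClosed
      rw [Finset.set_biUnion_insert, Set.compl_union]
      refine IsDetected.inter (hL a).isClosed.isOpen_compl hc.isOpen_compl
        (isDetected_of_chart (hf a) (hL a) (hLf a)) (ih L hL hLf) ?_
      rw [← Set.compl_inter]
      exact isDetected_of_chart (hf a) ((hL a).inter_right hc)
        (Set.inter_subset_left.trans (hLf a))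
  obtain ⟨t, ht⟩ := hK.elim_finite_subcover (fun i => Set.range (f i))
    (fun i => (hf i).isOpen_range) fun x _ => Set.mem_iUnion.2 ⟨x, 0, hf0 x⟩
  obtain ⟨L, hL, hLf, rfl⟩ := hK.finite_compact_cover t (fun i => Set.range (f i))
    (fun i _ => (hf i).isOpen_range) ht
  exact key t L hL hLf

/-- Small neighbourhoods with bijective restriction to points. -/
lemma exists_nhd_resPt_bijective (hM : HasPlaneCharts M) {C : Set M} (hC : IsClosed C) {x : M}
    (hx : x ∉ C) : ∃ D ∈ 𝓝 x, C ⊆ Dᶜ ∧ ∀ (R : ModuleCat.{0} ℤ) (n : ℕ), ∀ y (hy : y ∉ Dᶜ),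
      Function.Bijective (resPt (R := R) (n := n) hy) := by
  obtain ⟨f, hf, rfl⟩ := hM x
  obtain ⟨r, hr0, hr⟩ := Metric.nhds_basis_closedBall.mem_iff.1
    ((hC.isOpen_compl.preimage f.continuous).mem_nhds hx)
  have hcomp : IsCompact (f '' Metric.closedBall 0 r) := (isCompact_closedBall _ _).image f.continuous
  refine ⟨f '' Metric.closedBall 0 r, hf.isOpenMap.image_mem_nhds
    (Metric.closedBall_mem_nhds _ hr0), ?_, ?_⟩
  · rw [Set.subset_compl_comm, Set.image_subset_iff]
    exact hr
  · rintro R n y hy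
    obtain ⟨y, hyr, rfl⟩ := Set.notMem_compl_iff.1 hy
    have h1 := Hmap_chart_bijective (R := R) (n := n) hf hcomp.isClosed.isOpen_compl
      (by rw [compl_compl]; exact Set.image_subset_range _ _)
    have e : (f ⁻¹' (f '' Metric.closedBall 0 r)ᶜ)= (Metric.closedBall 0 r)ᶜ := by
      rw [Set.preimage_compl, Set.preimage_image_eq _ hf.injective]
    have h2 : ∀ (A : Set ℂ) (hA : A = (Metric.closedBall 0 r)ᶜ) (hy : y ∉ A),
        Function.Bijective (resPt (R := R) (n := n) hy) := by
      rintro _ rfl hy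
      exact resPt_bijective_of_convex Metric.isBounded_closedBall (convex_closedBall _ _) hy
    refine (Function.Bijective.of_comp_iff _ h1).1 ?_
    have h3 : resPt hy ∘ Hmap R n (A := f ⁻¹' (f '' Metric.closedBall 0 r)ᶜ) f (fun _ h => h) =
        Hmap R n f (chart_mapsTo hf y) ∘ resPt (show y ∉ f ⁻¹' (f '' Metric.closedBall 0 r)ᶜ from hy) :=
      funext fun α => resPt_chart hf hy α
    rw [h3]
    exact (Hmap_chart_pt_bijective hf y).comp (h2 _ e hy)

/-- A relative class that vanishes at one point vanishes at all points of a connected complement. -/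
theorem resPt_eq_zero_of_isPreconnected (hM : HasPlaneCharts M) {C : Set M} (hC : IsClosed C)
    (hc : IsPreconnected Cᶜ) (α : Hr R n C) {x : M} (hx : x ∉ C) (h : resPt hx α = 0) {y : M}
    (hy : y ∉ C) : resPt hy α = 0 := by
  have key : ∀ z, z ∉ C → ∃ D ∈ 𝓝 z, ∀ y ∈ D, ∀ w ∈ D, ∀ (hy : y ∉ C) (hw : w ∉ C),
      resPt hy α = 0 → resPt hw α = 0 := by
    intro z hz
    obtain ⟨D, hD, hCD, hb⟩ := exists_nhd_resPt_bijective hM hC hz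
    refine ⟨D, hD, fun y hy w hw hyC hwC h0 => ?_⟩
    have hy' : y ∉ Dᶜ := fun h => h hy
    have hw' : w ∉ Dᶜ := fun h => h hw
    rw [← resPt_Hres hCD hy'] at h0
    rw [← resPt_Hres hCD hw', (hb R n y hy').1 (h0.trans (map_zero _).symm), map_zero]
  -- Vanishing and non-vanishing of the restriction are both open conditions outside C, by the
  -- neighbourhoods of `key`.
  let u : Set M := {z | ∃ hz : z ∉ C, resPt hz α = 0}
  let v : Set M := {z | ∃ hz : z ∉ C, resPt hz α ≠ 0}
  have hu : IsOpen u := isOpen_iff_mem_nhds.2 fun z ⟨hz, h0⟩ => by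
    obtain ⟨D, hD, hk⟩ := key z hz
    filter_upwards [hD, hC.isOpen_compl.mem_nhds hz] with w hw hwC
    exact ⟨hwC, hk z (mem_of_mem_nhds hD) w hw hz hwC h0⟩
  have hv : IsOpen v := isOpen_iff_mem_nhds.2 fun z ⟨hz, h0⟩ => by
    obtain ⟨D, hD, hk⟩ := key z hz
    filter_upwards [hD, hC.isOpen_compl.mem_nhds hz] with w hw hwC
    exact ⟨hwC, fun h' => h0 (hk w hw z (mem_of_mem_nhds hD) hwC hz h')⟩
  have := hc.subset_left_of_subset_union hu hv
    (Set.disjoint_left.2 fun z ⟨_, h1⟩ ⟨_, h2⟩ => h2 h1)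
    (fun z hz => (em (resPt hz α = 0)).imp (fun h => ⟨hz, h⟩) (fun h => ⟨hz, h⟩))
    ⟨x, hx, hx, h⟩
  obtain ⟨_, h'⟩ := this hy
  exact h'

variable (R) in
lemma Hr_compl_point_two (hM : HasPlaneCharts M) (x : M) :
    Nonempty (Hr R 2 ({x}ᶜ : Set M) ≃ₗ[ℤ] R) := by
  obtain ⟨f, hf, rfl⟩ := hM x
  exact ⟨(LinearEquiv.ofBijective _ (Hmap_chart_pt_bijective hf 0)).symm.trans
    (Hr_compl_singleton_two R 0).some⟩

/-- A locally consistent family of local classes comes from classes relative to complements of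
compact sets. -/
theorem exists_class_of_consistent (hM : HasPlaneCharts M) (μ : ∀ x : M, Hr R 2 ({x}ᶜ : Set M))
    (hμ : ∀ x : M, ∃ U ∈ 𝓝 x, ∃ c : Hr R 2 (Uᶜ), ∀ y (hy : y ∈ U), resPt (Set.notMem_compl_iff.2 hy) c = μ y)
    {K : Set M} (hK : IsCompact K) :
    ∃ γ : Hr R 2 (Kᶜ), ∀ y (hy : y ∈ K), resPt (Set.notMem_compl_iff.2 hy) γ = μ y := by
  classical
  choose U hU c hc using hμ
  have hsmall : ∀ L : Set M, (∃ x, L ⊆ U x) →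
      ∃ γ : Hr R 2 (Lᶜ), ∀ y (hy : y ∈ L), resPt (Set.notMem_compl_iff.2 hy) γ = μ y := by
    rintro L ⟨x, hL⟩
    refine ⟨Hres (Set.compl_subset_compl.2 hL) (c x), fun y hy => ?_⟩
    rw [resPt_Hres]
    exact hc x y (hL hy)
  have key : ∀ (t : Finset M) (L : M → Set M), (∀ i, IsCompact (L i)) → (∀ i, L i ⊆ U i) →
      ∃ γ : Hr R 2 ((⋃ i ∈ t, L i)ᶜ), ∀ y (hy : y ∈ ⋃ i ∈ t, L i),
        resPt (Set.notMem_compl_iff.2 hy) γ = μ y := by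
    intro t L hL hLU
    induction t using Finset.induction_on with
    | empty => exact ⟨0, fun y hy => by simp at hy⟩
    | insert a t _ ih =>
      obtain ⟨γ, hγ⟩ := ih
      obtain ⟨γ', hγ'⟩ := hsmall (L a) ⟨a, hLU a⟩
      have hcp : IsCompact (⋃ i ∈ t, L i) := t.isCompact_biUnion fun i _ => hL i
      have hd : IsDetected R ((L a)ᶜ ∪ (⋃ i ∈ t, L i)ᶜ) := by
        rw [← Set.compl_inter]
        exact isDetected_of_isCompact hM ((hL a).inter hcp)
      -- The two classes have the same restriction at each point of the overlap, so detection makes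
      -- them equal there and they glue.
      obtain ⟨η, h1, h2⟩ := exists_glue (hL a).isClosed.isOpen_compl hcp.isClosed.isOpen_compl γ' γ
        (sub_eq_zero.1 (hd.2 _ fun y hy => by
          simp only [Set.mem_union, not_or, Set.notMem_compl_iff] at hy
          rw [map_sub, resPt_Hres, resPt_Hres]
          exact sub_eq_zero.2 ((hγ' y hy.1).trans (hγ y hy.2).symm)))
      rw [Finset.set_biUnion_insert]
      have e : (L a ∪ ⋃ i ∈ t, L i)ᶜ = (L a)ᶜ ∩ (⋃ i ∈ t, L i)ᶜ := Set.compl_union _ _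
      refine ⟨Hres e.ge η, fun y hy => ?_⟩
      rw [resPt_Hres]
      rcases hy with hy | hy
      · rw [← hγ' y hy, ← h1, resPt_Hres]
      · rw [← hγ y hy, ← h2, resPt_Hres]
  obtain ⟨t, ht⟩ := hK.elim_finite_subcover (fun i => interior (U i))
    (fun i => isOpen_interior) fun x _ => Set.mem_iUnion.2 ⟨x, mem_interior_iff_mem_nhds.2 (hU x)⟩
  obtain ⟨L, hL, hLf, rfl⟩ := hK.finite_compact_cover t (fun i => interior (U i))
    (fun i _ => isOpen_interior) ht
  exact key t L hL fun i => (hLf i).trans interior_subset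

end Surface

/-! ### Closed surfaces and nonseparating curves -/

/-- The coefficients `ℤ`. -/
abbrev Zc : ModuleCat.{0} ℤ := ModuleCat.of ℤ ℤ

/-! ### Quotients of free abelian groups by indivisible elements -/

section Algebra

/-- Induction on the prime factorisation of n. For a prime p with p c = k v and p ∤ k, a Bézout
relation would exhibit v as a multiple of p; so p divides k and can be cancelled. -/
lemma mem_zmultiples_of_zsmul_mem {G : Type} [AddCommGroup G] [IsAddTorsionFree G] {v : G}
    (hv : ∀ p : ℕ, p.Prime → ∀ c : G, v ≠ (p : ℤ) • c) (n : ℕ) (hn : n ≠ 0) :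
    ∀ (c : G) (k : ℤ), (n : ℤ) • c = k • v → ∃ j : ℤ, c = j • v := by
  induction n using Nat.recOnMul with
  | zero => exact absurd rfl hn
  | one => exact fun c k h => ⟨k, by simpa using h⟩
  | prime p hp =>
    intro c k h
    by_cases hk : (p : ℤ) ∣ k
    · obtain ⟨k, rfl⟩ := hk
      refine ⟨k, ?_⟩
      rw [mul_smul] at h
      exact zsmul_right_injective (Int.natCast_ne_zero.2 hp.ne_zero) h
    · obtain ⟨a, b, hab⟩ : IsCoprime (p : ℤ) k :=
        (Nat.prime_iff_prime_int.1 hp).coprime_iff_not_dvd.2 hk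
      refine absurd ?_ (hv p hp (a • v + b • c))
      calc v = (a * p + b * k) • v := by rw [hab, one_smul]
        _ = _ := by
          rw [add_smul, mul_smul b, ← h, smul_add, smul_smul, smul_smul, smul_smul, mul_comm,
            mul_comm b]
  | mul a b ha hb =>
    intro c k h
    have ha0 : a ≠ 0 := fun h => hn (by simp [h])
    have hb0 : b ≠ 0 := fun h => hn (by simp [h])
    rw [Nat.cast_mul, mul_smul] at h
    obtain ⟨j, hj⟩ := ha ha0 _ _ h
    exact hb hb0 _ _ hj

/-- The quotient of a free abelian group by an indivisible element. -/
lemma equiv_of_indivisible {G Q : Type} [AddCommGroup G] [AddCommGroup Q] {m : ℕ}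
    (e : G ≃+ (Fin m → ℤ)) (f : G →+ Q) (hf : Function.Surjective f) {v : G}
    (hker : ∀ x, f x = 0 ↔ ∃ k : ℤ, x = k • v)
    (hv : ∀ p : ℕ, p.Prime → ∀ c : G, v ≠ (p : ℤ) • c) :
    Nonempty (Q ≃+ (Fin (m - 1) → ℤ)) := by
  have htf : IsAddTorsionFree G := e.injective.isAddTorsionFree e.toAddMonoidHom
  let F : G →ₗ[ℤ] Q := f.toIntLinearMap
  have hfree : Module.Free ℤ G := Module.Free.of_equiv e.symm.toIntLinearEquiv
  have hfin : Module.Finite ℤ G := Module.Finite.equiv e.symm.toIntLinearEquiv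
  have hfinQ : Module.Finite ℤ Q := Module.Finite.of_surjective F hf
  have htfQ : Module.IsTorsionFree ℤ Q := by
    rw [Module.isTorsionFree_int_iff_isAddTorsionFree]
    refine ⟨fun n hn => ?_⟩
    have : ∀ q : Q, n • q = 0 → q = 0 := fun q hq => by
      obtain ⟨c, rfl⟩ := hf q
      rw [← map_nsmul, hker] at hq
      obtain ⟨k, hk⟩ := hq
      rw [← natCast_zsmul] at hk
      exact (hker c).2 (mem_zmultiples_of_zsmul_mem hv n hn c k hk)
    intro a b hab
    exact sub_eq_zero.1 (this _ (by rw [nsmul_sub]; exact sub_eq_zero.2 hab))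
  -- A finitely generated torsion-free ℤ-module is free, so only the rank remains to be computed.
  have hfreeQ : Module.Free ℤ Q := inferInstance
  have hkerF : LinearMap.ker F = Submodule.span ℤ {v} := by
    ext x
    rw [LinearMap.mem_ker, Submodule.mem_span_singleton]
    exact (hker x).trans ⟨fun ⟨k, hk⟩ => ⟨k, hk.symm⟩, fun ⟨k, hk⟩ => ⟨k, hk.symm⟩⟩
  have hv0 : v ≠ 0 := fun h => hv 2 Nat.prime_two 0 (by simpa using h)
  have h1 : Module.finrank ℤ (LinearMap.ker F) = 1 := by
    rw [hkerF]
    exact (LinearEquiv.toSpanNonzeroSingleton ℤ G v hv0).symm.finrank_eq.trans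
      (Module.finrank_self ℤ)
  let E : G ≃ₗ[ℤ] (Fin m → ℤ) := e.toIntLinearEquiv
  have hG : Module.finrank ℤ G = m := E.finrank_eq.trans (Module.finrank_fin_fun ℤ)
  have h2 := (LinearMap.ker F).finrank_quotient_add_finrank
  rw [h1, (F.quotKerEquivOfSurjective hf).finrank_eq, hG] at h2
  have h3 : Module.finrank ℤ Q = m - 1 := by omega
  exact ⟨((Module.finBasisOfFinrankEq ℤ Q h3).equivFun).toAddEquiv⟩

end Algebra


/-! ### Fundamental classes of closed surfaces -/

section ClosedSurface

/-- The two constructions of relative homology use the same cokernel, so the orientation of the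
surface transfers to `Hr Zc`. -/
lemma relHMap_apply (n : ℕ) {X : Type} [TopologicalSpace X] {A B : Set X} (h : A ⊆ B)
    (c : relH n A) : relHMap n h c = Hres (R := Zc) (n := n) h c := by
  have e : relChainsMap h = relC.map Zc (ContinuousMap.id X) (id_mapsTo h) := by
    refine (cancel_epi (relC.π Zc A)).1 ?_
    refine (cokernel.π_desc _ _ _).trans (Eq.trans ?_ (relC.π_map Zc _ (id_mapsTo h)).symm)
    rw [Chains.map_id]
    rfl
  exact congr($(congrArg (fun g => HomologicalComplex.homologyMap g n) e) c)

/-- A small ball around the image of x in a chart is homeomorphic to the whole plane. -/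
lemma hasPlaneCharts_of_chartedSpace (F : Type) [TopologicalSpace F]
    [ChartedSpace (EuclideanSpace ℝ (Fin 2)) F] : HasPlaneCharts F := by
  intro x
  let c := chartAt (EuclideanSpace ℝ (Fin 2)) x
  obtain ⟨r, hr0, hr⟩ := Metric.isOpen_iff.1 c.open_target (c x) (mem_chart_target _ x)
  let g := (OpenPartialHomeomorph.univBall (c x) r).trans c.symm
  have hg : g.source = Set.univ := by
    rw [OpenPartialHomeomorph.trans_source, OpenPartialHomeomorph.univBall_source, Set.univ_inter,
      Set.eq_univ_iff_forall]
    intro y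
    refine hr ?_
    rw [← OpenPartialHomeomorph.univBall_target (c x) hr0]
    exact OpenPartialHomeomorph.map_source _ (by simp)
  let L : ℂ ≃ₜ EuclideanSpace ℝ (Fin 2) :=
    Complex.orthonormalBasisOneI.repr.toHomeomorph
  have hge := (g.isOpenEmbedding hg).comp L.isOpenEmbedding
  refine ⟨⟨g ∘ L, hge.continuous⟩, hge, ?_⟩
  have h0 : L 0 = 0 := map_zero Complex.orthonormalBasisOneI.repr
  change c.symm (OpenPartialHomeomorph.univBall (c x) r (L 0)) = x
  rw [h0, OpenPartialHomeomorph.univBall_apply_zero]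
  exact c.left_inv (mem_chart_source _ x)

variable {R : ModuleCat.{0} ℤ} {F : Type} [TopologicalSpace F] [T2Space F] [CompactSpace F]
  [ConnectedSpace F]

omit [ConnectedSpace F] in
lemma isDetected_empty (hM : HasPlaneCharts F) : IsDetected R (∅ : Set F) := by
  have := isDetected_of_isCompact (R := R) hM isCompact_univ
  rwa [Set.compl_univ] at this

/-- By connectedness, vanishing at x spreads to all points, and the closed surface is compact, so
its degree-two classes are detected at points. -/
lemma resPt_injective_of_closed (hM : HasPlaneCharts F) (x : F) :
    Function.Injective (resPt (R := R) (n := 2) (Set.notMem_empty x)) := by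
  rw [injective_iff_map_eq_zero]
  intro α hα
  refine (isDetected_empty hM).2 α fun y hy => ?_
  refine resPt_eq_zero_of_isPreconnected hM isClosed_empty ?_ α _ hα hy
  rw [Set.compl_empty]
  exact isPreconnected_univ

omit [ConnectedSpace F] in
/-- The fundamental class. -/
theorem resPt_surjective_of_orientable (hM : HasPlaneCharts F) (ho : IsOrientable 2 F) (x : F) :
    Function.Surjective (resPt (R := Zc) (n := 2) (Set.notMem_empty x)) := by
  obtain ⟨μ, hgen, hμ⟩ := ho
  obtain ⟨γ, hγ⟩ := exists_class_of_consistent (R := Zc) hM μ (fun x => by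
    obtain ⟨U, hU, c, hc⟩ := hμ x
    exact ⟨U, hU, c, fun y hy => (relHMap_apply 2 _ c).symm.trans (hc y hy)⟩) isCompact_univ
  intro β
  have hβ : β ∈ AddSubgroup.zmultiples (μ x) := by
    rw [hgen x]; exact AddSubgroup.mem_top _
  obtain ⟨k, rfl⟩ := AddSubgroup.mem_zmultiples_iff.1 hβ
  refine ⟨k • Hres Set.compl_univ.le γ, ?_⟩
  rw [map_zsmul, resPt_Hres]
  exact congrArg (k • ·) (hγ x (Set.mem_univ x))

theorem Hr_two_equiv (hM : HasPlaneCharts F) (ho : IsOrientable 2 F) :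
    Nonempty (Hr Zc 2 (∅ : Set F) ≃ₗ[ℤ] Zc) := by
  obtain ⟨x⟩ : Nonempty F := inferInstance
  exact ⟨(LinearEquiv.ofBijective _ ⟨resPt_injective_of_closed hM x,
    resPt_surjective_of_orientable hM ho x⟩).trans (Hr_compl_point_two Zc hM x).some⟩

/-- The fundamental class modulo a prime. -/
theorem resPt_surjective_mod (hM : HasPlaneCharts F) (ho : IsOrientable 2 F) (p : ℕ)
    (hp : p.Prime) (x : F) :
    Function.Surjective (resPt (R := ModuleCat.of ℤ (ZMod p)) (n := 2) (Set.notMem_empty x)) := by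
  have := Fact.mk hp
  obtain ⟨e⟩ := Hr_two_equiv hM ho
  let e' : Ha Zc 2 F ≃ₗ[ℤ] Zc := (LinearEquiv.ofBijective _ (toRel_empty_bijective Zc 2)).trans e
  let γ : Ha Zc 2 F := e'.symm (1 : ℤ)
  -- γ generates H_2(F; ℤ), so it is not divisible by p and survives reduction. Its restriction at x
  -- is then a nonzero element of the field ℤ/p, hence a generator.
  have h1 : Ha.red p 2 F γ ≠ 0 := by
    intro h
    obtain ⟨y, hy⟩ := exists_smul_of_red_eq_zero p hp.ne_zero γ h
    have h2 : (1 : ℤ) = (p : ℤ) * (e' y : ℤ) :=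
      (e'.apply_symm_apply (1 : ℤ)).symm.trans ((congrArg e' hy).trans (map_zsmul e' _ _))
    exact hp.one_lt.ne' (by exact_mod_cast Int.eq_one_of_mul_eq_one_right (by positivity) h2.symm)
  let η : Hr (ModuleCat.of ℤ (ZMod p)) 2 (∅ : Set F) := toRel _ 2 ∅ (Ha.red p 2 F γ)
  obtain ⟨e2⟩ := Hr_compl_point_two (ModuleCat.of ℤ (ZMod p)) hM x
  have h3 : (e2 (resPt (Set.notMem_empty x) η) : ZMod p) ≠ 0 := by
    intro h
    have h4 := (map_eq_zero_iff e2 e2.injective).1 h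
    have h5 := (map_eq_zero_iff _ (resPt_injective_of_closed hM x)).1 h4
    exact h1 ((map_eq_zero_iff _ (toRel_empty_bijective _ 2).1).1 h5)
  intro β
  obtain ⟨k, hk⟩ := ZMod.intCast_surjective
    ((e2 β : ZMod p) / (e2 (resPt (Set.notMem_empty x) η) : ZMod p))
  refine ⟨k • η, e2.injective ?_⟩
  rw [map_zsmul, map_zsmul]
  change k • (e2 (resPt (Set.notMem_empty x) η) : ZMod p) = (e2 β : ZMod p)
  rw [zsmul_eq_mul, hk, div_mul_cancel₀ _ h3]

/-! ### Homology relative to a nonseparating curve -/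

section Curve

variable {V U : Set F}

/-- The top homology of a closed surface injects in, and maps onto, the homology relative to a
closed set with connected complement. -/
theorem Hres_two_bijective (hM : HasPlaneCharts F)
    (hs : ∀ x : F, Function.Surjective (resPt (R := R) (n := 2) (Set.notMem_empty x)))
    (hV : IsClosed V) (hVc : IsConnected Vᶜ) (hU : IsOpen U) (hVU : V ⊆ U)
    (hb : Function.Injective (Hres (R := R) (n := 2) hVU)) :
    Function.Bijective (Hres (R := R) (n := 2) (Set.empty_subset V)) := by
  obtain ⟨x, hx⟩ := hVc.nonempty
  constructor
  · rw [injective_iff_map_eq_zero]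
    intro α hα
    apply resPt_injective_of_closed hM x
    rw [map_zero, ← resPt_Hres (Set.empty_subset V) hx, hα, map_zero]
  · intro β
    obtain ⟨α, hα⟩ := hs x (resPt hx β)
    refine ⟨α, sub_eq_zero.1 ?_⟩
    have h0 : resPt hx (Hres (Set.empty_subset V) α - β) = 0 := by
      rw [map_sub, resPt_Hres, hα, sub_self]
    -- Detection is available relative to the open set U, whose complement is compact. The
    -- hypothesis `hb` brings the resulting equality back to the closed set V.
    apply hb
    rw [map_zero]
    have hd : IsDetected R U := by
      rw [← compl_compl U]
      exact isDetected_of_isCompact hM hU.isClosed_compl.isCompact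
    refine hd.2 _ fun y hy => ?_
    rw [resPt_Hres]
    exact resPt_eq_zero_of_isPreconnected hM hV hVc.isPreconnected _ hx h0 _

/-- As H_2(F) → H_2(F, V) is onto, the connecting map H_2(F, V) → H_1(V) is zero. -/
theorem Hsub_one_injective (hM : HasPlaneCharts F)
    (hs : ∀ x : F, Function.Surjective (resPt (R := R) (n := 2) (Set.notMem_empty x)))
    (hV : IsClosed V) (hVc : IsConnected Vᶜ) (hU : IsOpen U) (hVU : V ⊆ U)
    (hb : Function.Injective (Hres (R := R) (n := 2) hVU)) :
    Function.Injective (Hsub (R := R) (n := 1) V ∅) := by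
  rw [injective_iff_map_eq_zero]
  intro α hα
  obtain ⟨β, rfl⟩ := (exact_δ_sub (Set.empty_subset V) α).1 hα
  exact (exact_res_δ (Set.empty_subset V) β).2
    ((Hres_two_bijective hM hs hV hVc hU hVU hb).2 β)

omit [T2Space F] [CompactSpace F] [ConnectedSpace F] in
lemma Ha_map_one_injective
    (hb : Function.Injective (Hsub (R := R) (n := 1) V ∅)) :
    Function.Injective (Ha.map R 1 (subIncl V)) := by
  have h1 := toRel_empty_bijective R 1 (X := V)
  have h3 : Hsub V ∅ ∘ toRel R 1 (∅ : Set V) = toRel R 1 ∅ ∘ Ha.map R 1 (subIncl V) :=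
    funext fun x => (toRel_map (subIncl V) (subIncl_mapsTo V ∅) x).symm
  have h4 := hb.comp h1.1
  exact Function.Injective.of_comp (h3 ▸ h4)

/-- The first homology relative to a nonseparating curve. -/
theorem Hr_one_curve_equiv (hM : HasPlaneCharts F) (ho : IsOrientable 2 F)
    (hV : IsClosed V) (hVc : IsConnected Vᶜ) (hU : IsOpen U) (hVU : V ⊆ U)
    (hb : ∀ R : ModuleCat.{0} ℤ, Function.Injective (Hres (R := R) (n := 2) hVU))
    [PathConnectedSpace V] [PathConnectedSpace F]
    (eV : Ha Zc 1 V ≃ₗ[ℤ] Zc) {m : ℕ} (eF : Ha Zc 1 F ≃+ (Fin m → ℤ)) :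
    Nonempty (Hr Zc 1 V ≃+ (Fin (m - 1) → ℤ)) := by
  let f : Ha Zc 1 F →+ Hr Zc 1 V :=
    ((Hres (Set.empty_subset V)).comp (toRel Zc 1 ∅)).toAddMonoidHom
  have hbF := toRel_empty_bijective Zc 1 (X := F)
  have hbV := toRel_empty_bijective Zc 1 (X := V)
  let v : Ha Zc 1 V := eV.symm (1 : ℤ)
  have hv : ∀ y, ∃ k : ℤ, y = k • v := fun y => ⟨(eV y : ℤ), by
    apply eV.injective
    rw [map_zsmul]
    exact ((congrArg ((eV y : ℤ) • ·) (eV.apply_symm_apply (1 : ℤ))).trans (mul_one (eV y : ℤ))).symm⟩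
  have hfsurj : Function.Surjective f := by
    intro x
    -- H_0(V) → H_0(F) is injective, both spaces being path connected, so H_1(F) maps onto H_1(F,
    -- V).
    have hx : Hδ Zc 0 (Set.empty_subset V) x = 0 := by
      refine (Hr_zero_map_bijective (R := Zc) (subIncl V) (A := inSub V ∅) (B := ∅) rfl rfl
        (subIncl_mapsTo V ∅)).1 ?_
      rw [map_zero]
      exact (exact_δ_sub (Set.empty_subset V) _).2 ⟨x, rfl⟩
    obtain ⟨y, rfl⟩ := (exact_res_δ (Set.empty_subset V) x).1 hx
    obtain ⟨z, rfl⟩ := hbF.2 y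
    exact ⟨z, rfl⟩
  have hsub : ∀ y, Hsub V ∅ (toRel Zc 1 (∅ : Set V) y) = toRel Zc 1 ∅ (Ha.map Zc 1 (subIncl V) y) :=
    fun y => (toRel_map (subIncl V) (subIncl_mapsTo V ∅) y).symm
  refine equiv_of_indivisible eF f hfsurj (v := Ha.map Zc 1 (subIncl V) v) (fun x => ?_) ?_
  · constructor
    · intro hx
      obtain ⟨y, hy⟩ := (exact_sub_res (Set.empty_subset V) (toRel Zc 1 ∅ x)).1 hx
      obtain ⟨y, rfl⟩ := hbV.2 y
      obtain ⟨k, rfl⟩ := hv y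
      refine ⟨k, hbF.1 ?_⟩
      rw [← hy]
      refine (hsub _).trans ?_
      rw [map_zsmul]
    · rintro ⟨k, rfl⟩
      rw [map_zsmul]
      have : f (Ha.map Zc 1 (subIncl V) v) = 0 :=
        (exact_sub_res (Set.empty_subset V) (toRel Zc 1 ∅ (Ha.map Zc 1 (subIncl V) v))).2
          ⟨_, hsub v⟩
      rw [this]
      exact zsmul_zero k
  -- If the class of V were p c, its reduction would vanish in H_1(F; ℤ/p). As H_1(V; ℤ/p) injects
  -- there, the generator of H_1(V; ℤ) would be divisible by p.
  · intro p hp c hc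
    have h1 : Ha.red p 1 F (Ha.map Zc 1 (subIncl V) v) = 0 := by
      rw [hc, map_zsmul]
      exact zmod_smul_eq_zero p _
    rw [Ha.red_map] at h1
    have h2 := (map_eq_zero_iff _ (Ha_map_one_injective (Hsub_one_injective hM
      (resPt_surjective_mod hM ho p hp) hV hVc hU hVU (hb _)))).1 h1
    obtain ⟨y, hy⟩ := exists_smul_of_red_eq_zero p hp.ne_zero v h2
    have h3 : (1 : ℤ) = (p : ℤ) * (eV y : ℤ) :=
      (eV.apply_symm_apply (1 : ℤ)).symm.trans ((congrArg eV hy).trans (map_zsmul eV _ _))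
    exact hp.one_lt.ne' (by exact_mod_cast Int.eq_one_of_mul_eq_one_right (by positivity) h3.symm)

end Curve

end ClosedSurface

/-! ### The local model in the coordinates `w₊`, `w₋` -/

section LocalModel

/-- The coordinate `x` of the local model. -/
def cw (w : ℂ × ℂ) : ℝ := (‖w.1‖ ^ 2 - ‖w.2‖ ^ 2) / 4

lemma continuous_cw : Continuous cw := by unfold cw; fun_prop

/-- The local model. -/
def Wm (lam δ : ℝ) : Set (ℂ × ℂ) := {w | |cw w| ≤ lam ∧ ‖w.1 * w.2‖ ≤ δ}

/-- The point with given coordinates `w₊`, `w₋`. -/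
def ofW (w : ℂ × ℂ) : ℂ × ℂ := ((w.1 + w.2) / 2, (w.1 - w.2) / (2 * Complex.I))

lemma continuous_ofW : Continuous ofW := by unfold ofW; fun_prop

@[simp] lemma wPlus_ofW (w : ℂ × ℂ) : wPlus (ofW w) = w.1 := by
  simp only [wPlus, ofW]; field_simp; ring

@[simp] lemma wMinus_ofW (w : ℂ × ℂ) : wMinus (ofW w) = w.2 := by
  simp only [wMinus, ofW]; field_simp; ring

lemma ofW_wPlus_wMinus (p : ℂ × ℂ) : ofW (wPlus p, wMinus p) = p := by
  ext1
  · simp only [wPlus, wMinus, ofW]; ring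
  · simp only [wPlus, wMinus, ofW]; field_simp; ring

lemma localPi_eq (p : ℂ × ℂ) : localPi p = wPlus p * wMinus p := by
  simp only [localPi, wPlus, wMinus]
  linear_combination p.2 ^ 2 * Complex.I_sq

lemma cylX_eq (p : ℂ × ℂ) : cylX p = cw (wPlus p, wMinus p) := rfl

lemma norm_sq_sum (p : ℂ × ℂ) :
    ‖p.1‖ ^ 2 + ‖p.2‖ ^ 2 = (‖wPlus p‖ ^ 2 + ‖wMinus p‖ ^ 2) / 2 := by
  have := parallelogram_law_with_norm ℝ p.1 (Complex.I * p.2)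
  simp only [norm_mul, Complex.norm_I, one_mul] at this
  simp only [wPlus, wMinus]
  linarith

/-- Since |p|² = (|w₊|² + |w₋|²)/2 and π = w₊w₋, the difference |p|⁴ - |π|² equals 4x². -/
lemma mem_E_iff {lam δ : ℝ} (hlam : 0 ≤ lam) (p : ℂ × ℂ) :
    p ∈ E lam δ ↔ (wPlus p, wMinus p) ∈ Wm lam δ := by
  have h : (‖p.1‖ ^ 2 + ‖p.2‖ ^ 2) ^ 2 - ‖localPi p‖ ^ 2 =
      4 * (cw (wPlus p, wMinus p)) ^ 2 := by
    rw [norm_sq_sum, localPi_eq, norm_mul, cw]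
    ring
  refine and_congr (Iff.trans (by rw [h]) (Iff.trans (b := cw (wPlus p, wMinus p) ^ 2 ≤ lam ^ 2)
    ?_ ?_)) (by rw [localPi_eq])
  · constructor <;> intro h <;> linarith
  · rw [← sq_le_sq₀ (abs_nonneg _) hlam, sq_abs]

/-- The circle coordinate of the local model. -/
def dirC (w : ℂ × ℂ) : Circle :=
  if 0 < cw w then Circle.exp (Complex.arg w.1) else Circle.exp (-Complex.arg w.2)

lemma cyl_eq (p : ℂ × ℂ) :
    cyl p = (cw (wPlus p, wMinus p), dirC (wPlus p, wMinus p)) := by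
  unfold cyl dirC
  simp only [cylX_eq]
  congr

lemma coe_exp_arg {z : ℂ} (hz : z ≠ 0) : (Circle.exp (Complex.arg z) : ℂ) = z / ‖z‖ := by
  rw [Circle.coe_exp, eq_div_iff (by simpa using hz), mul_comm]
  exact Complex.norm_mul_exp_arg_mul_I z

lemma coe_exp_neg_arg {z : ℂ} (hz : z ≠ 0) :
    (Circle.exp (-Complex.arg z) : ℂ) = (starRingEnd ℂ) z / ‖z‖ := by
  rw [Circle.exp_neg, Circle.coe_inv_eq_conj, coe_exp_arg hz, map_div₀, Complex.conj_ofReal]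

lemma fst_ne_zero_of_cw_pos {w : ℂ × ℂ} (h : 0 < cw w) : w.1 ≠ 0 := by
  rintro h0
  simp only [cw, h0, norm_zero] at h
  nlinarith [sq_nonneg ‖w.2‖]

lemma snd_ne_zero_of_cw_neg {w : ℂ × ℂ} (h : cw w < 0) : w.2 ≠ 0 := by
  rintro h0
  simp only [cw, h0, norm_zero] at h
  nlinarith [sq_nonneg ‖w.1‖]

lemma dirC_of_pos {w : ℂ × ℂ} (h : 0 < cw w) : (dirC w : ℂ) = w.1 / ‖w.1‖ := by
  rw [dirC, if_pos h, coe_exp_arg (fst_ne_zero_of_cw_pos h)]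

lemma dirC_of_neg {w : ℂ × ℂ} (h : cw w < 0) : (dirC w : ℂ) = (starRingEnd ℂ) w.2 / ‖w.2‖ := by
  rw [dirC, if_neg (not_lt.2 h.le), coe_exp_neg_arg (snd_ne_zero_of_cw_neg h)]

/-- The branch cut of the argument is harmless: locally the value is w₊/|w₊| or the conjugate of
w₋/|w₋|. -/
lemma continuousOn_dirC : ContinuousOn dirC {w | cw w ≠ 0} := by
  intro w hw
  refine ContinuousAt.continuousWithinAt ?_
  refine (IsInducing.subtypeVal : IsInducing (fun c : Circle => (c : ℂ))).continuousAt_iff.2 ?_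
  rcases lt_or_gt_of_ne hw with h | h
  · have h1 : ∀ᶠ w' in 𝓝 w, cw w' < 0 := (continuous_cw.continuousAt).eventually_lt_const h
    have h2 : (fun w : ℂ × ℂ => (starRingEnd ℂ) w.2 / ‖w.2‖) =ᶠ[𝓝 w] (fun c : Circle => (c : ℂ)) ∘ dirC :=
      h1.mono fun w' hw' => (dirC_of_neg hw').symm
    refine ContinuousAt.congr ?_ h2
    refine ContinuousAt.div ?_ (by fun_prop) (by simpa using snd_ne_zero_of_cw_neg h)
    exact (Complex.continuous_conj.comp continuous_snd).continuousAt
  · have h1 : ∀ᶠ w' in 𝓝 w, 0 < cw w' := (continuous_cw.continuousAt).eventually_const_lt h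
    have h2 : (fun w : ℂ × ℂ => w.1 / ‖w.1‖) =ᶠ[𝓝 w] (fun c : Circle => (c : ℂ)) ∘ dirC :=
      h1.mono fun w' hw' => (dirC_of_pos hw').symm
    refine ContinuousAt.congr ?_ h2
    exact ContinuousAt.div (by fun_prop) (by fun_prop) (by simpa using fst_ne_zero_of_cw_pos h)

/-- The norm of `w₊` in terms of `|π|` and `x`. -/
def amp (r x : ℝ) : ℝ := √(2 * x + √(4 * x ^ 2 + r ^ 2))

lemma continuous_amp : Continuous fun p : ℝ × ℝ => amp p.1 p.2 := by unfold amp; fun_prop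

lemma amp_nonneg (r x : ℝ) : 0 ≤ amp r x := Real.sqrt_nonneg _

lemma amp_sq (r x : ℝ) : amp r x ^ 2 = 2 * x + √(4 * x ^ 2 + r ^ 2) := by
  refine Real.sq_sqrt ?_
  have : |2 * x| ≤ √(4 * x ^ 2 + r ^ 2) := Real.abs_le_sqrt (by nlinarith [sq_nonneg r])
  linarith [neg_abs_le (2 * x)]

/-- Together with `amp_mul` this says that s = amp r x and t = amp r (-x) solve s² - t² = 4x, st =
r, the equations for |w₊| and |w₋|. Conversely `amp_eq` recovers s from these data. -/
lemma amp_sq_sub (r x : ℝ) : amp r x ^ 2 - amp r (-x) ^ 2 = 4 * x := by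
  rw [amp_sq, amp_sq, neg_sq]; ring

lemma amp_mul (r x : ℝ) (hr : 0 ≤ r) : amp r x * amp r (-x) = r := by
  refine (sq_eq_sq₀ (mul_nonneg (amp_nonneg _ _) (amp_nonneg _ _)) hr).1 ?_
  rw [mul_pow, amp_sq, amp_sq, neg_sq]
  have := Real.sq_sqrt (show 0 ≤ 4 * x ^ 2 + r ^ 2 by positivity)
  linear_combination this

lemma amp_pos {r x : ℝ} (h : 0 < x ∨ 0 < r) : 0 < amp r x := by
  rcases h with h | h
  · exact Real.sqrt_pos.2 (by positivity)
  · refine Real.sqrt_pos.2 ?_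
    have : |2 * x| < √(4 * x ^ 2 + r ^ 2) := Real.lt_sqrt (abs_nonneg _) |>.2 (by
      rw [sq_abs]; nlinarith [pow_pos h 2])
    linarith [neg_abs_le (2 * x)]

lemma amp_eq {s t : ℝ} (hs : 0 ≤ s) : amp (s * t) ((s ^ 2 - t ^ 2) / 4) = s := by
  have h : √(4 * ((s ^ 2 - t ^ 2) / 4) ^ 2 + (s * t) ^ 2) = (s ^ 2 + t ^ 2) / 2 := by
    rw [show 4 * ((s ^ 2 - t ^ 2) / 4) ^ 2 + (s * t) ^ 2 = ((s ^ 2 + t ^ 2) / 2) ^ 2 by ring]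
    exact Real.sqrt_sq (by positivity)
  rw [amp, h, show 2 * ((s ^ 2 - t ^ 2) / 4) + (s ^ 2 + t ^ 2) / 2 = s ^ 2 by ring]
  exact Real.sqrt_sq hs

lemma amp_cw (w : ℂ × ℂ) : amp ‖w.1 * w.2‖ (cw w) = ‖w.1‖ := by
  rw [norm_mul]
  exact amp_eq (norm_nonneg _)

lemma amp_neg_cw (w : ℂ × ℂ) : amp ‖w.1 * w.2‖ (-cw w) = ‖w.2‖ := by
  rw [norm_mul, mul_comm, cw, ← neg_div, neg_sub]
  exact amp_eq (norm_nonneg _)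

/-- The point over `z` with `w₊` in the direction `u` and given `x`. -/
def upt (z : ℂ) (x : ℝ) (u : Circle) : ℂ × ℂ :=
  (amp ‖z‖ x * u, z / amp ‖z‖ x * (starRingEnd ℂ) (u : ℂ))

/-- The point over `z` with `w₋` in the direction conjugate to `u` and given `x`. -/
def dpt (z : ℂ) (x : ℝ) (u : Circle) : ℂ × ℂ :=
  (z / amp ‖z‖ (-x) * u, amp ‖z‖ (-x) * (starRingEnd ℂ) (u : ℂ))

/-- The inverse of the trivialisation of the local model. -/
def lft (z : ℂ) (x : ℝ) (v : Circle) : ℂ × ℂ := if 0 < x then upt z x v else dpt z x v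

lemma circle_mul_conj (u : Circle) : (u : ℂ) * (starRingEnd ℂ) (u : ℂ) = 1 := by
  rw [Complex.mul_conj, Complex.normSq_eq_norm_sq, Circle.norm_coe]; simp

section pt

variable {z : ℂ} {x : ℝ} (u : Circle)

lemma upt_mul (h : 0 < amp ‖z‖ x) : (upt z x u).1 * (upt z x u).2 = z := by
  have h' : (amp ‖z‖ x : ℂ) ≠ 0 := by exact_mod_cast h.ne'
  simp only [upt]
  field_simp
  linear_combination z * circle_mul_conj u

lemma dpt_mul (h : 0 < amp ‖z‖ (-x)) : (dpt z x u).1 * (dpt z x u).2 = z := by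
  have h' : (amp ‖z‖ (-x) : ℂ) ≠ 0 := by exact_mod_cast h.ne'
  simp only [dpt]
  field_simp
  linear_combination z * circle_mul_conj u

lemma norm_upt_fst : ‖(upt z x u).1‖ = amp ‖z‖ x := by
  simp [upt, abs_of_nonneg (amp_nonneg _ _), Circle.norm_coe]

lemma norm_dpt_snd : ‖(dpt z x u).2‖ = amp ‖z‖ (-x) := by
  simp [dpt, abs_of_nonneg (amp_nonneg _ _), Circle.norm_coe]

lemma norm_upt_snd (h : 0 < amp ‖z‖ x) : ‖(upt z x u).2‖ = amp ‖z‖ (-x) := by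
  simp only [upt, norm_mul, norm_div, Complex.norm_real, RCLike.norm_conj, Circle.norm_coe,
    mul_one, Real.norm_of_nonneg (amp_nonneg _ _)]
  rw [div_eq_iff h.ne', mul_comm, amp_mul _ _ (norm_nonneg z)]

lemma norm_dpt_fst (h : 0 < amp ‖z‖ (-x)) : ‖(dpt z x u).1‖ = amp ‖z‖ x := by
  simp only [dpt, norm_mul, norm_div, Complex.norm_real, Circle.norm_coe,
    mul_one, Real.norm_of_nonneg (amp_nonneg _ _)]
  rw [div_eq_iff h.ne', amp_mul _ _ (norm_nonneg z)]

lemma cw_upt (h : 0 < amp ‖z‖ x) : cw (upt z x u) = x := by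
  rw [cw, norm_upt_fst, norm_upt_snd u h, amp_sq_sub]; ring

lemma cw_dpt (h : 0 < amp ‖z‖ (-x)) : cw (dpt z x u) = x := by
  rw [cw, norm_dpt_fst u h, norm_dpt_snd, amp_sq_sub]; ring

lemma dirC_upt (h : 0 < x) : dirC (upt z x u) = u := by
  have ha : 0 < amp ‖z‖ x := amp_pos (Or.inl h)
  have h' : (amp ‖z‖ x : ℂ) ≠ 0 := by exact_mod_cast ha.ne'
  ext
  rw [dirC_of_pos (by rwa [cw_upt u ha]), norm_upt_fst]
  simp only [upt]
  field_simp

lemma dirC_dpt (h : x < 0) : dirC (dpt z x u) = u := by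
  have ha : 0 < amp ‖z‖ (-x) := amp_pos (Or.inl (by linarith))
  have h' : (amp ‖z‖ (-x) : ℂ) ≠ 0 := by exact_mod_cast ha.ne'
  ext
  rw [dirC_of_neg (by rwa [cw_dpt u ha]), norm_dpt_snd]
  simp only [dpt, map_mul, Complex.conj_ofReal, Complex.conj_conj]
  field_simp

lemma upt_eq_self {w : ℂ × ℂ} (h : w.1 ≠ 0) (hu : (u : ℂ) = w.1 / ‖w.1‖) :
    upt (w.1 * w.2) (cw w) u = w := by
  have h' : (‖w.1‖ : ℂ) ≠ 0 := by simpa using h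
  have hn : w.1 * (starRingEnd ℂ) w.1 = ‖w.1‖ ^ 2 := by
    rw [Complex.mul_conj, Complex.normSq_eq_norm_sq]; push_cast; rfl
  ext1
  · simp only [upt, amp_cw, hu]
    field_simp
  · simp only [upt, amp_cw, hu, map_div₀, Complex.conj_ofReal]
    field_simp
    linear_combination w.2 * hn

lemma dpt_eq_self {w : ℂ × ℂ} (h : w.2 ≠ 0) (hu : (u : ℂ) = (starRingEnd ℂ) w.2 / ‖w.2‖) :
    dpt (w.1 * w.2) (cw w) u = w := by
  have h' : (‖w.2‖ : ℂ) ≠ 0 := by simpa using h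
  have hn : w.2 * (starRingEnd ℂ) w.2 = ‖w.2‖ ^ 2 := by
    rw [Complex.mul_conj, Complex.normSq_eq_norm_sq]; push_cast; rfl
  ext1
  · simp only [dpt, amp_neg_cw, hu]
    field_simp
    linear_combination w.1 * hn
  · simp only [dpt, amp_neg_cw, hu, map_div₀, Complex.conj_ofReal, Complex.conj_conj]
    field_simp

lemma lft_mul (v : Circle) (hx : x ≠ 0) : (lft z x v).1 * (lft z x v).2 = z := by
  unfold lft
  split_ifs with h
  · exact upt_mul v (amp_pos (Or.inl h))
  · exact dpt_mul v (amp_pos (Or.inl (by linarith [lt_of_le_of_ne (not_lt.1 h) hx])))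

lemma cw_lft (v : Circle) (hx : x ≠ 0) : cw (lft z x v) = x := by
  unfold lft
  split_ifs with h
  · exact cw_upt v (amp_pos (Or.inl h))
  · exact cw_dpt v (amp_pos (Or.inl (by linarith [lt_of_le_of_ne (not_lt.1 h) hx])))

lemma dirC_lft (v : Circle) (hx : x ≠ 0) : dirC (lft z x v) = v := by
  unfold lft
  split_ifs with h
  · exact dirC_upt v h
  · exact dirC_dpt v (lt_of_le_of_ne (not_lt.1 h) hx)

lemma lft_eq_self {w : ℂ × ℂ} (h : cw w ≠ 0) : lft (w.1 * w.2) (cw w) (dirC w) = w := by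
  unfold lft
  split_ifs with hp
  · exact upt_eq_self _ (fst_ne_zero_of_cw_pos hp) (dirC_of_pos hp)
  · have hn := lt_of_le_of_ne (not_lt.1 hp) h
    exact dpt_eq_self _ (snd_ne_zero_of_cw_neg hn) (dirC_of_neg hn)

end pt

lemma continuousOn_upt : ContinuousOn (fun p : ℂ × ℝ × Circle => upt p.1 p.2.1 p.2.2)
    {p | 0 < amp ‖p.1‖ p.2.1} := by
  have ha : Continuous fun p : ℂ × ℝ × Circle => ((amp ‖p.1‖ p.2.1 : ℝ) : ℂ) :=
    Complex.continuous_ofReal.comp (continuous_amp.comp (f := fun p : ℂ × ℝ × Circle => (‖p.1‖, p.2.1)) (by fun_prop))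
  have hu : Continuous fun p : ℂ × ℝ × Circle => (p.2.2 : ℂ) :=
    (continuous_subtype_val : Continuous fun c : Circle => (c : ℂ)).comp
      (continuous_snd.comp continuous_snd)
  refine ContinuousOn.prodMk (ha.mul hu).continuousOn (ContinuousOn.mul ?_
    (Complex.continuous_conj.comp hu).continuousOn)
  refine ContinuousOn.div (by fun_prop) ha.continuousOn fun p hp => ?_
  exact_mod_cast (show 0 < amp ‖p.1‖ p.2.1 from hp).ne'

lemma continuousOn_dpt : ContinuousOn (fun p : ℂ × ℝ × Circle => dpt p.1 p.2.1 p.2.2)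
    {p | 0 < amp ‖p.1‖ (-p.2.1)} := by
  have ha : Continuous fun p : ℂ × ℝ × Circle => ((amp ‖p.1‖ (-p.2.1) : ℝ) : ℂ) :=
    Complex.continuous_ofReal.comp
      (continuous_amp.comp (f := fun p : ℂ × ℝ × Circle => (‖p.1‖, -p.2.1)) (by fun_prop))
  have hu : Continuous fun p : ℂ × ℝ × Circle => (p.2.2 : ℂ) :=
    (continuous_subtype_val : Continuous fun c : Circle => (c : ℂ)).comp
      (continuous_snd.comp continuous_snd)
  refine ContinuousOn.prodMk (ContinuousOn.mul ?_ hu.continuousOn)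
    (ha.mul (Complex.continuous_conj.comp hu)).continuousOn
  refine ContinuousOn.div (by fun_prop) ha.continuousOn fun p hp => ?_
  exact_mod_cast (show 0 < amp ‖p.1‖ (-p.2.1) from hp).ne'

lemma continuousOn_lft : ContinuousOn (fun p : ℂ × ℝ × Circle => lft p.1 p.2.1 p.2.2)
    {p | p.2.1 ≠ 0} := by
  intro p hp
  refine ContinuousAt.continuousWithinAt ?_
  have hc : ContinuousAt (fun p : ℂ × ℝ × Circle => p.2.1) p := by fun_prop
  have hampc : Continuous fun p : ℂ × ℝ × Circle => amp ‖p.1‖ p.2.1 :=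
    continuous_amp.comp (f := fun p : ℂ × ℝ × Circle => (‖p.1‖, p.2.1)) (by fun_prop)
  have hampc' : Continuous fun p : ℂ × ℝ × Circle => amp ‖p.1‖ (-p.2.1) :=
    continuous_amp.comp (f := fun p : ℂ × ℝ × Circle => (‖p.1‖, -p.2.1)) (by fun_prop)
  rcases lt_or_gt_of_ne hp with h | h
  · have h1 : ∀ᶠ p' in 𝓝 p, p'.2.1 < 0 := hc.eventually_lt_const h
    refine ContinuousAt.congr (continuousOn_dpt.continuousAt ?_)
      (h1.mono fun p' hp' => (if_neg (not_lt.2 hp'.le)).symm)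
    exact (isOpen_lt continuous_const hampc').mem_nhds (amp_pos (Or.inl (by linarith)))
  · have h1 : ∀ᶠ p' in 𝓝 p, 0 < p'.2.1 := hc.eventually_const_lt h
    refine ContinuousAt.congr (continuousOn_upt.continuousAt ?_)
      (h1.mono fun p' hp' => (if_pos hp').symm)
    exact (isOpen_lt continuous_const hampc).mem_nhds (amp_pos (Or.inl h))

lemma zero_mem_Wm {lam δ : ℝ} (hlam : 0 ≤ lam) (hδ : 0 ≤ δ) : (0 : ℂ × ℂ) ∈ Wm lam δ := by
  simp [Wm, cw, hlam, hδ]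

lemma cw_smul (t : ℝ) (w : ℂ × ℂ) : cw (t • w) = t ^ 2 * cw w := by
  simp only [cw, Prod.smul_fst, Prod.smul_snd, norm_smul, mul_pow, Real.norm_eq_abs, sq_abs]
  ring

lemma norm_mul_smul (t : ℝ) (w : ℂ × ℂ) :
    ‖(t • w).1 * (t • w).2‖ = t ^ 2 * ‖w.1 * w.2‖ := by
  simp only [Prod.smul_fst, Prod.smul_snd, norm_smul, norm_mul, Real.norm_eq_abs]
  rw [← sq_abs t]; ring

end LocalModel

/-! ### Topology of the total space -/

section Covers

variable {X Y : Type} [TopologicalSpace X] [TopologicalSpace Y]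

lemma continuousOn_of_cover {f : X → Y} {s u v : Set X} (hu : IsOpen u) (hv : IsOpen v)
    (h : s ⊆ u ∪ v) (h₁ : ContinuousOn f (s ∩ u)) (h₂ : ContinuousOn f (s ∩ v)) :
    ContinuousOn f s := by
  intro x hx
  rcases h hx with hxu | hxv
  · exact (h₁ x ⟨hx, hxu⟩).mono_of_mem_nhdsWithin (inter_mem_nhdsWithin s (hu.mem_nhds hxu))
  · exact (h₂ x ⟨hx, hxv⟩).mono_of_mem_nhdsWithin (inter_mem_nhdsWithin s (hv.mem_nhds hxv))

/-- Mutually inverse continuous maps between subsets. -/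
def homeoOn {A : Set X} {B : Set Y} (f : X → Y) (g : Y → X) (hf : ContinuousOn f A)
    (hg : ContinuousOn g B) (mf : Set.MapsTo f A B) (mg : Set.MapsTo g B A)
    (l : Set.LeftInvOn g f A) (r : Set.LeftInvOn f g B) : A ≃ₜ B where
  toFun := mf.restrict
  invFun := mg.restrict
  left_inv a := Subtype.ext (l a.2)
  right_inv b := Subtype.ext (r b.2)
  continuous_toFun := hf.mapsToRestrict mf
  continuous_invFun := hg.mapsToRestrict mg

end Covers

/-! ### The cylinder inside the surface -/

section Cylinder

variable {F : Type} [TopologicalSpace F] {lam : ℝ} (ι : CylinderEmbedding F lam)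

/-- The closed cylinder. -/
def Cyl (lam : ℝ) : Set (ℝ × Circle) := {q | |q.1| ≤ lam}

lemma isCompact_Cyl (b : ℝ) : IsCompact (Cyl b) := by
  have : Cyl b = Set.Icc (-b) b ×ˢ Set.univ := by
    ext q
    simp [Cyl, abs_le]
  rw [this]
  exact isCompact_Icc.prod isCompact_univ

/-- The open cylinder of width `b` in the surface. -/
def CylinderEmbedding.U (b : ℝ) : Set F := ι.toFun '' {q | |q.1| < b}

/-- The closed cylinder of width `b` in the surface. -/
def CylinderEmbedding.K (b : ℝ) : Set F := ι.toFun '' Cyl b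

/-- The coordinates on the cylinder in the surface. -/
def CylinderEmbedding.inv : F → ℝ × Circle := Function.invFunOn ι.toFun (Cyl lam)

lemma CylinderEmbedding.inv_apply {t : ℝ × Circle} (ht : |t.1| ≤ lam) : ι.inv (ι.toFun t) = t :=
  ι.injOn.leftInvOn_invFunOn ht

lemma CylinderEmbedding.mem_U_iff {b : ℝ} (hb : b ≤ lam) {t : ℝ × Circle} (ht : |t.1| ≤ lam) :
    ι.toFun t ∈ ι.U b ↔ |t.1| < b := by
  refine ⟨?_, fun h => ⟨t, h, rfl⟩⟩
  rintro ⟨t', ht', h⟩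
  rw [← ι.injOn (show t' ∈ {q : ℝ × Circle | |q.1| ≤ lam} from (le_of_lt ht').trans hb) ht h]
  exact ht'

lemma CylinderEmbedding.mem_K_iff {b : ℝ} (hb : b ≤ lam) {t : ℝ × Circle} (ht : |t.1| ≤ lam) :
    ι.toFun t ∈ ι.K b ↔ |t.1| ≤ b := by
  refine ⟨?_, fun h => ⟨t, h, rfl⟩⟩
  rintro ⟨t', ht', h⟩
  rw [← ι.injOn (show t' ∈ {q : ℝ × Circle | |q.1| ≤ lam} from le_trans ht' hb) ht h]
  exact ht'

lemma CylinderEmbedding.mem_V_iff (hlam : 0 ≤ lam) {t : ℝ × Circle} (ht : |t.1| ≤ lam) :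
    ι.toFun t ∈ ι.vanishingCycle ↔ t.1 = 0 := by
  refine ⟨?_, fun h => ⟨t, h, rfl⟩⟩
  rintro ⟨t', ht', h⟩
  have ht0 : t'.1 = 0 := ht'
  rw [← ι.injOn (show t' ∈ {q : ℝ × Circle | |q.1| ≤ lam} by
    change |t'.1| ≤ lam
    rwa [ht0, abs_zero]) ht h]
  exact ht'

lemma CylinderEmbedding.isCompact_K {b : ℝ} (hb : b ≤ lam) : IsCompact (ι.K b) :=
  (isCompact_Cyl b).image_of_continuousOn (ι.continuousOn.mono fun _ h => le_trans h hb)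

lemma CylinderEmbedding.vanishingCycle_eq : ι.vanishingCycle = ι.K 0 := by
  unfold vanishingCycle K
  congr 1
  ext q
  simp [Cyl]

lemma CylinderEmbedding.V_subset_U {b : ℝ} (hb : 0 < b) : ι.vanishingCycle ⊆ ι.U b := by
  rintro _ ⟨t, ht, rfl⟩
  refine ⟨t, ?_, rfl⟩
  change |t.1| < b
  rwa [show t.1 = 0 from ht, abs_zero]

lemma CylinderEmbedding.inv_mem {q : F} (hq : q ∈ ι.K lam) :
    |(ι.inv q).1| ≤ lam ∧ ι.toFun (ι.inv q) = q := by
  obtain ⟨t, ht, rfl⟩ := hq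
  rw [ι.inv_apply ht]
  exact ⟨ht, rfl⟩

lemma CylinderEmbedding.U_subset_K (b : ℝ) : ι.U b ⊆ ι.K b :=
  Set.image_mono fun q (h : |q.1| < b) => le_of_lt h

lemma CylinderEmbedding.K_mono {b c : ℝ} (h : b ≤ c) : ι.K b ⊆ ι.K c :=
  Set.image_mono fun q (h' : |q.1| ≤ b) => le_trans h' h

variable [T2Space F]

/-- A continuous injection of a compact space into a Hausdorff space is a closed embedding. -/
lemma CylinderEmbedding.continuousOn_inv : ContinuousOn ι.inv (ι.K lam) := by
  have := isCompact_iff_compactSpace.1 (isCompact_Cyl lam)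
  let f : Cyl lam → F := fun t => ι.toFun t
  have hf : IsClosedEmbedding f := (continuousOn_iff_continuous_domRestrict.1 ι.continuousOn
    : Continuous f).isClosedEmbedding fun a b h => Subtype.ext (ι.injOn a.2 b.2 h)
  rw [continuousOn_iff_continuous_domRestrict]
  let e := hf.isEmbedding.toHomeomorph
  have he : ∀ x : ι.K lam, x.1 ∈ Set.range f := fun x => by
    obtain ⟨t, ht, h⟩ := x.2
    exact ⟨⟨t, ht⟩, h⟩
  have : Set.domRestrict (ι.K lam) ι.inv = fun x => ((e.symm ⟨x.1, he x⟩ : Cyl lam) : ℝ × Circle) := by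
    funext x
    obtain ⟨t, ht⟩ := he x
    have h1 : (⟨x.1, he x⟩ : Set.range f) = e t := Subtype.ext ht.symm
    rw [h1, e.symm_apply_apply, Set.domRestrict_apply, ← ht]
    exact ι.inv_apply t.2
  rw [this]
  fun_prop

/-- Only the full open cylinder is assumed to be open; the thinner ones are cut out of it by the
continuous coordinate of `inv`. -/
lemma CylinderEmbedding.isOpen_U {b : ℝ} (hb : b ≤ lam) : IsOpen (ι.U b) := by
  have h : ι.U b = ι.U lam ∩ ι.inv ⁻¹' {q | |q.1| < b} := by
    ext q
    constructor
    · rintro ⟨t, ht, rfl⟩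
      have ht' : |t.1| < lam := lt_of_lt_of_le ht hb
      refine ⟨⟨t, ht', rfl⟩, ?_⟩
      rw [Set.mem_preimage, ι.inv_apply ht'.le]
      exact ht
    · rintro ⟨⟨t, ht, rfl⟩, h⟩
      rw [Set.mem_preimage, ι.inv_apply (le_of_lt ht)] at h
      exact ⟨t, h, rfl⟩
  rw [h]
  exact (ι.continuousOn_inv.mono (ι.U_subset_K lam)).isOpen_inter_preimage ι.isOpen_image
    (isOpen_lt (by fun_prop) continuous_const)

lemma CylinderEmbedding.isClosed_V (hlam : 0 ≤ lam) : IsClosed ι.vanishingCycle := by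
  rw [ι.vanishingCycle_eq]
  exact (ι.isCompact_K hlam).isClosed

end Cylinder

/-- Admissible parameters. -/
structure IsAdm (lam δ d₀ : ℝ) : Prop where
  d₀_pos : 0 < d₀
  d₀_lt : d₀ < lam
  δ_pos : 0 < δ

lemma IsAdm.lam_nonneg {lam δ d₀ : ℝ} (h : IsAdm lam δ d₀) : 0 ≤ lam :=
  (h.d₀_pos.trans h.d₀_lt).le

lemma IsAdm.c_pos {lam δ d₀ : ℝ} (h : IsAdm lam δ d₀) : 0 < lam - d₀ := sub_pos.2 h.d₀_lt

lemma IsAdm.c_lt {lam δ d₀ : ℝ} (h : IsAdm lam δ d₀) : lam - d₀ < lam := by linarith [h.d₀_pos]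

/-! ### The two pieces of the total space -/

section Total

variable {F : Type} [TopologicalSpace F] {lam δ d₀ : ℝ} {ι : CylinderEmbedding F lam}

lemma ofW_mem_E (h : IsAdm lam δ d₀) {w : ℂ × ℂ} : ofW w ∈ E lam δ ↔ w ∈ Wm lam δ := by
  rw [mem_E_iff h.lam_nonneg, wPlus_ofW, wMinus_ofW]

lemma zero_mem_E (h : IsAdm lam δ d₀) : (0 : ℂ × ℂ) ∈ E lam δ := by
  rw [mem_E_iff h.lam_nonneg]
  convert zero_mem_Wm h.lam_nonneg h.δ_pos.le using 1
  simp [wPlus, wMinus]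

open Classical in
/-- The chart of the total space given by the local model, in the coordinates `w₊`, `w₋`. -/
def eX (ι : CylinderEmbedding F lam) (h : IsAdm lam δ d₀) (w : ℂ × ℂ) : TotalSpace ι δ d₀ :=
  Quot.mk _ (Sum.inl (if hw : ofW w ∈ E lam δ then ⟨ofW w, hw⟩ else ⟨0, zero_mem_E h⟩))

open Classical in
/-- The trivial part of the total space. -/
def sX (ι : CylinderEmbedding F lam) (h : IsAdm lam δ d₀) (y : ℂ × F) : TotalSpace ι δ d₀ :=
  if hy : y.1 ∈ Metric.closedBall 0 δ ∧ y.2 ∈ ι.complement d₀ then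
    Quot.mk _ (Sum.inr (⟨y.1, hy.1⟩, ⟨y.2, hy.2⟩)) else eX ι h 0

lemma eX_apply (h : IsAdm lam δ d₀) {w : ℂ × ℂ} (hw : w ∈ Wm lam δ) :
    eX ι h w = Quot.mk _ (Sum.inl ⟨ofW w, (ofW_mem_E h).2 hw⟩) := by
  rw [eX, dif_pos]

lemma sX_apply (h : IsAdm lam δ d₀) {z : ℂ} {q : F} (hz : z ∈ Metric.closedBall 0 δ)
    (hq : q ∈ ι.complement d₀) :
    sX ι h (z, q) = Quot.mk _ (Sum.inr (⟨z, hz⟩, ⟨q, hq⟩)) := by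
  exact dif_pos (c := (z, q).1 ∈ Metric.closedBall 0 δ ∧ (z, q).2 ∈ ι.complement d₀) ⟨hz, hq⟩

lemma exists_rep (h : IsAdm lam δ d₀) (p : TotalSpace ι δ d₀) :
    (∃ w ∈ Wm lam δ, p = eX ι h w) ∨
      ∃ z ∈ Metric.closedBall (0 : ℂ) δ, ∃ q ∈ ι.complement d₀, p = sX ι h (z, q) := by
  induction p using Quot.ind with
  | mk y =>
    rcases y with ⟨p, hp⟩ | ⟨⟨z, hz⟩, ⟨q, hq⟩⟩
    · refine Or.inl ⟨(wPlus p, wMinus p), (mem_E_iff h.lam_nonneg p).1 hp, ?_⟩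
      rw [eX_apply h ((mem_E_iff h.lam_nonneg p).1 hp)]
      simp only [ofW_wPlus_wMinus]
      rfl
    · exact Or.inr ⟨z, hz, q, hq, (sX_apply h hz hq).symm⟩

lemma eX_continuousOn (h : IsAdm lam δ d₀) : ContinuousOn (eX ι h) (Wm lam δ) := by
  rw [continuousOn_iff_continuous_domRestrict]
  have : Set.domRestrict (Wm lam δ) (eX ι h) = fun w =>
      Quot.mk _ (Sum.inl ⟨ofW w, (ofW_mem_E h).2 w.2⟩) := funext fun w => eX_apply h w.2
  rw [this]
  exact continuous_quot_mk.comp (continuous_inl.comp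
    ((continuous_ofW.comp continuous_subtype_val).subtype_mk _))

lemma sX_continuousOn (h : IsAdm lam δ d₀) :
    ContinuousOn (sX ι h) (Metric.closedBall 0 δ ×ˢ ι.complement d₀) := by
  rw [continuousOn_iff_continuous_domRestrict]
  have : Set.domRestrict (Metric.closedBall 0 δ ×ˢ ι.complement d₀) (sX ι h) = fun y =>
      Quot.mk _ (Sum.inr (⟨y.1.1, y.2.1⟩, ⟨y.1.2, y.2.2⟩)) :=
    funext fun y => sX_apply h y.2.1 y.2.2
  rw [this]
  refine continuous_quot_mk.comp (continuous_inr.comp ?_)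
  fun_prop

lemma mem_complement_iff (h : IsAdm lam δ d₀) {t : ℝ × Circle} (ht : |t.1| ≤ lam) :
    ι.toFun t ∈ ι.complement d₀ ↔ lam - d₀ ≤ |t.1| := by
  rw [← not_lt, ← ι.mem_U_iff h.c_lt.le ht]
  rfl

/-- The gluing relation. -/
lemma eX_eq_sX (h : IsAdm lam δ d₀) {w : ℂ × ℂ} (hw : w ∈ Wm lam δ) (hc : lam - d₀ ≤ |cw w|) :
    eX ι h w = sX ι h (w.1 * w.2, ι.toFun (cw w, dirC w)) := by
  have hq : ι.toFun (cw w, dirC w) ∈ ι.complement d₀ :=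
    (mem_complement_iff h (t := (cw w, dirC w)) hw.1).2 hc
  have hz : w.1 * w.2 ∈ Metric.closedBall (0 : ℂ) δ := by simpa using hw.2
  rw [eX_apply h hw, sX_apply h hz hq]
  refine Quot.sound (Glue.mk _ _ ?_ ?_ ?_)
  · simpa [cylX_eq] using hc
  · simp [localPi_eq]
  · simp [cyl_eq]

/-! #### Functions on the total space -/

/-- The truncated absolute value of the coordinate `x`. -/
def xi : TotalSpace ι δ d₀ → ℝ :=
  Quot.lift (Sum.elim (fun e => min |cylX e| (lam - d₀)) (fun _ => lam - d₀)) (by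
    rintro _ _ ⟨e, s, hc, -, -⟩
    exact min_eq_right hc)

/-- The projection to the surface, meaningful away from `xi = 0`. -/
def theta : TotalSpace ι δ d₀ → F :=
  Quot.lift (Sum.elim (fun e => ι.toFun (cyl e)) (fun s => (s.2 : F))) (by
    rintro _ _ ⟨e, s, -, -, hf⟩
    exact hf.symm)

/-- A cut off form of the coordinates `w₊`, `w₋`. -/
def kap : TotalSpace ι δ d₀ → ℂ × ℂ :=
  Quot.lift (Sum.elim (fun e => (max 0 (lam - d₀ - |cylX e|)) • (wPlus e, wMinus e)) (fun _ => 0))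
    (by
      rintro _ _ ⟨e, s, hc, -, -⟩
      simp [max_eq_left (sub_nonpos.2 hc)])

/-- The coordinates `w₊`, `w₋` on `xi < lam - d₀`. -/
def winv (p : TotalSpace ι δ d₀) : ℂ × ℂ := (lam - d₀ - xi p)⁻¹ • kap p

section Values

variable (h : IsAdm lam δ d₀) {w : ℂ × ℂ} {z : ℂ} {q : F}

lemma xi_eX (hw : w ∈ Wm lam δ) : xi (eX ι h w) = min |cw w| (lam - d₀) := by
  rw [eX_apply h hw]
  change min |cylX (ofW w)| (lam - d₀) = _
  simp [cylX_eq]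

lemma xi_sX (hz : z ∈ Metric.closedBall 0 δ) (hq : q ∈ ι.complement d₀) :
    xi (sX ι h (z, q)) = lam - d₀ := by
  rw [sX_apply h hz hq]; rfl

lemma proj_eX (hw : w ∈ Wm lam δ) : proj ι δ d₀ (eX ι h w) = w.1 * w.2 := by
  rw [eX_apply h hw]
  change localPi (ofW w) = _
  simp [localPi_eq]

lemma proj_sX (hz : z ∈ Metric.closedBall 0 δ) (hq : q ∈ ι.complement d₀) :
    proj ι δ d₀ (sX ι h (z, q)) = z := by
  rw [sX_apply h hz hq]; rfl

lemma theta_eX (hw : w ∈ Wm lam δ) : theta (eX ι h w) = ι.toFun (cw w, dirC w) := by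
  rw [eX_apply h hw]
  change ι.toFun (cyl (ofW w)) = _
  simp [cyl_eq]

lemma theta_sX (hz : z ∈ Metric.closedBall 0 δ) (hq : q ∈ ι.complement d₀) :
    theta (sX ι h (z, q)) = q := by
  rw [sX_apply h hz hq]; rfl

lemma winv_eX (hw : w ∈ Wm lam δ) (hc : |cw w| < lam - d₀) : winv (eX ι h w) = w := by
  rw [winv, xi_eX h hw, min_eq_left hc.le, eX_apply h hw]
  change (lam - d₀ - |cw w|)⁻¹ • ((max 0 (lam - d₀ - |cylX (ofW w)|)) •
    (wPlus (ofW w), wMinus (ofW w))) = w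
  have h0 : 0 < lam - d₀ - |cw w| := by linarith
  rw [cylX_eq, wPlus_ofW, wMinus_ofW, max_eq_right h0.le, smul_smul, inv_mul_cancel₀ h0.ne',
    one_smul]

/-- Points with `xi < lam - d₀` come from the local model. -/
lemma exists_eX_of_xi_lt {p : TotalSpace ι δ d₀} (hp : xi p < lam - d₀) :
    ∃ w ∈ Wm lam δ, |cw w| < lam - d₀ ∧ p = eX ι h w ∧ xi p = |cw w| ∧ winv p = w := by
  rcases exists_rep h p with ⟨w, hw, rfl⟩ | ⟨z, hz, q, hq, rfl⟩
  · rw [xi_eX h hw] at hp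
    have hc := (min_lt_iff.1 hp).resolve_right (lt_irrefl _)
    exact ⟨w, hw, hc, rfl, by rw [xi_eX h hw, min_eq_left hc.le], winv_eX h hw hc⟩
  · rw [xi_sX h hz hq] at hp
    exact absurd hp (lt_irrefl _)

end Values

lemma continuous_proj : Continuous (proj ι δ d₀) := by
  refine continuous_quot_lift _ (continuous_sum_dom.2 ⟨?_, ?_⟩)
  · change Continuous fun e : E lam δ => localPi e
    unfold localPi; fun_prop
  · change Continuous fun s : TrivialPart ι δ d₀ => (s.1 : ℂ)
    fun_prop

lemma continuous_wPlus : Continuous wPlus := by unfold wPlus; fun_prop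

lemma continuous_wMinus : Continuous wMinus := by unfold wMinus; fun_prop

lemma continuous_cylX : Continuous cylX :=
  continuous_cw.comp (continuous_wPlus.prodMk continuous_wMinus)

/-- Truncating |x| at lam - d₀ makes it constant on the collar, so it extends over D × S. -/
lemma continuous_xi : Continuous (xi : TotalSpace ι δ d₀ → ℝ) := by
  refine continuous_quot_lift _ (continuous_sum_dom.2 ⟨?_, ?_⟩)
  · change Continuous fun e : E lam δ => min |cylX e| (lam - d₀)
    have := continuous_cylX
    fun_prop
  · exact continuous_const

lemma continuous_kap : Continuous (kap : TotalSpace ι δ d₀ → ℂ × ℂ) := by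
  refine continuous_quot_lift _ (continuous_sum_dom.2 ⟨?_, ?_⟩)
  · change Continuous fun e : E lam δ => (max 0 (lam - d₀ - |cylX e|)) • (wPlus e, wMinus e)
    have := continuous_cylX
    have := continuous_wPlus
    have := continuous_wMinus
    fun_prop
  · exact continuous_const

/-- The coordinates w₊, w₋ do not descend to the quotient, but their product with a cut-off
vanishing on the collar does (`kap`). Dividing by lam - d₀ - ξ recovers them continuously. -/
lemma continuousOn_winv :
    ContinuousOn (winv : TotalSpace ι δ d₀ → ℂ × ℂ) {p | xi p < lam - d₀} := by
  refine ContinuousOn.smul (ContinuousOn.inv₀ (continuous_const.sub continuous_xi).continuousOn fun p hp => ?_)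
    continuous_kap.continuousOn
  exact (sub_pos.2 hp).ne'

/-- The set {ξ > 0} is open, so continuity can be tested on the two pieces before gluing; on E it
excludes x = 0, where the circle coordinate jumps. -/
lemma continuousOn_theta (h : IsAdm lam δ d₀) :
    ContinuousOn (theta : TotalSpace ι δ d₀ → F) {p | 0 < xi p} := by
  have hq : IsQuotientMap (Quot.mk (Glue ι δ d₀)) := isQuotientMap_quot_mk
  have ho : IsOpen {p : TotalSpace ι δ d₀ | 0 < xi p} := isOpen_lt continuous_const continuous_xi
  refine (hq.continuousOn_isOpen_iff ho).2 ?_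
  have ho' := ho.preimage hq.continuous
  rintro (e | s) hp
  · refine ContinuousAt.continuousWithinAt ?_
    rw [← IsOpenEmbedding.inl.continuousAt_iff]
    have hp' : 0 < min |cylX e| (lam - d₀) := hp
    have h0 : cylX e ≠ 0 := abs_pos.1 (lt_min_iff.1 hp').1
    have h1 : ContinuousAt (fun e : E lam δ => cyl e) e := by
      have : (fun e : E lam δ => cyl e) = fun e : E lam δ =>
          (cylX e, dirC (wPlus e, wMinus e)) := funext fun e => cyl_eq _
      rw [this]
      refine ContinuousAt.prodMk (continuous_cylX.comp continuous_subtype_val).continuousAt ?_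
      have h2 : ContinuousAt dirC (wPlus e, wMinus e) := continuousOn_dirC.continuousAt
        ((isOpen_ne_fun continuous_cw continuous_const).mem_nhds h0)
      exact h2.comp (f := fun e : E lam δ => (wPlus e, wMinus e))
        ((continuous_wPlus.prodMk continuous_wMinus).comp continuous_subtype_val).continuousAt
    have hT : ∀ e : E lam δ, cyl e ∈ {q : ℝ × Circle | |q.1| ≤ lam} := fun e =>
      ((mem_E_iff h.lam_nonneg _).1 e.2).1
    exact (ι.continuousOn _ (hT e)).tendsto.comp
      (tendsto_nhdsWithin_iff.2 ⟨h1, Filter.Eventually.of_forall hT⟩)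
  · refine ContinuousAt.continuousWithinAt ?_
    rw [← IsOpenEmbedding.inr.continuousAt_iff]
    change ContinuousAt (fun s : TrivialPart ι δ d₀ => (s.2 : F)) s
    fun_prop

end Total

/-! ### The trivialisation away from the vanishing cycles -/

section Trivialisation

variable {F : Type} [TopologicalSpace F] {lam δ d₀ : ℝ} {ι : CylinderEmbedding F lam}

open Classical in
/-- The inverse of the trivialisation away from the vanishing cycles. -/
def psi (ι : CylinderEmbedding F lam) (h : IsAdm lam δ d₀) (y : ℂ × F) : TotalSpace ι δ d₀ :=
  if y.2 ∈ ι.U lam then eX ι h (lft y.1 (ι.inv y.2).1 (ι.inv y.2).2) else sX ι h y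

variable (h : IsAdm lam δ d₀) {w : ℂ × ℂ} {z : ℂ} {q : F} {x : ℝ} {v : Circle}

lemma lft_mem (hz : z ∈ Metric.closedBall (0 : ℂ) δ) (hx : |x| ≤ lam) (hx0 : x ≠ 0) :
    lft z x v ∈ Wm lam δ := by
  refine ⟨by rwa [cw_lft v hx0], ?_⟩
  rw [lft_mul v hx0]
  simpa using hz

lemma sX_eq_eX_lft (hz : z ∈ Metric.closedBall (0 : ℂ) δ) (hx : |x| ≤ lam) (hc : lam - d₀ ≤ |x|) :
    sX ι h (z, ι.toFun (x, v)) = eX ι h (lft z x v) := by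
  have hx0 : x ≠ 0 := abs_pos.1 (h.c_pos.trans_le hc)
  rw [eX_eq_sX h (lft_mem hz hx hx0) (by rwa [cw_lft v hx0]), lft_mul v hx0, cw_lft v hx0,
    dirC_lft v hx0]

/-- Only |x| = lam falls outside the first case of the definition of `psi`, and there the gluing
identifies the two formulas. -/
lemma psi_cyl (hz : z ∈ Metric.closedBall (0 : ℂ) δ) (hx : |x| ≤ lam) :
    psi ι h (z, ι.toFun (x, v)) = eX ι h (lft z x v) := by
  unfold psi
  split_ifs with hU
  · rw [ι.inv_apply (t := (x, v)) hx]
  · rw [ι.mem_U_iff le_rfl (t := (x, v)) hx, not_lt] at hU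
    exact sX_eq_eX_lft h hz hx (h.c_lt.le.trans hU)

lemma psi_complement (hz : z ∈ Metric.closedBall (0 : ℂ) δ) (hq : q ∈ ι.complement d₀) :
    psi ι h (z, q) = sX ι h (z, q) := by
  by_cases hU : q ∈ ι.U lam
  · obtain ⟨⟨x, v⟩, hx, rfl⟩ := hU
    have hx' : |x| ≤ lam := le_of_lt hx
    have hc := (mem_complement_iff h (t := (x, v)) hx').1 hq
    rw [psi_cyl h hz hx', sX_eq_eX_lft h hz hx' hc]
  · exact if_neg hU

/-- Every point of the surface lies in the cylinder or in the complement. -/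
lemma mem_cases (ι : CylinderEmbedding F lam) (d₀ : ℝ) (hd : 0 ≤ d₀) (q : F) :
    (∃ x v, |x| < lam ∧ q = ι.toFun (x, v)) ∨ (q ∈ ι.complement d₀ ∧ q ∉ ι.U lam) := by
  by_cases hU : q ∈ ι.U lam
  · obtain ⟨⟨x, v⟩, hx, rfl⟩ := hU
    exact Or.inl ⟨x, v, hx, rfl⟩
  · refine Or.inr ⟨?_, hU⟩
    rintro ⟨t, ht, rfl⟩
    have ht' : |t.1| < lam - d₀ := ht
    exact hU ⟨t, by change |t.1| < lam; linarith, rfl⟩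

lemma notMem_K_of_complement {b : ℝ} (hb : b < lam - d₀) (hq : q ∈ ι.complement d₀) :
    q ∉ ι.K b := by
  rintro ⟨t, ht, rfl⟩
  exact hq ⟨t, lt_of_le_of_lt ht hb, rfl⟩

lemma psi_values (hz : z ∈ Metric.closedBall (0 : ℂ) δ) (hq : q ∉ ι.vanishingCycle) :
    proj ι δ d₀ (psi ι h (z, q)) = z ∧ theta (psi ι h (z, q)) = q ∧ 0 < xi (psi ι h (z, q)) := by
  rcases mem_cases ι d₀ h.d₀_pos.le q with ⟨x, v, hx, rfl⟩ | ⟨hS, -⟩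
  · have hx0 : x ≠ 0 := fun h0 => hq ((ι.mem_V_iff h.lam_nonneg (t := (x, v)) hx.le).2 h0)
    rw [psi_cyl h hz hx.le, proj_eX h (lft_mem hz hx.le hx0), theta_eX h (lft_mem hz hx.le hx0),
      xi_eX h (lft_mem hz hx.le hx0), lft_mul v hx0, cw_lft v hx0, dirC_lft v hx0]
    exact ⟨rfl, rfl, lt_min (abs_pos.2 hx0) h.c_pos⟩
  · rw [psi_complement h hz hS, proj_sX h hz hS, theta_sX h hz hS, xi_sX h hz hS]
    exact ⟨rfl, rfl, h.c_pos⟩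

lemma xi_psi_lt_iff (hz : z ∈ Metric.closedBall (0 : ℂ) δ) (hq : q ∉ ι.vanishingCycle) {b : ℝ}
    (hb : b ≤ lam - d₀) : xi (psi ι h (z, q)) < b ↔ q ∈ ι.U b := by
  rcases mem_cases ι d₀ h.d₀_pos.le q with ⟨x, v, hx, rfl⟩ | ⟨hS, hU⟩
  · have hx0 : x ≠ 0 := fun h0 => hq ((ι.mem_V_iff h.lam_nonneg (t := (x, v)) hx.le).2 h0)
    rw [psi_cyl h hz hx.le, xi_eX h (lft_mem hz hx.le hx0), cw_lft v hx0,
      ι.mem_U_iff (hb.trans h.c_lt.le) (t := (x, v)) hx.le, min_lt_iff,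
      or_iff_left (not_lt.2 hb)]
  · rw [psi_complement h hz hS, xi_sX h hz hS]
    refine ⟨fun h' => absurd h' (not_lt.2 hb), fun ⟨t, ht, h'⟩ => absurd hS ?_⟩
    rintro h2
    exact h2 ⟨t, lt_of_lt_of_le ht hb, h'⟩

lemma psi_proj_theta {p : TotalSpace ι δ d₀} (hp : 0 < xi p) :
    proj ι δ d₀ p ∈ Metric.closedBall (0 : ℂ) δ ∧ theta p ∉ ι.vanishingCycle ∧
      psi ι h (proj ι δ d₀ p, theta p) = p := by
  rcases exists_rep h p with ⟨w, hw, rfl⟩ | ⟨z, hz, q, hq, rfl⟩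
  · rw [xi_eX h hw] at hp
    have h0 : cw w ≠ 0 := abs_pos.1 (lt_min_iff.1 hp).1
    have hz : w.1 * w.2 ∈ Metric.closedBall (0 : ℂ) δ := by simpa using hw.2
    rw [proj_eX h hw, theta_eX h hw, psi_cyl h hz hw.1, lft_eq_self h0]
    exact ⟨hz, fun h' => h0 ((ι.mem_V_iff h.lam_nonneg (t := (cw w, dirC w)) hw.1).1 h'), rfl⟩
  · rw [proj_sX h hz hq, theta_sX h hz hq, psi_complement h hz hq]
    refine ⟨hz, fun h' => ?_, rfl⟩
    rw [ι.vanishingCycle_eq] at h'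
    exact notMem_K_of_complement h.c_pos hq h'

lemma proj_mem (h : IsAdm lam δ d₀) (p : TotalSpace ι δ d₀) : ‖proj ι δ d₀ p‖ ≤ δ := by
  rcases exists_rep h p with ⟨w, hw, rfl⟩ | ⟨z, hz, q, hq, rfl⟩
  · rw [proj_eX h hw]; exact hw.2
  · rw [proj_sX h hz hq]; simpa using hz

variable [T2Space F]

/-- Two open sets suffice: over the open cylinder the map is the lift to the local model, and off
the compact cylinder of width lam - d₀ it is the trivial piece. -/
lemma psi_continuousOn :
    ContinuousOn (psi ι h) (Metric.closedBall 0 δ ×ˢ ι.vanishingCycleᶜ) := by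
  have hKc : IsOpen (Prod.snd ⁻¹' (ι.K (lam - d₀))ᶜ : Set (ℂ × F)) :=
    (ι.isCompact_K h.c_lt.le).isClosed.isOpen_compl.preimage continuous_snd
  have hU : IsOpen (Prod.snd ⁻¹' ι.U lam : Set (ℂ × F)) :=
    (ι.isOpen_U le_rfl).preimage continuous_snd
  refine continuousOn_of_cover hU hKc ?_ ?_ ?_
  · rintro ⟨z, q⟩ -
    rcases mem_cases ι d₀ h.d₀_pos.le q with ⟨x, v, hx, rfl⟩ | ⟨hS, hU⟩
    · exact Or.inl ⟨(x, v), hx, rfl⟩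
    · refine Or.inr fun ⟨t, ht, h'⟩ => hU ⟨t, lt_of_le_of_lt ht h.c_lt, h'⟩
  · have h1 : ContinuousOn (fun y : ℂ × F => lft y.1 (ι.inv y.2).1 (ι.inv y.2).2)
        ((Metric.closedBall 0 δ ×ˢ ι.vanishingCycleᶜ) ∩ Prod.snd ⁻¹' ι.U lam) := by
      refine continuousOn_lft.comp (f := fun y : ℂ × F => (y.1, ι.inv y.2))
        (continuousOn_fst.prodMk (ι.continuousOn_inv.comp continuousOn_snd
          fun y hy => ι.U_subset_K _ hy.2)) ?_
      rintro ⟨z, q⟩ ⟨⟨-, hq⟩, ⟨t, ht, rfl⟩⟩ h0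
      change (ι.inv (ι.toFun t)).1 = 0 at h0
      rw [ι.inv_apply (le_of_lt ht)] at h0
      exact hq ⟨t, h0, rfl⟩
    refine ((eX_continuousOn h).comp h1 ?_).congr fun y hy => if_pos hy.2
    rintro ⟨z, q⟩ ⟨⟨hz, hq⟩, ⟨t, ht, rfl⟩⟩
    change lft z (ι.inv (ι.toFun t)).1 (ι.inv (ι.toFun t)).2 ∈ _
    rw [ι.inv_apply (le_of_lt ht)]
    exact lft_mem hz (le_of_lt ht) fun h0 => hq ⟨t, h0, rfl⟩
  · refine ((sX_continuousOn (ι := ι) h).mono ?_).congr (f := sX ι h) ?_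
    · rintro ⟨z, q⟩ ⟨⟨hz, -⟩, hq⟩
      exact ⟨hz, fun h' => hq (ι.U_subset_K _ h')⟩
    · rintro ⟨z, q⟩ ⟨⟨hz, -⟩, hq⟩
      exact psi_complement h hz fun h' => hq (ι.U_subset_K _ h')

/-- The trivialisation away from the vanishing cycles. -/
def trivHomeo (h : IsAdm lam δ d₀) :
    (Metric.closedBall (0 : ℂ) δ ×ˢ ι.vanishingCycleᶜ : Set (ℂ × F)) ≃ₜ
      {p : TotalSpace ι δ d₀ | 0 < xi p} :=
  homeoOn (psi ι h) (fun p => (proj ι δ d₀ p, theta p)) (psi_continuousOn h)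
    (continuous_proj.continuousOn.prodMk (continuousOn_theta h))
    (fun _ hy => (psi_values h hy.1 hy.2).2.2)
    (fun _ hp => ⟨(psi_proj_theta h hp).1, (psi_proj_theta h hp).2.1⟩)
    (fun _ hy => Prod.ext (psi_values h hy.1 hy.2).1 (psi_values h hy.1 hy.2).2.1)
    (fun _ hp => (psi_proj_theta h hp).2.2)

/-- The inclusion of the trivial open part. -/
def trivMap (ι : CylinderEmbedding F lam) (h : IsAdm lam δ d₀) :
    C(Metric.closedBall (0 : ℂ) δ × (ι.vanishingCycleᶜ : Set F), TotalSpace ι δ d₀) :=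
  ⟨fun y => psi ι h (y.1, y.2), (psi_continuousOn h).comp_continuous (by fun_prop)
    fun y => ⟨y.1.2, y.2.2⟩⟩

lemma trivMap_isOpenEmbedding : IsOpenEmbedding (trivMap ι h) := by
  have h1 : IsOpenEmbedding (Subtype.val ∘ trivHomeo (ι := ι) h) :=
    (isOpen_lt continuous_const continuous_xi).isOpenEmbedding_subtypeVal.comp
      (trivHomeo h).isOpenEmbedding
  exact h1.comp (Homeomorph.Set.prod (Metric.closedBall (0 : ℂ) δ)
    (ι.vanishingCycleᶜ : Set F)).symm.isOpenEmbedding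

lemma range_trivMap : Set.range (trivMap ι h) = {p | 0 < xi p} := by
  ext p
  constructor
  · rintro ⟨y, rfl⟩
    exact (psi_values h y.1.2 y.2.2).2.2
  · intro hp
    obtain ⟨h1, h2, h3⟩ := psi_proj_theta h hp
    exact ⟨(⟨_, h1⟩, ⟨_, h2⟩), h3⟩

omit [T2Space F] in
/-- Subsets of the local model as subsets of the total space. -/
def modelHomeo (ι : CylinderEmbedding F lam) (h : IsAdm lam δ d₀) (P : Set (ℂ × ℂ))
    (hP : P ⊆ {w ∈ Wm lam δ | |cw w| < lam - d₀}) :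
    P ≃ₜ {p : TotalSpace ι δ d₀ | xi p < lam - d₀ ∧ winv p ∈ P} :=
  homeoOn (eX ι h) winv ((eX_continuousOn h).mono fun w hw => (hP hw).1)
    (continuousOn_winv.mono fun p hp => hp.1)
    (fun w hw => ⟨by
      rw [xi_eX h (hP hw).1]
      exact min_lt_of_left_lt (hP hw).2, by
      rwa [winv_eX h (hP hw).1 (hP hw).2]⟩)
    (fun p hp => hp.2)
    (fun w hw => winv_eX h (hP hw).1 (hP hw).2)
    (fun p hp => by
      obtain ⟨w, hw, -, rfl, -, hww⟩ := exists_eX_of_xi_lt h hp.1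
      rw [hww])

end Trivialisation

/-! ### Regular fibres as copies of the surface -/

section Fibre

/-- The direction of `w₊`. -/
def dirU (w : ℂ × ℂ) : Circle := Circle.exp (Complex.arg w.1)

lemma coe_dirU {w : ℂ × ℂ} (hw : w.1 ≠ 0) : (dirU w : ℂ) = w.1 / ‖w.1‖ := coe_exp_arg hw

lemma continuousOn_dirU : ContinuousOn dirU {w | w.1 ≠ 0} := by
  intro w hw
  refine ContinuousAt.continuousWithinAt ?_
  refine (IsInducing.subtypeVal : IsInducing (fun c : Circle => (c : ℂ))).continuousAt_iff.2 ?_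
  have h1 : ∀ᶠ w' : ℂ × ℂ in 𝓝 w, w'.1 ≠ 0 := continuous_fst.continuousAt.eventually_ne hw
  have h2 : (fun w : ℂ × ℂ => w.1 / ‖w.1‖) =ᶠ[𝓝 w] (fun c : Circle => (c : ℂ)) ∘ dirU :=
    h1.mono fun w' hw' => (coe_dirU hw').symm
  refine ContinuousAt.congr ?_ h2
  exact ContinuousAt.div (by fun_prop) (by fun_prop) (by simpa using hw)

lemma upt_dirU {w : ℂ × ℂ} (hw : w.1 ≠ 0) : upt (w.1 * w.2) (cw w) (dirU w) = w :=
  upt_eq_self _ hw (coe_dirU hw)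

variable {z : ℂ} {x : ℝ}

lemma dirU_upt (u : Circle) (h : 0 < amp ‖z‖ x) : dirU (upt z x u) = u := by
  have h' : (amp ‖z‖ x : ℂ) ≠ 0 := by exact_mod_cast h.ne'
  have h0 : (upt z x u).1 ≠ 0 := by
    rw [← norm_pos_iff, norm_upt_fst]; exact h
  ext
  rw [coe_dirU h0, norm_upt_fst]
  simp only [upt]
  field_simp

/-- Since w₊w₋ = z, the direction of w₊ is the conjugate direction of w₋ rotated by arg z. This is
the mismatch between the two ends of the cylinder. -/
lemma upt_mul_exp_arg (hz : z ≠ 0) (u : Circle) :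
    upt z x (u * Circle.exp (Complex.arg z)) = dpt z x u := by
  have hr : 0 < ‖z‖ := norm_pos_iff.2 hz
  have ha : (amp ‖z‖ x : ℂ) ≠ 0 := by exact_mod_cast (amp_pos (Or.inr hr)).ne'
  have hb : (amp ‖z‖ (-x) : ℂ) ≠ 0 := by exact_mod_cast (amp_pos (x := -x) (Or.inr hr)).ne'
  have hab : (amp ‖z‖ x : ℂ) * amp ‖z‖ (-x) = ‖z‖ := by
    exact_mod_cast amp_mul _ x (norm_nonneg z)
  have hn : (‖z‖ : ℂ) ≠ 0 := by exact_mod_cast hr.ne'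
  have hzz : z * (starRingEnd ℂ) z = ‖z‖ ^ 2 := by
    rw [Complex.mul_conj, Complex.normSq_eq_norm_sq]; push_cast; rfl
  ext1
  · simp only [upt, dpt, Circle.coe_mul, coe_exp_arg hz]
    field_simp
    linear_combination hab
  · simp only [upt, dpt, Circle.coe_mul, coe_exp_arg hz, map_mul, map_div₀, Complex.conj_ofReal]
    field_simp
    linear_combination hzz - ‖z‖ * hab

/-- The cut off function for the twist. -/
def twist (a x : ℝ) : ℝ := max 0 (min 1 ((a - x) / (2 * a)))

lemma twist_of_le {a : ℝ} (ha : 0 < a) (h : a ≤ x) : twist a x = 0 := by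
  rw [twist, max_eq_left]
  exact min_le_of_right_le (div_nonpos_of_nonpos_of_nonneg (by linarith) (by linarith))

lemma twist_of_le_neg {a : ℝ} (ha : 0 < a) (h : x ≤ -a) : twist a x = 1 := by
  rw [twist, min_eq_left, max_eq_right zero_le_one]
  rw [le_div_iff₀ (by linarith)]
  linarith

lemma continuous_twist (a : ℝ) : Continuous (twist a) := by unfold twist; fun_prop

/-- The parametrisation of the cylinder in the fibre over `z`. -/
def tw (a : ℝ) (z : ℂ) (x : ℝ) (v : Circle) : ℂ × ℂ :=
  upt z x (v * Circle.exp (Complex.arg z * twist a x))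

/-- The twist angle runs from 0 to arg z across |x| ≤ a and so absorbs the mismatch. The
parametrisation agrees with the trivialisation at both ends, and the fibre closes up to F. -/
lemma tw_eq_lft {a : ℝ} (ha : 0 < a) (hz : z ≠ 0) (hx : a ≤ |x|) (v : Circle) :
    tw a z x v = lft z x v := by
  unfold tw lft
  split_ifs with h
  · rw [abs_of_pos h] at hx
    rw [twist_of_le ha hx, mul_zero, Circle.exp_zero, mul_one]
  · rw [abs_of_nonpos (not_lt.1 h)] at hx
    rw [twist_of_le_neg ha (by linarith), mul_one, upt_mul_exp_arg hz]

lemma lft_eq_upt (hz : z ≠ 0) (v : Circle) :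
    lft z x v = upt z x (v * if 0 < x then 1 else Circle.exp (Complex.arg z)) := by
  unfold lft
  split_ifs with h
  · rw [mul_one]
  · rw [upt_mul_exp_arg hz]

variable {F : Type} [TopologicalSpace F] {lam δ d₀ : ℝ} {ι : CylinderEmbedding F lam}

open Classical in
/-- The identification of the surface with the fibre over `z`. -/
def fibMap (ι : CylinderEmbedding F lam) (h : IsAdm lam δ d₀) (a : ℝ) (z : ℂ) (q : F) :
    TotalSpace ι δ d₀ :=
  if q ∈ ι.U lam then eX ι h (tw a z (ι.inv q).1 (ι.inv q).2) else sX ι h (z, q)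

open Classical in
/-- The inverse of `fibMap`. -/
def fibInv (a : ℝ) (z : ℂ) (p : TotalSpace ι δ d₀) : F :=
  if a < xi p then theta p else
    ι.toFun (cw (winv p), dirU (winv p) *
      Circle.exp (-(Complex.arg z * twist a (cw (winv p)))))

variable (h : IsAdm lam δ d₀) {a : ℝ} (ha : 0 < a) (hac : a < lam - d₀) (hz0 : z ≠ 0)
  (hz : z ∈ Metric.closedBall (0 : ℂ) δ) {q : F} {v : Circle}

include hz0 hz in
lemma tw_mem (hx : |x| ≤ lam) : tw a z x v ∈ Wm lam δ ∧ cw (tw a z x v) = x ∧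
    (tw a z x v).1 * (tw a z x v).2 = z ∧ (tw a z x v).1 ≠ 0 := by
  have hp : 0 < amp ‖z‖ x := amp_pos (Or.inr (norm_pos_iff.2 hz0))
  refine ⟨⟨?_, ?_⟩, cw_upt _ hp, upt_mul _ hp, ?_⟩
  · rwa [tw, cw_upt _ hp]
  · rw [tw, upt_mul _ hp]; simpa using hz
  · rw [← norm_pos_iff, tw, norm_upt_fst]; exact hp

lemma fibMap_cyl (hx : |x| < lam) : fibMap ι h a z (ι.toFun (x, v)) = eX ι h (tw a z x v) := by
  unfold fibMap
  rw [if_pos ((ι.mem_U_iff le_rfl (t := (x, v)) hx.le).2 hx), ι.inv_apply (t := (x, v)) hx.le]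

include ha hac hz0 hz in
lemma fibMap_eq_psi (hq : q ∉ ι.U a) : fibMap ι h a z q = psi ι h (z, q) := by
  rcases mem_cases ι d₀ h.d₀_pos.le q with ⟨x, v, hx, rfl⟩ | ⟨hS, hU⟩
  · rw [ι.mem_U_iff (hac.le.trans h.c_lt.le) (t := (x, v)) hx.le, not_lt] at hq
    rw [fibMap_cyl h hx, tw_eq_lft ha hz0 hq, psi_cyl h hz hx.le]
  · rw [psi_complement h hz hS, fibMap, if_neg hU]

include ha in
lemma notMem_V_of_notMem_U (hq : q ∉ ι.U a) : q ∉ ι.vanishingCycle :=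
  fun h' => hq (ι.V_subset_U ha h')

include ha hac hz0 hz in
lemma fibMap_mem (q : F) : fibMap ι h a z q ∈ fibre ι δ d₀ z := by
  change proj ι δ d₀ _ = z
  by_cases hq : q ∈ ι.U a
  · obtain ⟨⟨x, v⟩, hx, rfl⟩ := hq
    have hx' : |x| < a := hx
    have hx2 : |x| < lam := hx'.trans (hac.trans h.c_lt)
    rw [fibMap_cyl h hx2, proj_eX h (tw_mem hz0 hz hx2.le).1]
    exact (tw_mem hz0 hz hx2.le).2.2.1
  · rw [fibMap_eq_psi h ha hac hz0 hz hq]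
    exact (psi_values h hz (notMem_V_of_notMem_U ha hq)).1

include ha hac hz0 hz in
lemma xi_fibMap_lt_iff {b : ℝ} (hb : b ≤ lam - d₀) :
    xi (fibMap ι h a z q) < b ↔ q ∈ ι.U b := by
  by_cases hq : q ∈ ι.U a
  · obtain ⟨⟨x, v⟩, hx, rfl⟩ := hq
    have hx' : |x| < a := hx
    have hx2 : |x| < lam := hx'.trans (hac.trans h.c_lt)
    rw [fibMap_cyl h hx2, xi_eX h (tw_mem hz0 hz hx2.le).1, (tw_mem hz0 hz hx2.le).2.1,
      ι.mem_U_iff (hb.trans h.c_lt.le) (t := (x, v)) hx2.le, min_lt_iff,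
      or_iff_left (not_lt.2 hb)]
  · rw [fibMap_eq_psi h ha hac hz0 hz hq, xi_psi_lt_iff h hz (notMem_V_of_notMem_U ha hq) hb]

include ha hac hz0 hz in
lemma fibInv_fibMap (q : F) : fibInv a z (fibMap ι h a z q) = q := by
  by_cases hq : q ∈ ι.K a
  · obtain ⟨⟨x, v⟩, hx, rfl⟩ := hq
    have hx' : |x| ≤ a := hx
    have hx2 : |x| < lam := hx'.trans_lt (hac.trans h.c_lt)
    obtain ⟨h1, h2, h3, h4⟩ := tw_mem (a := a) (v := v) hz0 hz hx2.le
    have hp : 0 < amp ‖z‖ x := amp_pos (Or.inr (norm_pos_iff.2 hz0))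
    rw [fibMap_cyl h hx2, fibInv, if_neg, winv_eX h h1 (by rw [h2]; linarith), h2, tw, dirU_upt _ hp,
      mul_assoc, ← Circle.exp_add, add_neg_cancel, Circle.exp_zero, mul_one]
    rw [xi_eX h h1, h2, not_lt]
    exact min_le_of_left_le hx'
  · have hqU : q ∉ ι.U a := fun h' => hq (ι.U_subset_K a h')
    have hqV := notMem_V_of_notMem_U ha hqU
    have : a < xi (psi ι h (z, q)) := by
      refine lt_of_le_of_ne (not_lt.1 fun h' => hqU ((xi_psi_lt_iff h hz hqV hac.le).1 h')) ?_
      intro he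
      rcases mem_cases ι d₀ h.d₀_pos.le q with ⟨x, v, hx, rfl⟩ | ⟨hS, hU⟩
      · have hx0 : x ≠ 0 := fun h0 => hqV ((ι.mem_V_iff h.lam_nonneg (t := (x, v)) hx.le).2 h0)
        rw [psi_cyl h hz hx.le, xi_eX h (lft_mem hz hx.le hx0), cw_lft v hx0] at he
        apply hq
        rw [ι.mem_K_iff (hac.le.trans h.c_lt.le) (t := (x, v)) hx.le]
        by_contra h'
        exact (lt_min (not_le.1 h') hac).ne he
      · rw [psi_complement h hz hS, xi_sX h hz hS] at he
        exact hac.ne he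
    rw [fibMap_eq_psi h ha hac hz0 hz hqU, fibInv, if_pos this]
    exact (psi_values h hz hqV).2.1

include hz0 in
lemma fst_ne_zero_of_mul {w : ℂ × ℂ} (hw : w.1 * w.2 = z) : w.1 ≠ 0 := fun h0 => hz0 (by
  rw [← hw, h0, zero_mul])

include hz0 in
lemma tw_dirU {w : ℂ × ℂ} (hw : w.1 * w.2 = z) :
    tw a z (cw w) (dirU w * Circle.exp (-(Complex.arg z * twist a (cw w)))) = w := by
  rw [tw, mul_assoc, ← Circle.exp_add, neg_add_cancel, Circle.exp_zero, mul_one]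
  have := upt_dirU (fst_ne_zero_of_mul hz0 hw)
  rwa [hw] at this

include ha hac hz0 hz in
lemma fibMap_fibInv {p : TotalSpace ι δ d₀} (hp : proj ι δ d₀ p = z) :
    fibMap ι h a z (fibInv a z p) = p := by
  by_cases hx : a < xi p
  · rw [fibInv, if_pos hx]
    obtain ⟨-, h2, h3⟩ := psi_proj_theta h (ha.trans hx)
    rw [hp] at h3
    rw [fibMap_eq_psi h ha hac hz0 hz, h3]
    rw [← xi_psi_lt_iff h hz h2 hac.le, h3]
    exact not_lt.2 hx.le
  · obtain ⟨w, hw, hc, rfl, hxi, hwi⟩ := exists_eX_of_xi_lt h ((not_lt.1 hx).trans_lt hac)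
    rw [proj_eX h hw] at hp
    rw [fibInv, if_neg hx, hwi, fibMap_cyl h (hc.trans h.c_lt), tw_dirU hz0 hp]

-- The two formulas for the inverse agree on the overlap a < ξ < lam - d₀, which gives continuity by
-- an open cover.
include h ha hz0 in
lemma fibInv_eq_of_xi_lt {p : TotalSpace ι δ d₀} (hp : proj ι δ d₀ p = z)
    (hx : xi p < lam - d₀) : fibInv a z p = ι.toFun (cw (winv p), dirU (winv p) *
      Circle.exp (-(Complex.arg z * twist a (cw (winv p))))) := by
  unfold fibInv
  split_ifs with hax
  · obtain ⟨w, hw, hc, rfl, hxi, hwi⟩ := exists_eX_of_xi_lt h hx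
    rw [proj_eX h hw] at hp
    have h1 := tw_dirU (a := a) hz0 hp
    rw [hxi] at hax
    rw [tw_eq_lft ha hz0 hax.le] at h1
    have h2 := dirC_lft (z := z) (dirU w * Circle.exp (-(Complex.arg z * twist a (cw w))))
      (abs_pos.1 (ha.trans hax))
    rw [h1] at h2
    rw [theta_eX h hw, hwi, h2]
  · rfl

include ha hac hz0 hz in
lemma continuous_fibMap [T2Space F] : Continuous (fibMap ι h a z) := by
  rw [← continuousOn_univ]
  refine continuousOn_of_cover (ι.isOpen_U le_rfl)
    (ι.isCompact_K (hac.le.trans h.c_lt.le)).isClosed.isOpen_compl ?_ ?_ ?_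
  · intro q _
    by_cases hq : q ∈ ι.K a
    · obtain ⟨t, ht, rfl⟩ := hq
      exact Or.inl ⟨t, lt_of_le_of_lt ht (hac.trans h.c_lt), rfl⟩
    · exact Or.inr hq
  · rw [Set.univ_inter]
    have h1 : ContinuousOn (fun q => tw a z (ι.inv q).1 (ι.inv q).2) (ι.U lam) := by
      have hi : ContinuousOn ι.inv (ι.U lam) := ι.continuousOn_inv.mono (ι.U_subset_K lam)
      have ht : Continuous fun t : ℝ × Circle =>
          (z, t.1, t.2 * Circle.exp (Complex.arg z * twist a t.1)) := by
        have := continuous_twist a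
        fun_prop
      exact continuousOn_upt.comp (ht.comp_continuousOn hi) fun q _ =>
        amp_pos (Or.inr (norm_pos_iff.2 hz0))
    refine ((eX_continuousOn h).comp h1 ?_).congr fun y hy => if_pos hy
    rintro _ ⟨t, ht, rfl⟩
    change tw a z (ι.inv (ι.toFun t)).1 (ι.inv (ι.toFun t)).2 ∈ _
    rw [ι.inv_apply (le_of_lt ht)]
    exact (tw_mem hz0 hz (le_of_lt ht)).1
  · rw [Set.univ_inter]
    refine ((psi_continuousOn (ι := ι) h).comp (f := fun q => (z, q)) (by fun_prop) ?_).congr ?_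
    · exact fun q hq => ⟨hz, notMem_V_of_notMem_U ha fun h' => hq (ι.U_subset_K a h')⟩
    · exact fun q hq => fibMap_eq_psi h ha hac hz0 hz fun h' => hq (ι.U_subset_K a h')

include h ha hac hz0 in
lemma continuousOn_fibInv : ContinuousOn (fibInv (ι := ι) (δ := δ) (d₀ := d₀) a z)
    (fibre ι δ d₀ z) := by
  refine continuousOn_of_cover (isOpen_lt continuous_const continuous_xi)
    (isOpen_lt continuous_xi continuous_const) (u := {p | a < xi p}) (v := {p | xi p < lam - d₀})
    ?_ ?_ ?_
  · exact fun p _ => (lt_or_ge a (xi p)).imp id fun h' => h'.trans_lt hac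
  · exact ((continuousOn_theta h).mono fun p hp => ha.trans hp.2).congr fun p hp => if_pos hp.2
  · refine ContinuousOn.congr (ι.continuousOn.comp (f := fun p => (cw (winv p), dirU (winv p) *
      Circle.exp (-(Complex.arg z * twist a (cw (winv p)))))) ?_ ?_)
      fun p hp => fibInv_eq_of_xi_lt h ha hz0 hp.1 hp.2
    · have hw : ContinuousOn (winv : TotalSpace ι δ d₀ → ℂ × ℂ)
          (fibre ι δ d₀ z ∩ {p | xi p < lam - d₀}) := continuousOn_winv.mono fun p hp => hp.2
      have h1 : ContinuousOn (fun p : TotalSpace ι δ d₀ => cw (winv p))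
          (fibre ι δ d₀ z ∩ {p | xi p < lam - d₀}) := continuous_cw.comp_continuousOn hw
      refine h1.prodMk (ContinuousOn.mul (continuousOn_dirU.comp hw ?_) ?_)
      · intro p hp
        obtain ⟨w, hw, hc, rfl, hxi, hwi⟩ := exists_eX_of_xi_lt h hp.2
        rw [hwi]
        exact fst_ne_zero_of_mul hz0 ((proj_eX h hw).symm.trans hp.1)
      · have ht : Continuous fun x : ℝ => Circle.exp (-(Complex.arg z * twist a x)) := by
          have := continuous_twist a
          fun_prop
        exact ht.comp_continuousOn h1
    · intro p hp
      obtain ⟨w, hw, hc, rfl, hxi, hwi⟩ := exists_eX_of_xi_lt h hp.2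
      change |cw (winv _)| ≤ lam
      rw [hwi]
      exact hw.1

/-- The surface is homeomorphic to the fibre over `z ≠ 0`. -/
def fibHomeo [T2Space F] : F ≃ₜ fibre ι δ d₀ z :=
  (Homeomorph.Set.univ F).symm.trans (homeoOn (fibMap ι h a z) (fibInv a z)
    (continuous_fibMap h ha hac hz0 hz).continuousOn (continuousOn_fibInv h ha hac hz0)
    (fun q _ => fibMap_mem h ha hac hz0 hz q) (fun _ _ => trivial)
    (fun q _ => fibInv_fibMap h ha hac hz0 hz q) (fun _ hp => fibMap_fibInv h ha hac hz0 hz hp))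

end Fibre

/-! ### Homology of the total space relative to the vanishing cycles -/

section TotalHomology

variable {F : Type} [TopologicalSpace F] {lam δ d₀ : ℝ} {ι : CylinderEmbedding F lam}
  {R : ModuleCat.{0} ℤ} {n : ℕ} (h : IsAdm lam δ d₀) {a b : ℝ} {z : ℂ}

/-- The part of the total space close to the vanishing cycles. -/
def nearV (ι : CylinderEmbedding F lam) (δ d₀ b : ℝ) : Set (TotalSpace ι δ d₀) := {p | xi p < b}

lemma isOpen_nearV : IsOpen (nearV ι δ d₀ b) := isOpen_lt continuous_xi continuous_const

-- Scaling by a real t multiplies both x and w₊w₋ by t², up to modulus, so the inequalities persist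
-- for t ≤ 1.
include h in
lemma starConvex_model {b : ℝ} (hb0 : 0 < b) :
    StarConvex ℝ 0 {w | w ∈ Wm lam δ ∧ |cw w| < b} ∧
      (0 : ℂ × ℂ) ∈ {w | w ∈ Wm lam δ ∧ |cw w| < b} := by
  refine ⟨starConvex_zero_iff.2 ?_, zero_mem_Wm h.lam_nonneg h.δ_pos.le, by simpa [cw] using hb0⟩
  rintro w ⟨⟨hw1, hw2⟩, hw3⟩ t ht0 ht1
  have ht : t ^ 2 ≤ 1 := pow_le_one₀ ht0 ht1
  have h3 : |cw (t • w)| ≤ |cw w| := by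
    rw [cw_smul, abs_mul, abs_of_nonneg (sq_nonneg t)]
    exact mul_le_of_le_one_left (abs_nonneg _) ht
  refine ⟨⟨h3.trans hw1, ?_⟩, h3.trans_lt hw3⟩
  rw [norm_mul_smul]
  exact (mul_le_of_le_one_left (norm_nonneg _) ht).trans hw2

include h in
lemma nearV_contractible (hb : b ≤ lam - d₀) (hb0 : 0 < b) :
    ContractibleSpace (nearV ι δ d₀ b) := by
  obtain ⟨h1, h2⟩ := starConvex_model (δ := δ) h hb0
  have hP : {w | w ∈ Wm lam δ ∧ |cw w| < b} ⊆ {w ∈ Wm lam δ | |cw w| < lam - d₀} :=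
    fun w hw => ⟨hw.1, hw.2.trans_le hb⟩
  have := h1.contractibleSpace ⟨_, h2⟩
  have e : {p : TotalSpace ι δ d₀ | xi p < lam - d₀ ∧ winv p ∈ {w | w ∈ Wm lam δ ∧ |cw w| < b}} =
      nearV ι δ d₀ b := by
    ext p
    constructor
    · rintro ⟨hp, hp2⟩
      obtain ⟨w, hw, hc, rfl, hxi, hwi⟩ := exists_eX_of_xi_lt h hp
      rw [hwi] at hp2
      exact hxi.trans_lt hp2.2
    · intro hp
      have hp' : xi p < lam - d₀ := lt_of_lt_of_le hp hb
      obtain ⟨w, hw, hc, rfl, hxi, hwi⟩ := exists_eX_of_xi_lt h hp'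
      refine ⟨hp', ?_⟩
      rw [hwi]
      exact ⟨hw, hxi.symm.trans_lt hp⟩
  rw [← e]
  exact (modelHomeo ι h _ hP).symm.contractibleSpace

variable [T2Space F]

-- The space is the union of the image of the star-shaped model and of D × (F ∖ V), which share a
-- point with x = lam - d₀.
include h in
lemma pathConnected_total [PathConnectedSpace (ι.vanishingCycleᶜ : Set F)] :
    PathConnectedSpace (TotalSpace ι δ d₀) := by
  have h1 : IsPathConnected (eX ι h '' Wm lam δ) := by
    have hs : StarConvex ℝ 0 (Wm lam δ) := by
      refine starConvex_zero_iff.2 ?_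
      rintro w ⟨hw1, hw2⟩ t ht0 ht1
      have ht : t ^ 2 ≤ 1 := pow_le_one₀ ht0 ht1
      refine ⟨?_, ?_⟩
      · rw [cw_smul, abs_mul, abs_of_nonneg (sq_nonneg t)]
        exact (mul_le_of_le_one_left (abs_nonneg _) ht).trans hw1
      · rw [norm_mul_smul]
        exact (mul_le_of_le_one_left (norm_nonneg _) ht).trans hw2
    exact (hs.isPathConnected (zero_mem_Wm h.lam_nonneg h.δ_pos.le)).image' (eX_continuousOn h)
  have : PathConnectedSpace (Metric.closedBall (0 : ℂ) δ) :=
    isPathConnected_iff_pathConnectedSpace.1 ((convex_closedBall _ _).isPathConnected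
      ⟨0, Metric.mem_closedBall_self h.δ_pos.le⟩)
  have h2 : IsPathConnected (Set.range (trivMap ι h)) := isPathConnected_range (trivMap ι h).continuous
  have hu : (Set.univ : Set (TotalSpace ι δ d₀)) = eX ι h '' Wm lam δ ∪ Set.range (trivMap ι h) := by
    refine (Set.eq_univ_of_forall fun p => ?_).symm
    rcases exists_rep h p with ⟨w, hw, rfl⟩ | ⟨z, hz, q, hq, rfl⟩
    · exact Or.inl ⟨w, hw, rfl⟩
    · right
      rw [range_trivMap]
      change 0 < xi _
      rw [xi_sX h hz hq]
      exact h.c_pos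
  rw [pathConnectedSpace_iff_univ, hu]
  refine h1.union h2 ?_
  have hc : |lam - d₀| ≤ lam := by
    rw [abs_of_pos h.c_pos]; exact h.c_lt.le
  have hw := lft_mem (lam := lam) (x := lam - d₀) (v := 1)
    (Metric.mem_closedBall_self h.δ_pos.le) hc h.c_pos.ne'
  refine ⟨_, ⟨_, hw, rfl⟩, ?_⟩
  rw [range_trivMap]
  change 0 < xi _
  rw [xi_eX h hw, cw_lft _ h.c_pos.ne']
  exact lt_min (abs_pos.2 h.c_pos.ne') h.c_pos

/-- The slice of the trivial part over `z`. -/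
def sliceMap (ι : CylinderEmbedding F lam) (z : Metric.closedBall (0 : ℂ) δ) :
    C((ι.vanishingCycleᶜ : Set F), Metric.closedBall (0 : ℂ) δ × (ι.vanishingCycleᶜ : Set F)) :=
  ⟨fun q => (z, q), by fun_prop⟩

omit [T2Space F] in
lemma Hmap_slice_bijective (z : Metric.closedBall (0 : ℂ) δ) (B : Set (ι.vanishingCycleᶜ : Set F)) :
    Function.Bijective (Hmap R n (sliceMap ι z) (A := B) (B := Prod.snd ⁻¹' B) (fun _ hq => hq)) := by
  refine Hmap_bijective_of_homotopyEquiv (sliceMap ι z) ContinuousMap.snd _ (fun _ hq => hq)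
    (ContinuousMap.Homotopy.refl _) (fun _ _ hq => hq)
    { toFun := fun p => (⟨(1 - (p.1 : ℝ)) • (z : ℂ) + (p.1 : ℝ) • (p.2.1 : ℂ),
        (convex_closedBall (0 : ℂ) δ) z.2 p.2.1.2 (sub_nonneg.2 p.1.2.2) p.1.2.1 (by ring)⟩, p.2.2)
      continuous_toFun := by fun_prop
      map_zero_left := fun x => by ext <;> simp [sliceMap]
      map_one_left := fun x => by ext <;> simp } (fun _ _ hq => hq)

lemma slice_mapsTo (z : Metric.closedBall (0 : ℂ) δ) (hb : b ≤ lam - d₀) :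
    Set.MapsTo ((trivMap ι h).comp (sliceMap ι z)) (Subtype.val ⁻¹' ι.U b) (nearV ι δ d₀ b) :=
  fun q hq => (xi_psi_lt_iff h z.2 q.2 hb).2 hq

/-- The locus ξ = 0 lies inside `nearV` and is excised, leaving the product D × (F ∖ V), whose disk
factor contracts to z. -/
lemma Hmap_triv_slice_bijective (z : Metric.closedBall (0 : ℂ) δ) (hb : b ≤ lam - d₀)
    (hb0 : 0 < b) : Function.Bijective (Hmap R n _ (slice_mapsTo (ι := ι) h z hb)) := by
  have h1 := Hmap_slice_bijective (R := R) (n := n) z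
    (Subtype.val ⁻¹' ι.U b : Set (ι.vanishingCycleᶜ : Set F))
  have hm : Set.MapsTo (trivMap ι h) (Prod.snd ⁻¹' (Subtype.val ⁻¹' ι.U b)) (nearV ι δ d₀ b) :=
    fun y hy => (xi_psi_lt_iff h y.1.2 y.2.2 hb).2 hy
  have h2 := Hmap_excision (R := R) (n := n) (f := trivMap ι h) (A := nearV ι δ d₀ b)
    (B := Prod.snd ⁻¹' (Subtype.val ⁻¹' ι.U b)) (trivMap_isOpenEmbedding h) isOpen_nearV (by
      rw [range_trivMap]
      exact Set.eq_univ_of_forall fun p => (lt_or_ge 0 (xi p)).imp id fun h' => lt_of_le_of_lt h' hb0)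
    (by
      ext y
      exact (xi_psi_lt_iff h y.1.2 y.2.2 hb).symm) hm
  have h3 : ⇑(Hmap R n _ (slice_mapsTo (ι := ι) h z hb)) = Hmap R n _ hm ∘ Hmap R n (sliceMap ι z)
      (A := Subtype.val ⁻¹' ι.U b) (B := Prod.snd ⁻¹' (Subtype.val ⁻¹' ι.U b)) (fun _ hq => hq) :=
    funext fun x => (Hmap_comp (sliceMap ι z) (trivMap ι h) _ hm x).symm
  rw [h3]
  exact h2.comp h1

/-- The identification of the surface with a fibre as a map into the total space. -/
def fibC (ι : CylinderEmbedding F lam) (h : IsAdm lam δ d₀) (ha : 0 < a) (hac : a < lam - d₀)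
    (hz0 : z ≠ 0) (hz : z ∈ Metric.closedBall (0 : ℂ) δ) : C(F, TotalSpace ι δ d₀) :=
  ⟨fibMap ι h a z, continuous_fibMap h ha hac hz0 hz⟩

variable (ha : 0 < a) (hac : a < lam - d₀) (hz0 : z ≠ 0) (hz : z ∈ Metric.closedBall (0 : ℂ) δ)

lemma fibC_mapsTo (hb : b ≤ lam - d₀) :
    Set.MapsTo (fibC ι h ha hac hz0 hz) (ι.U b) (nearV ι δ d₀ b) :=
  fun _ hq => (xi_fibMap_lt_iff h ha hac hz0 hz hb).2 hq

/-- The fibre pair has the homology of the total pair. -/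
theorem Hmap_fibC_bijective (hab : a < b) (hb : b ≤ lam - d₀) :
    Function.Bijective (Hmap R n _ (fibC_mapsTo (ι := ι) h ha hac hz0 hz hb)) := by
  have hbl : b ≤ lam := hb.trans h.c_lt.le
  have hKo : IsOpen (ι.K a)ᶜ := (ι.isCompact_K (hab.le.trans hbl)).isClosed.isOpen_compl
  have hVK : (ι.K a)ᶜ ⊆ ι.vanishingCycleᶜ := by
    rw [Set.compl_subset_compl, ι.vanishingCycle_eq]
    exact ι.K_mono ha.le
  have hKU : ι.K a ⊆ ι.U b := Set.image_mono fun q (hq : |q.1| ≤ a) => lt_of_le_of_lt hq hab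
  let j : C(((ι.K a)ᶜ : Set F), (ι.vanishingCycleᶜ : Set F)) := ⟨Set.inclusion hVK, by fun_prop⟩
  have hj : IsOpenEmbedding j := IsOpenEmbedding.of_comp j
    ((ι.isClosed_V h.lam_nonneg).isOpen_compl.isOpenEmbedding_subtypeVal)
    hKo.isOpenEmbedding_subtypeVal
  have hjm : Set.MapsTo j (Subtype.val ⁻¹' ι.U b) (Subtype.val ⁻¹' ι.U b) := fun _ hq => hq
  have h1 := Hmap_excision (R := R) (n := n) hj ((ι.isOpen_U hbl).preimage continuous_subtype_val)
    (Set.eq_univ_of_forall fun q => (em ((q : F) ∈ ι.K a)).symm.imp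
      (fun hq => ⟨⟨q, hq⟩, rfl⟩) (fun hq => hKU hq)) rfl hjm
  have hm : Set.MapsTo (subIncl (ι.K a)ᶜ) (Subtype.val ⁻¹' ι.U b) (ι.U b) := fun _ hq => hq
  have h2 := Hmap_excision (R := R) (n := n) (f := subIncl (ι.K a)ᶜ) hKo.isOpenEmbedding_subtypeVal
    (ι.isOpen_U hbl) (Set.eq_univ_of_forall fun q => (em (q ∈ ι.K a)).symm.imp
      (fun hq => ⟨⟨q, hq⟩, rfl⟩) (fun hq => hKU hq)) rfl hm
  refine (Function.Bijective.of_comp_iff _ h2).1 ?_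
  -- Off the twisted cylinder the fibre embedding is the slice of the trivialisation. That cylinder
  -- lies in U b, so excising it from F lets the two maps be compared.
  have e : (fibC ι h ha hac hz0 hz).comp (subIncl (ι.K a)ᶜ) =
      ((trivMap ι h).comp (sliceMap ι ⟨z, hz⟩)).comp j := by
    ext q
    exact fibMap_eq_psi h ha hac hz0 hz fun hq => q.2 (ι.U_subset_K a hq)
  have h3 : Hmap R n _ (fibC_mapsTo (ι := ι) h ha hac hz0 hz hb) ∘ Hmap R n (subIncl (ι.K a)ᶜ) hm =
      Hmap R n _ (slice_mapsTo (ι := ι) h ⟨z, hz⟩ hb) ∘ Hmap R n j hjm :=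
    funext fun x => Hmap_comm e hm (fibC_mapsTo (ι := ι) h ha hac hz0 hz hb) hjm
      (slice_mapsTo (ι := ι) h ⟨z, hz⟩ hb) x
  rw [h3]
  exact (Hmap_triv_slice_bijective h ⟨z, hz⟩ hb (ha.trans hab)).comp h1

/-- The cylinder deforms to the vanishing cycle. -/
theorem Hres_V_bijective (hb0 : 0 < b) (hb : b ≤ lam) :
    Function.Bijective (Hres (R := R) (n := n) (ι.V_subset_U hb0)) := by
  have hK : ∀ q : ι.U b, (q : F) ∈ ι.K lam := fun q => ι.K_mono hb (ι.U_subset_K b q.2)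
  have hx : ∀ q : ι.U b, |(ι.inv q).1| < b := by
    rintro ⟨_, ⟨t, ht, rfl⟩⟩
    rw [ι.inv_apply ((le_of_lt ht).trans hb)]
    exact ht
  have hx' : ∀ (t : unitInterval) (q : ι.U b), |(1 - (t : ℝ)) * (ι.inv q).1| < b := fun t q => by
    rw [abs_mul, abs_of_nonneg (sub_nonneg.2 t.2.2)]
    exact (mul_le_of_le_one_left (abs_nonneg _) (by linarith [t.2.1])).trans_lt (hx q)
  have hinv : Continuous fun q : ι.U b => ι.inv q :=
    ι.continuousOn_inv.comp_continuous continuous_subtype_val hK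
  let r : C(unitInterval × ι.U b, ι.U b) :=
    ⟨fun p => ⟨ι.toFun ((1 - (p.1 : ℝ)) * (ι.inv p.2).1, (ι.inv p.2).2), _, hx' p.1 p.2, rfl⟩, by
      refine Continuous.subtype_mk (ι.continuousOn.comp_continuous ?_ fun p =>
        ((hx' p.1 p.2).trans_le hb).le) _
      have hinv2 : Continuous fun p : unitInterval × ι.U b => ι.inv p.2 := hinv.comp continuous_snd
      exact ((continuous_const.sub (continuous_subtype_val.comp continuous_fst)).mul
        (continuous_fst.comp hinv2)).prodMk (continuous_snd.comp hinv2)⟩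
  refine Hres_bijective_of_deformation _ r (fun q => ?_) (fun q => ?_) (fun t q hq => ?_)
  · ext
    change ι.toFun ((1 - ((0 : unitInterval) : ℝ)) * (ι.inv q).1, (ι.inv q).2) = q
    rw [Set.Icc.coe_zero, sub_zero, one_mul]
    exact (ι.inv_mem (hK q)).2
  · refine ⟨_, ?_, rfl⟩
    change (1 - ((1 : unitInterval) : ℝ)) * (ι.inv q).1 = 0
    simp
  · refine ⟨_, ?_, rfl⟩
    change (1 - (t : ℝ)) * (ι.inv q).1 = 0
    obtain ⟨s, hs, hsq⟩ := hq
    have hs0 : s.1 = 0 := hs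
    rw [← hsq, ι.inv_apply (by rw [hs0, abs_zero]; exact hb0.le.trans hb), hs0, mul_zero]

/-- The vanishing cycle has the homology of a circle. -/
theorem Ha_one_V_equiv (hlam : 0 ≤ lam) : Nonempty (Ha R 1 ι.vanishingCycle ≃ₗ[ℤ] R) := by
  have h0 : ∀ v : Circle, ((0 : ℝ), v) ∈ {q : ℝ × Circle | |q.1| ≤ lam} := fun v => by
    simpa using hlam
  let f : C(({0}ᶜ : Set ℂ), ι.vanishingCycle) :=
    ⟨fun w => ⟨ι.toFun (0, dirU (w, 0)), _, rfl, rfl⟩, by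
      refine Continuous.subtype_mk (ι.continuousOn.comp_continuous
        (continuous_const.prodMk ?_) fun w => h0 _) _
      exact continuousOn_dirU.comp_continuous (by fun_prop) fun w => w.2⟩
  let g : C(ι.vanishingCycle, ({0}ᶜ : Set ℂ)) :=
    ⟨fun q => ⟨(ι.inv q).2, Circle.coe_ne_zero _⟩, by
      refine Continuous.subtype_mk ?_ _
      have : Continuous fun q : ι.vanishingCycle => ι.inv q :=
        ι.continuousOn_inv.comp_continuous continuous_subtype_val fun q =>
          ι.K_mono hlam (ι.vanishingCycle_eq.le q.2)
      exact continuous_subtype_val.comp (continuous_snd.comp this)⟩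
  have hne : ∀ (t : unitInterval) (w : ({0}ᶜ : Set ℂ)),
      0 < (1 - (t : ℝ)) * ‖(w : ℂ)‖⁻¹ + t := fun t w => by
    have hw : 0 < ‖(w : ℂ)‖⁻¹ := inv_pos.2 (norm_pos_iff.2 w.2)
    rcases t.2.1.eq_or_lt with ht | ht
    · rw [← ht, sub_zero, one_mul, add_zero]; exact hw
    · have := mul_nonneg (sub_nonneg.2 t.2.2) hw.le
      linarith
  have hfg : ∀ w : ({0}ᶜ : Set ℂ), ((g (f w) : ({0}ᶜ : Set ℂ)) : ℂ) = w / ‖(w : ℂ)‖ := fun w => by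
    change ((ι.inv (ι.toFun (0, dirU (w, 0)))).2 : ℂ) = _
    rw [ι.inv_apply (h0 _)]
    exact coe_dirU (w := (w, 0)) w.2
  have hb := Hmap_bijective_of_homotopyEquiv (R := R) (n := 1) f g (A := ∅) (B := ∅)
    (fun _ h => h) (fun _ h => h)
    { toFun := fun p => ⟨(((1 - (p.1 : ℝ)) * ‖(p.2 : ℂ)‖⁻¹ + p.1 : ℝ) : ℂ) * p.2,
        mul_ne_zero (by exact_mod_cast (hne p.1 p.2).ne') p.2.2⟩
      continuous_toFun := by
        refine Continuous.subtype_mk (Continuous.mul (Complex.continuous_ofReal.comp ?_)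
          (by fun_prop)) _
        refine Continuous.add (Continuous.mul (by fun_prop) ?_) (by fun_prop)
        exact Continuous.inv₀ (by fun_prop) fun p => (norm_pos_iff.2 p.2.2).ne'
      map_zero_left := fun w => by
        ext1
        rw [ContinuousMap.comp_apply, hfg]
        simp [div_eq_inv_mul]
      map_one_left := fun w => by ext1; simp } (fun _ _ h => h.elim)
    ((ContinuousMap.Homotopy.refl _).cast rfl (by
      refine ContinuousMap.ext fun q => Subtype.ext ?_
      obtain ⟨_, ⟨⟨x, v⟩, hx, rfl⟩⟩ := q
      obtain rfl : x = 0 := hx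
      change ι.toFun (0, dirU (((ι.inv (ι.toFun (0, v))).2 : ℂ), 0)) = ι.toFun (0, v)
      rw [ι.inv_apply (h0 _)]
      congr 2
      ext
      rw [coe_dirU (Circle.coe_ne_zero _)]
      simp [Circle.norm_coe])) (fun _ _ h => h.elim)
  exact ⟨(LinearEquiv.ofBijective _ (toRel_empty_bijective R 1)).trans
    ((LinearEquiv.ofBijective _ hb).symm.trans (Hr_one_punctured_plane R rfl).some)⟩

omit [T2Space F] in
lemma pathConnectedSpace_V (hlam : 0 ≤ lam) : PathConnectedSpace ι.vanishingCycle := by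
  let f : ℝ → ι.vanishingCycle := fun s => ⟨ι.toFun (0, Circle.exp s), _, rfl, rfl⟩
  have hf : Continuous f := Continuous.subtype_mk (ι.continuousOn.comp_continuous
    (by fun_prop) fun s => by simpa using hlam) _
  have hs : Function.Surjective f := by
    rintro ⟨_, ⟨⟨x, v⟩, hx, rfl⟩⟩
    obtain rfl : x = 0 := hx
    exact ⟨Complex.arg v, Subtype.ext (congrArg (fun v => ι.toFun (0, v)) (Circle.exp_arg v))⟩
  exact hs.pathConnectedSpace hf

end TotalHomology

/-! ### The fibre class and the first homology -/

section FibreClass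

variable {F : Type} [TopologicalSpace F] [T2Space F] [CompactSpace F] [ConnectedSpace F]
  {lam δ d₀ : ℝ} {ι : CylinderEmbedding F lam} (h : IsAdm lam δ d₀) (hM : HasPlaneCharts F)
  (ho : IsOrientable 2 F) (hVc : IsConnected ι.vanishingCycleᶜ)
  [PathConnectedSpace (ι.vanishingCycleᶜ : Set F)]
  {a b : ℝ} {z : ℂ} (ha : 0 < a) (hab : a < b) (hb : b < lam - d₀) (hz0 : z ≠ 0)
  (hz : z ∈ Metric.closedBall (0 : ℂ) δ)

omit [CompactSpace F] [ConnectedSpace F] in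
include h ha hab hb in
lemma Hres_two_nearV_bijective : Function.Bijective
    (Hres (R := Zc) (n := 2) (Set.empty_subset (nearV ι δ d₀ b))) := by
  have := nearV_contractible (ι := ι) h hb.le (ha.trans hab)
  have := pathConnected_total (ι := ι) h
  exact Hres_bijective_of_contractible

omit [PathConnectedSpace (ι.vanishingCycleᶜ : Set F)] in
include hM ho hVc in
lemma Hres_two_U_bijective (hb0 : 0 < b) (hbl : b ≤ lam) : Function.Bijective
    (Hres (R := Zc) (n := 2) (Set.empty_subset (ι.U b))) := by
  have h1 := Hres_V_bijective (ι := ι) (R := Zc) (n := 2) hb0 hbl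
  have h2 := Hres_two_bijective (R := Zc) hM (resPt_surjective_of_orientable hM ho)
    (ι.isClosed_V (hb0.le.trans hbl)) hVc (ι.isOpen_U hbl) (ι.V_subset_U hb0) h1.1
  have e : ⇑(Hres (R := Zc) (n := 2) (Set.empty_subset (ι.U b))) =
      Hres (ι.V_subset_U hb0) ∘ Hres (Set.empty_subset ι.vanishingCycle) :=
    funext fun x => (Hres_Hres _ _ x).symm
  rw [e]
  exact h1.comp h2

include hM ho hVc hab hb in
/-- The fibre carries the second homology of the total space. -/
theorem Hmap_fibC_empty_bijective : Function.Bijective (Hmap Zc 2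
    (fibC ι h ha (hab.trans hb) hz0 hz) (A := ∅) (B := ∅) (Set.mapsTo_empty _ _)) := by
  have h1 := Hres_two_nearV_bijective (ι := ι) h ha hab hb
  have h2 := Hres_two_U_bijective hM ho hVc (ha.trans hab) (hb.le.trans h.c_lt.le)
  have h3 := Hmap_fibC_bijective (ι := ι) (R := Zc) (n := 2) h ha (hab.trans hb) hz0 hz hab hb.le
  -- It suffices to check the map after passing to the pairs (F, U) and (X, nearV), where the fibre
  -- embedding is already known to be bijective.
  refine (Function.Bijective.of_comp_iff' h1 _).1 ?_
  have e : Hres (R := Zc) (n := 2) (Set.empty_subset (nearV ι δ d₀ b)) ∘ Hmap Zc 2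
      (fibC ι h ha (hab.trans hb) hz0 hz) (A := ∅) (B := ∅) (Set.mapsTo_empty _ _) =
      Hmap Zc 2 _ (fibC_mapsTo (ι := ι) h ha (hab.trans hb) hz0 hz hb.le) ∘
        Hres (Set.empty_subset (ι.U b)) :=
    funext fun x => (Hmap_Hres _ _ _ _ _ x).symm
  rw [e]
  exact h3.comp h2

include h hM ho hVc ha hab hb hz0 hz in
/-- The inclusion of a fibre induces an isomorphism on second homology. -/
theorem pushforward_fibre_bijective : Function.Bijective (pushforward 2 (fibre ι δ d₀ z)) := by
  have h1 := Hmap_fibC_empty_bijective h hM ho hVc ha hab hb hz0 hz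
  let e := fibHomeo (ι := ι) h ha (hab.trans hb) hz0 hz
  have h2 := Hmap_homeomorph_bijective (R := Zc) (n := 2) e (A := ∅) (B := ∅) (fun _ => Iff.rfl)
  have h3 : Function.Bijective (Hmap Zc 2 (subIncl (fibre ι δ d₀ z)) (A := ∅) (B := ∅)
      (Set.mapsTo_empty _ _)) := by
    refine (Function.Bijective.of_comp_iff _ h2).1 ?_
    have he : Hmap Zc 2 (subIncl (fibre ι δ d₀ z)) (A := ∅) (B := ∅) (Set.mapsTo_empty _ _) ∘
        Hmap Zc 2 (e : C(F, fibre ι δ d₀ z)) (A := ∅) (B := ∅) (Set.mapsTo_empty _ _) =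
        Hmap Zc 2 (fibC ι h ha (hab.trans hb) hz0 hz) (A := ∅) (B := ∅) (Set.mapsTo_empty _ _) :=
      funext fun x => Hmap_comp_eq (f := (e : C(F, fibre ι δ d₀ z)))
        (g := subIncl (fibre ι δ d₀ z)) rfl _ _ _ x
    exact he ▸ h1
  refine (Function.Bijective.of_comp_iff' (toRel_empty_bijective Zc 2) _).1 ?_
  have he : toRel Zc 2 (∅ : Set (TotalSpace ι δ d₀)) ∘ pushforward 2 (fibre ι δ d₀ z) =
      Hmap Zc 2 (subIncl (fibre ι δ d₀ z)) (A := ∅) (B := ∅) (Set.mapsTo_empty _ _) ∘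
        toRel Zc 2 ∅ :=
    funext fun x => toRel_map (R := Zc) (subIncl (fibre ι δ d₀ z)) (Set.mapsTo_empty _ _) x
  rw [he]
  exact h3.comp (toRel_empty_bijective Zc 2)

include h hM ho hVc ha hab hb hz0 hz in
theorem H_two_total_equiv : Nonempty (H 2 (TotalSpace ι δ d₀) ≃+ ℤ) := by
  have h1 := Hmap_fibC_empty_bijective h hM ho hVc ha hab hb hz0 hz
  obtain ⟨e⟩ := Hr_two_equiv hM ho
  exact ⟨((LinearEquiv.ofBijective _ (toRel_empty_bijective Zc 2
    (X := TotalSpace ι δ d₀))).trans ((LinearEquiv.ofBijective _ h1).symm.trans e)).toAddEquiv⟩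

include h hM ho hVc ha hab hb in
theorem H_one_total_equiv [PathConnectedSpace F] {m : ℕ} (eF : H 1 F ≃+ (Fin m → ℤ)) :
    Nonempty (H 1 (TotalSpace ι δ d₀) ≃+ (Fin (m - 1) → ℤ)) := by
  have hb0 : 0 < b := ha.trans hab
  have hbl : b ≤ lam := hb.le.trans h.c_lt.le
  have := nearV_contractible (ι := ι) h hb.le hb0
  have := pathConnected_total (ι := ι) h
  have := pathConnectedSpace_V (ι := ι) h.lam_nonneg
  have h1 : Function.Bijective (Hres (R := Zc) (n := 1) (Set.empty_subset (nearV ι δ d₀ b))) :=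
    Hres_bijective_of_contractible
  have hδ : (δ : ℂ) ∈ Metric.closedBall (0 : ℂ) δ := by
    simp [abs_of_pos h.δ_pos]
  have h2 := Hmap_fibC_bijective (ι := ι) (R := Zc) (n := 1) h ha (hab.trans hb)
    (by exact_mod_cast h.δ_pos.ne') hδ hab hb.le
  have h3 := Hres_V_bijective (ι := ι) (R := Zc) (n := 1) hb0 hbl
  obtain ⟨eV⟩ := Ha_one_V_equiv (ι := ι) (R := Zc) h.lam_nonneg
  obtain ⟨e⟩ := Hr_one_curve_equiv hM ho (ι.isClosed_V h.lam_nonneg) hVc (ι.isOpen_U hbl)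
    (ι.V_subset_U hb0) (fun R => (Hres_V_bijective (ι := ι) (R := R) (n := 2) hb0 hbl).1) eV eF
  exact ⟨((LinearEquiv.ofBijective _ (toRel_empty_bijective Zc 1
    (X := TotalSpace ι δ d₀))).trans ((LinearEquiv.ofBijective _ h1).trans
      ((LinearEquiv.ofBijective _ h2).symm.trans
        (LinearEquiv.ofBijective _ h3).symm))).toAddEquiv.trans e⟩

end FibreClass

lemma IsGenerator.map_of_surjective {M N : Type} [AddCommGroup M] [AddCommGroup N] {c : M}
    (hc : IsGenerator c) (f : M →+ N) (hf : Function.Surjective f) : IsGenerator (f c) := by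
  unfold IsGenerator at hc ⊢
  rw [← AddMonoidHom.map_zmultiples, hc, ← AddMonoidHom.range_eq_map]
  exact AddMonoidHom.range_eq_top.2 hf

/-! ### Homology relative to the boundary -/

section Boundary

/-- The radial flow of the punctured disk to its boundary. -/
def radial (δ t : ℝ) (z : ℂ) : ℂ := ((1 - t + t * (δ / ‖z‖) : ℝ) : ℂ) * z

section Radial

variable {δ t : ℝ} {z : ℂ}

lemma radial_factor_pos (hδ : 0 < δ) (ht : t ∈ Set.Icc (0 : ℝ) 1) (hz : z ≠ 0) :
    0 < 1 - t + t * (δ / ‖z‖) := by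
  have h1 : 0 < δ / ‖z‖ := div_pos hδ (norm_pos_iff.2 hz)
  rcases ht.1.eq_or_lt with h0 | h0
  · rw [← h0]; norm_num
  · have := mul_pos h0 h1
    linarith [ht.2]

lemma norm_radial (hδ : 0 < δ) (ht : t ∈ Set.Icc (0 : ℝ) 1) (hz : z ≠ 0) :
    ‖radial δ t z‖ = (1 - t) * ‖z‖ + t * δ := by
  have h1 : ‖z‖ ≠ 0 := norm_ne_zero_iff.2 hz
  rw [radial, norm_mul, Complex.norm_real, Real.norm_of_nonneg (radial_factor_pos hδ ht hz).le]
  field_simp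

lemma radial_ne_zero (hδ : 0 < δ) (ht : t ∈ Set.Icc (0 : ℝ) 1) (hz : z ≠ 0) :
    radial δ t z ≠ 0 :=
  mul_ne_zero (by exact_mod_cast (radial_factor_pos hδ ht hz).ne') hz

lemma arg_radial (hδ : 0 < δ) (ht : t ∈ Set.Icc (0 : ℝ) 1) (hz : z ≠ 0) :
    Complex.arg (radial δ t z) = Complex.arg z :=
  Complex.arg_real_mul z (radial_factor_pos hδ ht hz)

lemma radial_mem (hδ : 0 < δ) (ht : t ∈ Set.Icc (0 : ℝ) 1) (hz : z ≠ 0) (hz' : ‖z‖ ≤ δ) :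
    radial δ t z ∈ Metric.closedBall (0 : ℂ) δ := by
  rw [mem_closedBall_zero_iff, norm_radial hδ ht hz]
  nlinarith [ht.1, ht.2]

lemma radial_zero (z : ℂ) : radial δ 0 z = z := by simp [radial]

lemma continuousOn_radial :
    ContinuousOn (fun p : ℝ × ℂ => radial δ p.1 p.2) {p | p.2 ≠ 0} := by
  unfold radial
  refine ContinuousOn.mul (Complex.continuous_ofReal.comp_continuousOn ?_) (by fun_prop)
  refine ContinuousOn.add (by fun_prop) (ContinuousOn.mul (by fun_prop) ?_)
  exact ContinuousOn.div (by fun_prop) (by fun_prop) fun p hp => norm_ne_zero_iff.2 hp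

/-- The directions used by `lft` and by `upt` differ by a rotation depending only on the sign of x
and on arg z. Hence keeping the one fixed or the other is the same as long as arg z does not change,
as along a radial path. -/
lemma lft_eq_upt_dirU {z' : ℂ} {w : ℂ × ℂ} (hw : w.1 * w.2 ≠ 0) (hc : cw w ≠ 0) (hz' : z' ≠ 0)
    (ha : Complex.arg z' = Complex.arg (w.1 * w.2)) :
    lft z' (cw w) (dirC w) = upt z' (cw w) (dirU w) := by
  have h1 := lft_eq_self hc
  rw [lft_eq_upt hw] at h1
  have h2 := dirU_upt (z := w.1 * w.2) (x := cw w)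
    (dirC w * if 0 < cw w then 1 else Circle.exp (Complex.arg (w.1 * w.2)))
    (amp_pos (Or.inr (norm_pos_iff.2 hw)))
  rw [h1] at h2
  rw [lft_eq_upt hz', ha, ← h2]

end Radial

variable {F : Type} [TopologicalSpace F] {lam δ d₀ : ℝ} {ι : CylinderEmbedding F lam}
  {R : ModuleCat.{0} ℤ} {n : ℕ}

open Classical in
/-- The lift of the radial flow to the total space. -/
def flow (ι : CylinderEmbedding F lam) (h : IsAdm lam δ d₀) (y : ℝ × TotalSpace ι δ d₀) :
    TotalSpace ι δ d₀ :=
  if 0 < xi y.2 then psi ι h (radial δ y.1 (proj ι δ d₀ y.2), theta y.2) else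
    eX ι h (upt (radial δ y.1 (proj ι δ d₀ y.2)) (cw (winv y.2)) (dirU (winv y.2)))

variable (ι) in
/-- The complement of the singular fibre. -/
def offZero (δ d₀ : ℝ) : Set (TotalSpace ι δ d₀) := {p | proj ι δ d₀ p ≠ 0}

variable (h : IsAdm lam δ d₀) {t : ℝ} {p : TotalSpace ι δ d₀}

/-- Near the vanishing cycles the flow keeps x and the direction of w₊. This formula makes sense
across x = 0, where the trivialisation is undefined. -/
lemma flow_eq_of_xi_lt (ht : t ∈ Set.Icc (0 : ℝ) 1) (hp : proj ι δ d₀ p ≠ 0)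
    (hx : xi p < lam - d₀) : flow ι h (t, p) =
      eX ι h (upt (radial δ t (proj ι δ d₀ p)) (cw (winv p)) (dirU (winv p))) ∧
      upt (radial δ t (proj ι δ d₀ p)) (cw (winv p)) (dirU (winv p)) ∈ Wm lam δ ∧
      (winv p).1 ≠ 0 := by
  obtain ⟨w, hw, hc, rfl, hxi, hwi⟩ := exists_eX_of_xi_lt h hx
  have hm := radial_mem h.δ_pos ht hp (proj_mem h _)
  have hr := radial_ne_zero h.δ_pos ht hp
  have har := arg_radial h.δ_pos ht hp
  rw [flow]
  dsimp only
  rw [hwi, hxi, theta_eX h hw]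
  rw [proj_eX h hw] at *
  have hamp := amp_pos (x := cw w) (Or.inr (norm_pos_iff.2 hr))
  refine ⟨?_, ⟨by rw [cw_upt _ hamp]; exact hw.1, ?_⟩, fun h0 => hp (by rw [h0, zero_mul])⟩
  · split_ifs with h0
    · rw [psi_cyl h hm hw.1, lft_eq_upt_dirU hp (abs_pos.1 h0) hr har]
    · rfl
  · rw [upt_mul _ hamp]
    simpa using hm

lemma proj_flow (ht : t ∈ Set.Icc (0 : ℝ) 1) (hp : proj ι δ d₀ p ≠ 0) :
    proj ι δ d₀ (flow ι h (t, p)) = radial δ t (proj ι δ d₀ p) := by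
  by_cases hx : xi p < lam - d₀
  · obtain ⟨h1, h2, -⟩ := flow_eq_of_xi_lt h ht hp hx
    rw [h1, proj_eX h h2, upt_mul]
    exact amp_pos (Or.inr (norm_pos_iff.2 (radial_ne_zero h.δ_pos ht hp)))
  · have hx' : 0 < xi p := h.c_pos.trans_le (not_lt.1 hx)
    rw [flow, if_pos hx']
    exact (psi_values h (radial_mem h.δ_pos ht hp (proj_mem h _)) (psi_proj_theta h hx').2.1).1

lemma flow_eq_self (ht : t ∈ Set.Icc (0 : ℝ) 1) (hp : proj ι δ d₀ p ≠ 0)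
    (hr : radial δ t (proj ι δ d₀ p) = proj ι δ d₀ p) : flow ι h (t, p) = p := by
  by_cases hx : xi p < lam - d₀
  · rw [(flow_eq_of_xi_lt h ht hp hx).1, hr]
    obtain ⟨w, hw, hc, rfl, hxi, hwi⟩ := exists_eX_of_xi_lt h hx
    rw [proj_eX h hw] at hp
    rw [hwi, proj_eX h hw, upt_dirU fun h0 => hp (by rw [h0, zero_mul])]
  · have hx' : 0 < xi p := h.c_pos.trans_le (not_lt.1 hx)
    rw [flow, if_pos hx', hr]
    exact (psi_proj_theta h hx').2.2

lemma continuousOn_flow [T2Space F] :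
    ContinuousOn (flow ι h) (Set.Icc (0 : ℝ) 1 ×ˢ offZero ι δ d₀) := by
  have hrad : ContinuousOn (fun y : ℝ × TotalSpace ι δ d₀ => radial δ y.1 (proj ι δ d₀ y.2))
      (Set.Icc (0 : ℝ) 1 ×ˢ offZero ι δ d₀) :=
    continuousOn_radial.comp (f := fun y : ℝ × TotalSpace ι δ d₀ => (y.1, proj ι δ d₀ y.2))
      (continuous_fst.prodMk (continuous_proj.comp continuous_snd)).continuousOn fun y hy => hy.2
  have hx : Continuous fun y : ℝ × TotalSpace ι δ d₀ => xi y.2 := continuous_xi.comp continuous_snd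
  refine continuousOn_of_cover (isOpen_lt continuous_const hx) (isOpen_lt hx continuous_const)
    (u := {y | 0 < xi y.2}) (v := {y | xi y.2 < lam - d₀}) ?_ ?_ ?_
  · exact fun y _ => (lt_or_ge 0 (xi y.2)).imp id fun h' => h'.trans_lt h.c_pos
  · refine ContinuousOn.congr ((psi_continuousOn (ι := ι) h).comp ((hrad.mono fun y hy => hy.1).prodMk
      ((continuousOn_theta h).comp continuousOn_snd fun y hy => hy.2)) ?_) fun y hy => if_pos hy.2
    exact fun y hy => ⟨radial_mem h.δ_pos hy.1.1 hy.1.2 (proj_mem h _),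
      (psi_proj_theta h hy.2).2.1⟩
  · have hw : ContinuousOn (fun y : ℝ × TotalSpace ι δ d₀ => winv y.2)
        ((Set.Icc (0 : ℝ) 1 ×ˢ offZero ι δ d₀) ∩ {y | xi y.2 < lam - d₀}) :=
      continuousOn_winv.comp continuousOn_snd fun y hy => hy.2
    refine ContinuousOn.congr ((eX_continuousOn h).comp (continuousOn_upt.comp
      ((hrad.mono fun y hy => hy.1).prodMk ((continuous_cw.comp_continuousOn hw).prodMk
        (continuousOn_dirU.comp hw fun y hy => ?_))) fun y hy => ?_) fun y hy => ?_) fun y hy => ?_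
    · exact (flow_eq_of_xi_lt h hy.1.1 hy.1.2 hy.2).2.2
    · exact amp_pos (Or.inr (norm_pos_iff.2 (radial_ne_zero h.δ_pos hy.1.1 hy.1.2)))
    · exact (flow_eq_of_xi_lt h hy.1.1 hy.1.2 hy.2).2.1
    · exact (flow_eq_of_xi_lt h hy.1.1 hy.1.2 hy.2).1

include h in
lemma boundary_subset_offZero : boundary ι δ d₀ ⊆ offZero ι δ d₀ := fun p hp h0 => by
  have hp' : ‖proj ι δ d₀ p‖ = δ := hp
  rw [h0, norm_zero] at hp'
  exact h.δ_pos.ne hp'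

lemma isOpen_offZero : IsOpen (offZero ι δ d₀) := isOpen_ne_fun continuous_proj continuous_const

/-- The complement of the singular fibre deforms to the boundary. -/
theorem Hres_boundary_bijective [T2Space F] : Function.Bijective
    (Hres (R := R) (n := n) (boundary_subset_offZero (ι := ι) h)) := by
  refine Hres_bijective_of_deformation _
    ⟨fun y => ⟨flow ι h (y.1, y.2), ?_⟩, ?_⟩ (fun p => ?_) (fun p => ?_) (fun t p hp => ?_)
  · change proj ι δ d₀ _ ≠ 0
    rw [proj_flow h y.1.2 y.2.2]
    exact radial_ne_zero h.δ_pos y.1.2 y.2.2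
  · exact Continuous.subtype_mk ((continuousOn_flow (ι := ι) h).comp_continuous (by fun_prop)
      fun y => ⟨y.1.2, y.2.2⟩) _
  · exact Subtype.ext (flow_eq_self h ⟨le_rfl, zero_le_one⟩ p.2 (radial_zero _))
  · change ‖proj ι δ d₀ (flow ι h (((1 : unitInterval) : ℝ), p))‖ = δ
    rw [proj_flow h (1 : unitInterval).2 p.2, norm_radial h.δ_pos (1 : unitInterval).2 p.2]
    simp
  · have hp' : ‖proj ι δ d₀ p‖ = δ := hp
    change ‖proj ι δ d₀ (flow ι h ((t : ℝ), p))‖ = δ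
    rw [proj_flow h t.2 p.2, norm_radial h.δ_pos t.2 p.2, hp']
    ring

/-! #### The critical point -/

/-- The equation x = 0 means |w₊| = |w₋|, and w₊w₋ = 0 then forces both to vanish. So the central
fibre meets {ξ = 0} in the critical point only. -/
lemma eq_crit_iff : p = eX ι h 0 ↔ ¬ (0 < xi p ∨ proj ι δ d₀ p ≠ 0) := by
  have h0 := zero_mem_Wm (lam := lam) h.lam_nonneg h.δ_pos.le
  constructor
  · rintro rfl
    rw [xi_eX h h0, proj_eX h h0]
    simp [cw, h.c_pos.le]
  · rw [not_or, not_lt, not_not]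
    rintro ⟨hx, hp⟩
    obtain ⟨w, hw, hc, rfl, hxi, hwi⟩ := exists_eX_of_xi_lt h (hx.trans_lt h.c_pos)
    rw [proj_eX h hw] at hp
    rw [hxi] at hx
    have h1 : cw w = 0 := abs_nonpos_iff.1 hx
    have h2 : ‖w.1‖ ^ 2 = ‖w.2‖ ^ 2 := by unfold cw at h1; linarith
    have h3 : w = 0 := by
      rcases mul_eq_zero.1 hp with h4 | h4
      · rw [h4, norm_zero] at h2
        exact Prod.ext h4 (norm_eq_zero.1 (pow_eq_zero_iff two_ne_zero |>.1
          (h2.symm.trans (by norm_num))))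
      · rw [h4, norm_zero] at h2
        exact Prod.ext (norm_eq_zero.1 (pow_eq_zero_iff two_ne_zero |>.1
          (h2.trans (by norm_num)))) h4
    rw [h3]

lemma mem_compl_crit : p ∈ ({eX ι h 0}ᶜ : Set (TotalSpace ι δ d₀)) ↔
    0 < xi p ∨ proj ι δ d₀ p ≠ 0 := by
  rw [Set.mem_compl_singleton_iff, Ne, eq_crit_iff, not_not]

lemma isOpen_compl_crit : IsOpen ({eX ι h 0}ᶜ : Set (TotalSpace ι δ d₀)) := by
  have : ({eX ι h 0}ᶜ : Set (TotalSpace ι δ d₀)) = {p | 0 < xi p} ∪ offZero ι δ d₀ :=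
    Set.ext fun p => mem_compl_crit h
  rw [this]
  exact (isOpen_lt continuous_const continuous_xi).union isOpen_offZero

-- Both inequalities are strict so that the image, cut out by ξ < lam - d₀ and |π| < δ, is open in
-- the total space.
include h in
lemma isOpenEmbedding_model {N : Set (ℂ × ℂ)}
    (hN : N = {w | |cw w| < lam - d₀ ∧ ‖w.1 * w.2‖ < δ})
    (hP : N ⊆ {w ∈ Wm lam δ | |cw w| < lam - d₀}) :
    IsOpenEmbedding (Subtype.val ∘ modelHomeo ι h N hP) := by
  have e : {p : TotalSpace ι δ d₀ | xi p < lam - d₀ ∧ winv p ∈ N} =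
      {p | xi p < lam - d₀} ∩ {p | ‖proj ι δ d₀ p‖ < δ} := by
    subst hN
    ext p
    refine and_congr_right fun hx => ?_
    obtain ⟨w, hw, hc, rfl, hxi, hwi⟩ := exists_eX_of_xi_lt h hx
    change (|cw (winv _)| < lam - d₀ ∧ ‖(winv _).1 * (winv _).2‖ < δ) ↔ ‖proj ι δ d₀ _‖ < δ
    rw [hwi, proj_eX h hw]
    exact and_iff_right hc
  have ho : IsOpen {p : TotalSpace ι δ d₀ | xi p < lam - d₀ ∧ winv p ∈ N} := by
    rw [e]
    exact (isOpen_lt continuous_xi continuous_const).inter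
      (isOpen_lt continuous_proj.norm continuous_const)
  exact ho.isOpenEmbedding_subtypeVal.comp (modelHomeo ι h N hP).isOpenEmbedding

/-- The local homology at the critical point vanishes in degrees two and three. -/
theorem Hr_compl_crit_subsingleton (hn : n = 2 ∨ n = 3) :
    Subsingleton (Hr R n ({eX ι h 0}ᶜ : Set (TotalSpace ι δ d₀))) := by
  set N : Set (ℂ × ℂ) := {w | |cw w| < lam - d₀ ∧ ‖w.1 * w.2‖ < δ} with hN
  have hNo : IsOpen N := (isOpen_lt continuous_cw.abs continuous_const).inter
    (isOpen_lt (continuous_fst.mul continuous_snd).norm continuous_const)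
  have hP : N ⊆ {w ∈ Wm lam δ | |cw w| < lam - d₀} :=
    fun w hw => ⟨⟨(hw.1.trans h.c_lt).le, hw.2.le⟩, hw.1⟩
  have h0 : (0 : ℂ × ℂ) ∈ N := by
    change |cw 0| < lam - d₀ ∧ ‖(0 : ℂ) * 0‖ < δ
    simpa [cw] using ⟨h.d₀_lt, h.δ_pos⟩
  have hne : ∀ w : ℂ × ℂ, w ∈ csusp ({0}ᶜ : Set ℂ) ↔ w ≠ 0 := fun w => by
    change (w.1 ≠ 0 ∨ w.2 ≠ 0) ↔ _
    rw [← not_and_or, ← Prod.mk_eq_zero]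
  let f : C(N, TotalSpace ι δ d₀) :=
    ⟨_, (isOpenEmbedding_model (ι := ι) h hN hP).continuous⟩
  have hf : ∀ w : N, f w ∈ ({eX ι h 0}ᶜ : Set (TotalSpace ι δ d₀)) ↔ (w : ℂ × ℂ) ≠ 0 := fun w => by
    have h1 : eX ι h w = eX ι h 0 ↔ (w : ℂ × ℂ) = 0 := by
      refine ⟨fun he => ?_, fun he => by rw [he]⟩
      have := congrArg winv he
      rwa [winv_eX h (hP w.2).1 (hP w.2).2, winv_eX h (hP h0).1 (hP h0).2] at this
    exact not_congr h1
  have hm1 : Set.MapsTo (subIncl N) {w | (w : ℂ × ℂ) ≠ 0} (csusp ({0}ᶜ : Set ℂ)) :=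
    fun w hw => (hne w).2 hw
  have hm2 : Set.MapsTo f {w | (w : ℂ × ℂ) ≠ 0} ({eX ι h 0}ᶜ : Set (TotalSpace ι δ d₀)) :=
    fun w hw => (hf w).2 hw
  have hc : csusp ({0}ᶜ : Set ℂ) = {0}ᶜ := Set.ext hne
  -- N is an open neighbourhood both of the origin in ℂ² and of the critical point in X; excising to
  -- N from either side compares the two local homologies.
  have h1 := Hmap_excision (R := R) (n := n) (f := subIncl N) hNo.isOpenEmbedding_subtypeVal
    (A := csusp ({0}ᶜ : Set ℂ)) (by rw [hc]; exact isOpen_compl_singleton)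
    (Set.eq_univ_of_forall fun w => by
      by_cases hw : w = 0
      · exact Or.inl ⟨⟨w, hw ▸ h0⟩, rfl⟩
      · exact Or.inr ((hne w).2 hw)) (Set.ext fun w => (hne w).symm) hm1
  have h2 := Hmap_excision (R := R) (n := n) (f := f) (isOpenEmbedding_model (ι := ι) h hN hP)
    (isOpen_compl_crit h) (Set.eq_univ_of_forall fun p => by
      by_cases hp : p = eX ι h 0
      · exact Or.inl ⟨⟨0, h0⟩, hp.symm⟩
      · exact Or.inr hp) (Set.ext fun w => (hf w).symm) hm2
  have := Hr_punctured_plane_sq_subsingleton (R := R) hn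
  have := h1.1.subsingleton
  exact h2.2.subsingleton

lemma isOpenEmbedding_ball_prod (Y : Type) [TopologicalSpace Y] : IsOpenEmbedding
    (Prod.map (Set.inclusion (Metric.ball_subset_closedBall (x := (0 : ℂ)) (ε := δ))) (id : Y → Y)) :=
  IsOpenEmbedding.prodMap ⟨.inclusion _, by
    rw [Set.range_inclusion]
    exact Metric.isOpen_ball.preimage continuous_subtype_val⟩ .id

include h in
/-- The homology of the trivial part relative to the complement of the central fibre. -/
theorem Hr_disk_prod_equiv (Y : Type) [TopologicalSpace Y] [PathConnectedSpace Y] :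
    Nonempty (Hr R 2 {y : Metric.closedBall (0 : ℂ) δ × Y | (y.1 : ℂ) ≠ 0} ≃ₗ[ℤ] R) := by
  have h0 : (0 : ℂ) ∈ Metric.ball (0 : ℂ) δ := Metric.mem_ball_self h.δ_pos
  let f : C(Metric.ball (0 : ℂ) δ × Y, Metric.closedBall (0 : ℂ) δ × Y) :=
    ⟨_, (isOpenEmbedding_ball_prod Y).continuous⟩
  have hg : IsOpenEmbedding (Prod.map (Subtype.val : Metric.ball (0 : ℂ) δ → ℂ) (id : Y → Y)) :=
    Metric.isOpen_ball.isOpenEmbedding_subtypeVal.prodMap .id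
  let g : C(Metric.ball (0 : ℂ) δ × Y, ℂ × Y) := ⟨_, hg.continuous⟩
  have hm1 : Set.MapsTo f {y | (y.1 : ℂ) ≠ 0} {y | (y.1 : ℂ) ≠ 0} := fun _ hy => hy
  have hm2 : Set.MapsTo g {y | (y.1 : ℂ) ≠ 0} (csusp (∅ : Set Y)) := fun _ hy => Or.inl hy
  -- The product with the open disk is open both in the product with the closed disk and in ℂ × Y;
  -- in the latter, double suspension applies.
  have h1 := Hmap_excision (R := R) (n := 2) (f := f) (isOpenEmbedding_ball_prod Y)
    (A := {y | (y.1 : ℂ) ≠ 0})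
    (isOpen_ne_fun (continuous_subtype_val.comp continuous_fst) continuous_const) (Set.eq_univ_of_forall fun y => by
      by_cases hy : (y.1 : ℂ) = 0
      · exact Or.inl ⟨(⟨0, h0⟩, y.2), Prod.ext (Subtype.ext hy.symm) rfl⟩
      · exact Or.inr hy) rfl hm1
  have hc : csusp (∅ : Set Y) = {y | y.1 ≠ 0} := Set.ext fun y => or_iff_left id
  have h2 := Hmap_excision (R := R) (n := 2) (f := g) hg (A := csusp (∅ : Set Y))
    (by rw [hc]; exact isOpen_ne_fun continuous_fst continuous_const)
    (Set.eq_univ_of_forall fun y => by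
      by_cases hy : y.1 = 0
      · exact Or.inl ⟨(⟨0, h0⟩, y.2), Prod.ext hy.symm rfl⟩
      · exact Or.inr (Or.inl hy)) (by rw [hc]; rfl) hm2
  exact ⟨(LinearEquiv.ofBijective _ h1).symm.trans ((LinearEquiv.ofBijective _ h2).trans
    ((Hr_csusp_equiv isOpen_empty).some.trans (Hr_zero_equiv R rfl).some))⟩

include h in
/-- The second homology of the total space relative to its boundary. -/
theorem Hr_two_boundary_equiv [T2Space F] [PathConnectedSpace (ι.vanishingCycleᶜ : Set F)] :
    Nonempty (Hr R 2 (boundary ι δ d₀) ≃ₗ[ℤ] R) := by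
  set Q : Set (TotalSpace ι δ d₀) := {eX ι h 0}ᶜ with hQ
  have hBQ : offZero ι δ d₀ ⊆ Q := fun p hp => (mem_compl_crit h).2 (Or.inr hp)
  -- In the triple offZero ⊆ Q ⊆ X the groups H_2(X, Q) and H_3(X, Q) vanish, so the critical point
  -- may be removed.
  have hsub : Function.Bijective (Hsub (R := R) (n := 2) Q (offZero ι δ d₀)) := by
    have h2 := Hr_compl_crit_subsingleton (ι := ι) (R := R) h (Or.inl rfl)
    have h3 := Hr_compl_crit_subsingleton (ι := ι) (R := R) h (Or.inr rfl)
    constructor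
    · rw [injective_iff_map_eq_zero]
      intro x hx
      obtain ⟨y, rfl⟩ := (exact_δ_sub hBQ x).1 hx
      rw [Subsingleton.elim (α := Hr R 3 Q) y 0, map_zero]
    · exact fun x => (exact_sub_res hBQ x).1 (Subsingleton.elim (α := Hr R 2 Q) _ _)
  let f : C(Metric.closedBall (0 : ℂ) δ × (ι.vanishingCycleᶜ : Set F), Q) :=
    ⟨fun y => ⟨trivMap ι h y, (mem_compl_crit h).2 (Or.inl (psi_values h y.1.2 y.2.2).2.2)⟩,
      Continuous.subtype_mk (trivMap ι h).continuous _⟩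
  have hf : IsOpenEmbedding f := IsOpenEmbedding.of_comp f
    (isOpen_compl_crit h).isOpenEmbedding_subtypeVal (trivMap_isOpenEmbedding h)
  have hp : ∀ y, (y.1 : ℂ) ≠ 0 ↔ f y ∈ inSub Q (offZero ι δ d₀) := fun y => by
    change _ ↔ proj ι δ d₀ (psi ι h (y.1, y.2)) ≠ 0
    rw [(psi_values h y.1.2 y.2.2).1]
  have hm : Set.MapsTo f {y | (y.1 : ℂ) ≠ 0} (inSub Q (offZero ι δ d₀)) := fun y hy => (hp y).1 hy
  -- Every point of Q is either off the central fibre or has ξ > 0, so the product part and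
  -- `offZero` cover Q.
  have h1 := Hmap_excision (R := R) (n := 2) (f := f) hf
    (isOpen_offZero.preimage continuous_subtype_val) (Set.eq_univ_of_forall fun p => by
      rcases (mem_compl_crit h).1 p.2 with hx | hx
      · left
        have : (p : TotalSpace ι δ d₀) ∈ Set.range (trivMap ι h) := by rwa [range_trivMap]
        obtain ⟨y, hy⟩ := this
        exact ⟨y, Subtype.ext hy⟩
      · exact Or.inr hx) (Set.ext hp) hm
  exact ⟨(LinearEquiv.ofBijective _ (Hres_boundary_bijective h)).trans
    ((LinearEquiv.ofBijective _ hsub).symm.trans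
      ((LinearEquiv.ofBijective _ h1).symm.trans (Hr_disk_prod_equiv h _).some))⟩

end Boundary

end ElemLefschetz

end

/-! ### The theorem -/

theorem mainTheorem9
    (F : Type) [TopologicalSpace F] (g : ℕ) (hg : 2 ≤ g)
    (hF : ElemLefschetz.IsClosedSurface F g)
    (lam δ d₀ : ℝ) (hd₀ : 0 < d₀) (hlam : d₀ < lam) (hδ : 0 < δ)
    (ι : ElemLefschetz.CylinderEmbedding F lam)
    (hι : IsConnected (ι.vanishingCycleᶜ)) :
    Nonempty (ElemLefschetz.H 2 (ElemLefschetz.TotalSpace ι δ d₀) ≃+ ℤ) ∧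
    (∀ z : ℂ, z ≠ 0 → ‖z‖ ≤ δ →
      Nonempty (ElemLefschetz.H 2 (ElemLefschetz.fibre ι δ d₀ z) ≃+ ℤ) ∧
      ∀ c : ElemLefschetz.H 2 (ElemLefschetz.fibre ι δ d₀ z),
        ElemLefschetz.IsGenerator c →
        ElemLefschetz.IsGenerator
          (ElemLefschetz.pushforward 2 (ElemLefschetz.fibre ι δ d₀ z) c)) ∧
    Nonempty (ElemLefschetz.relH 2 (ElemLefschetz.boundary ι δ d₀) ≃+ ℤ) ∧
    Nonempty (ElemLefschetz.H 1 (ElemLefschetz.TotalSpace ι δ d₀) ≃+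
      (Fin (2 * g - 1) → ℤ)) := by
  obtain ⟨hc, hconn, hT2, ⟨hch⟩, ho, ⟨eF⟩⟩ := hF
  have hM := ElemLefschetz.hasPlaneCharts_of_chartedSpace F
  have h : ElemLefschetz.IsAdm lam δ d₀ := ⟨hd₀, hlam, hδ⟩
  -- A surface is locally path connected, so F and the open set F ∖ V, being connected, are path
  -- connected.
  have := ChartedSpace.locallyPathConnectedSpace (EuclideanSpace ℝ (Fin 2)) F
  have : PathConnectedSpace F := pathConnectedSpace_iff_connectedSpace.2 hconn
  have : PathConnectedSpace (ι.vanishingCycleᶜ : Set F) :=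
    isPathConnected_iff_pathConnectedSpace.1
      ((ι.isClosed_V h.lam_nonneg).isOpen_compl.isConnected_iff_isPathConnected.1 hι)
  -- The twist takes place in width a and the neighbourhood of V has width b; any 0 < a < b < lam -
  -- d₀ would do.
  have ha : 0 < (lam - d₀) / 3 := div_pos h.c_pos (by norm_num)
  have hab : (lam - d₀) / 3 < (lam - d₀) / 2 := by linarith [h.c_pos]
  have hb : (lam - d₀) / 2 < lam - d₀ := by linarith [h.c_pos]
  have hδ' : (δ : ℂ) ∈ Metric.closedBall (0 : ℂ) δ := by simp [abs_of_pos hδ]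
  -- The fibre over z = δ serves as the regular fibre.
  obtain ⟨eX⟩ := ElemLefschetz.H_two_total_equiv (ι := ι) h hM ho hι ha hab hb
    (by exact_mod_cast hδ.ne') hδ'
  refine ⟨⟨eX⟩, fun z hz0 hz => ?_, ?_, ?_⟩
  · have hp := ElemLefschetz.pushforward_fibre_bijective (ι := ι) h hM ho hι ha hab hb hz0
      (mem_closedBall_zero_iff.2 hz)
    exact ⟨⟨(LinearEquiv.ofBijective
      (ElemLefschetz.pushforward 2 (ElemLefschetz.fibre ι δ d₀ z)).hom hp).toAddEquiv.trans eX⟩,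
      fun c hc => hc.map_of_surjective
        (ElemLefschetz.pushforward 2 (ElemLefschetz.fibre ι δ d₀ z)).hom.toAddMonoidHom hp.2⟩
  · obtain ⟨e⟩ := ElemLefschetz.Hr_two_boundary_equiv (ι := ι) (R := ElemLefschetz.Zc) h
    exact ⟨e.toAddEquiv⟩
  · exact ElemLefschetz.H_one_total_equiv h hM ho hι ha hab hb eF
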